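/- Let $r\in\mathbb Z_{\ge 0}\cup\{\infty\}$, let $N$ be a nonempty $C^\infty$ manifold (separable metrizable, possibly with boundary), let $\Gamma$ be a subgroup of ${\rm Diff}^\infty(N)$, and let $\pi:M\to S^1$ be a $C^\infty$ fiber bundle with fiber $N$ and structure group $\Gamma$, i.e. a $C^\infty$ locally trivial bundle with a maximal atlas of local trivializations whose transition functions take values in $\Gamma$. Bundle diffeomorphisms. For a $C^\infty$ fiber bundle $\pi:M\to B$ with fiber $N$ and structure group $\Gamma$, ${\rm Diff}^r_\pi(M)$ is the group of $C^r$ diffeomorphisms $f$ of $M$ with $\pi f=\underline f\,\pi$ for some $\underline f:B\to B$ which are fiberwise, in local trivializations, given by elements of $\Gamma$. ${\rm Isot}^r_\pi(M)_0$ is the group of $C^r$ isotopies $F=(F_t)_{t\in[0,1]}$ of $M$ with $F_0={\rm id}_M$ and $F_t\in{\rm Diff}^r_\pi(M)$ for all $t$ (with $(FG)_t=F_tG_t$); ${\rm Isot}^r_\pi(M)_{{\rm id},{\rm id}}$ is its subgroup of those $F$ with $F_1={\rm id}_M$; and ${\rm Diff}^r_\pi(M)_0=\{F_1\mid F\in{\rm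 Isot}^r_\pi(M)_0\}$. Using only those $F$ whose support lies in $\pi^{-1}(K)$ for some compact $K\subset B$ one gets ${\rm Diff}^r_{\pi,c}(M)_0$; for $C\subset B$, using only those $F$ for which all $F_t$ are the identity on $\pi^{-1}(U)$ for some neighborhood $U$ of $C$ one gets ${\rm Diff}^r_\pi(M;C)_0$. The invariants. Let $\pi_{S^1}:\mathbb R\to\mathbb R/\mathbb Z\cong S^1$ be the universal covering, and for a path $c:[0,1]\to S^1$ with lift $\tilde c:[0,1]\to\mathbb R$ put $\lambda(c)=\tilde c(1)-\tilde c(0)$. Fix $p\in S^1$ and put $\nu(F)=\lambda\big(t\mapsto\underline{F_t}(p)\big)$ for $F\in{\rm Isot}^r_\pi(M)_0$. There is a unique integer $k=k(\pi,r)\ge 0$ with $\nu\big({\rm Isot}^r_\pi(M)_{{\rm id},{\rm id}}\big)=k\mathbb Z$, and $\widehat\nu:{\rm Diff}^r_\pi(M)_0\to\mathbb R/k\mathbb Z$, $\widehat\nu(F_1)=[\nu(F)]$, is well defined. For $f\in{\rm Diff}^r_\pi(M)_0$, $clb_\pi f\in\mathbb Z_{\ge 0}\cup\{\infty\}$ is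 the least number of factors in an expression of $f$ as a product of commutators $[a,b]$, each with $a,b\in{\rm Diff}^r_\pi(M;S^1\setminus{\rm Int}\,D)_0$ for some closed arc $D\subsetneq S^1$ (depending on the factor), and $\infty$ if there is none. Theorem. Assume that $k=k(\pi,r)\ge 1$ and that $(\ast)$ for every open interval $J$ and the trivial bundle $\varrho:L=J\times N\to J$ with fiber $N$ and structure group $\Gamma$, the group ${\rm Diff}^r_{\varrho,c}(L)_0$ is perfect. If $f\in{\rm Diff}^r_\pi(M)_0$ and $\widehat\nu(f)=[s]$ with $s\in(-k/2,k/2]$, then $$clb_\pi f\le 2\lfloor|s|\rfloor+3\le k+3 .$$ -/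

import Mathlib

open scoped Manifold ContDiff unitInterval

/-! ### Groups of diffeomorphisms and of isotopies of a manifold -/

section Manifold

variable {E : Type*} [NormedAddCommGroup E] [NormedSpace ℝ E] {H : Type*} [TopologicalSpace H]
  (I' : ModelWithCorners ℝ E H) (M : Type*) [TopologicalSpace M] [ChartedSpace H M]

/-- The group `Diff^r(M)` of `C^r` diffeomorphisms of `M`, where `r` is a natural number or `∞`. -/
def diffGroup (r : ℕ∞) : Subgroup (Equiv.Perm M) where
  carrier := {f | ContMDiff I' I' r f ∧ ContMDiff I' I' r f.symm}
  one_mem' := ⟨contMDiff_id, contMDiff_id⟩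
  mul_mem' := fun hf hg => ⟨hf.1.comp hg.1, hg.2.comp hf.2⟩
  inv_mem' := fun hf => ⟨hf.2, hf.1⟩

/-- The group `Isot^r(M)` of `C^r` isotopies `F = (F_t)_{t ∈ [0,1]}` of `M`: the map
`(x, t) ↦ (F_t x, t)` is a `C^r` diffeomorphism of `M × [0,1]`. The group law is
`(F G)_t = F_t G_t`. -/
def isotGroup (r : ℕ∞) : Subgroup (I → Equiv.Perm M) where
  carrier := {F | ContMDiff (I'.prod (𝓡∂ 1)) I' r (fun z : M × I => F z.2 z.1) ∧
    ContMDiff (I'.prod (𝓡∂ 1)) I' r (fun z : M × I => (F z.2).symm z.1)}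
  one_mem' := ⟨contMDiff_fst, contMDiff_fst⟩
  mul_mem' := fun hF hG => ⟨hF.1.comp (hG.1.prodMk contMDiff_snd),
    hG.2.comp (hF.2.prodMk contMDiff_snd)⟩
  inv_mem' := fun hF => ⟨hF.2, hF.1⟩

end Manifold

/-! ### Fiber bundles with fiber `N` and structure group `Γ` -/

section Bundle

variable {EB : Type*} [NormedAddCommGroup EB] [NormedSpace ℝ EB] {HB : Type*} [TopologicalSpace HB]
  {EN : Type*} [NormedAddCommGroup EN] [NormedSpace ℝ EN] {HN : Type*} [TopologicalSpace HN]
  {EM : Type*} [NormedAddCommGroup EM] [NormedSpace ℝ EM] {HM : Type*} [TopologicalSpace HM]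
  {B : Type*} [TopologicalSpace B] [ChartedSpace HB B]
  {N : Type*} [TopologicalSpace N] [ChartedSpace HN N]
  {M : Type*} [TopologicalSpace M] [ChartedSpace HM M]

/-- A local trivialization `φ : π⁻¹(U) → U × N` is smooth if it is a `C^∞` diffeomorphism. -/
def SmoothTriv (IB : ModelWithCorners ℝ EB HB) (IN : ModelWithCorners ℝ EN HN)
    (IM : ModelWithCorners ℝ EM HM) {π : M → B} (e : Bundle.Trivialization N π) : Prop :=
  ContMDiffOn IM (IB.prod IN) ∞ e e.source ∧
    ContMDiffOn (IB.prod IN) IM ∞ e.toOpenPartialHomeomorph.symm e.target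

/-- Two local trivializations `(U, φ)`, `(V, ψ)` are `Γ`-compatible if `ψ_q φ_q⁻¹ ∈ Γ` for all
`q ∈ U ∩ V`. -/
def GammaCompat (Γ : Subgroup (Equiv.Perm N)) {π : M → B} (e e' : Bundle.Trivialization N π) :
    Prop :=
  ∀ q ∈ e.baseSet ∩ e'.baseSet, ∃ γ ∈ Γ, ∀ x : N,
    (e' (e.toOpenPartialHomeomorph.symm (q, x))).2 = γ x

/-- A `C^∞` fiber bundle `π : M → B` with fiber `N` and structure group `Γ`: the map `π` together
with a maximal `Γ`-atlas of smooth local trivializations. -/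
structure GammaBundle (IB : ModelWithCorners ℝ EB HB) (IN : ModelWithCorners ℝ EN HN)
    (IM : ModelWithCorners ℝ EM HM) (Γ : Subgroup (Equiv.Perm N)) (π : M → B) where
  /-- the local trivializations of the bundle -/
  atlas : Set (Bundle.Trivialization N π)
  smooth : ∀ e ∈ atlas, SmoothTriv IB IN IM e
  cover : ∀ q : B, ∃ e ∈ atlas, q ∈ e.baseSet
  compat : ∀ e ∈ atlas, ∀ e' ∈ atlas, GammaCompat Γ e e'
  maximal : ∀ e : Bundle.Trivialization N π, SmoothTriv IB IN IM e →
    (∀ e' ∈ atlas, GammaCompat Γ e e' ∧ GammaCompat Γ e' e) → e ∈ atlas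

namespace GammaBundle

variable {IB : ModelWithCorners ℝ EB HB} {IN : ModelWithCorners ℝ EN HN}
  {IM : ModelWithCorners ℝ EM HM} {Γ : Subgroup (Equiv.Perm N)} {π : M → B}

/-- `f` covers `g : B → B` and is, fiberwise and in local trivializations, given by elements of
`Γ`. -/
def Covers (ξ : GammaBundle IB IN IM Γ π) (f : M → M) (g : B → B) : Prop :=
  (∀ x, π (f x) = g (π x)) ∧
    ∀ e ∈ ξ.atlas, ∀ e' ∈ ξ.atlas, ∀ q ∈ e.baseSet, g q ∈ e'.baseSet →
      ∃ γ ∈ Γ, ∀ x : N, (e' (f (e.toOpenPartialHomeomorph.symm (q, x)))).2 = γ x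

variable (ξ : GammaBundle IB IN IM Γ π)

theorem proj_symm {e : Bundle.Trivialization N π} {q : B} (hq : q ∈ e.baseSet) (x : N) :
    π (e.toOpenPartialHomeomorph.symm (q, x)) = q :=
  e.proj_symm_apply' hq

theorem symm_surj {e : Bundle.Trivialization N π} {y : M} (hy : π y ∈ e.baseSet) :
    e.toOpenPartialHomeomorph.symm (π y, (e y).2) = y := by
  have hs : y ∈ e.source := e.mem_source.2 hy
  have : e y = (π y, (e y).2) := Prod.ext (e.coe_fst hs) rfl
  rw [← this]
  exact e.toOpenPartialHomeomorph.left_inv hs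

theorem snd_symm {e : Bundle.Trivialization N π} {q : B} (hq : q ∈ e.baseSet) (x : N) :
    (e (e.toOpenPartialHomeomorph.symm (q, x))).2 = x := by
  rw [e.apply_symm_apply' hq]

theorem surjective (ξ : GammaBundle IB IN IM Γ π) [Nonempty N] :
    Function.Surjective π := fun q => by
  obtain ⟨e, -, hq⟩ := ξ.cover q
  exact ⟨_, proj_symm hq (Classical.arbitrary N)⟩

theorem Covers.mul {ξ : GammaBundle IB IN IM Γ π} {f f' : M → M} {g g' : B → B}
    (h : ξ.Covers f g) (h' : ξ.Covers f' g') : ξ.Covers (f ∘ f') (g ∘ g') := by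
  refine ⟨fun x => by simp [h.1, h'.1], fun e he e' he' q hq hq' => ?_⟩
  obtain ⟨e₂, he₂, hq₂⟩ := ξ.cover (g' q)
  obtain ⟨γ', hγ', hx'⟩ := h'.2 e he e₂ he₂ q hq hq₂
  obtain ⟨γ, hγ, hx⟩ := h.2 e₂ he₂ e' he' (g' q) hq₂ hq'
  refine ⟨γ * γ', Γ.mul_mem hγ hγ', fun x => ?_⟩
  have hp : π (f' (e.toOpenPartialHomeomorph.symm (q, x))) = g' q := by
    rw [h'.1, proj_symm hq]
  have := symm_surj (e := e₂) (y := f' (e.toOpenPartialHomeomorph.symm (q, x))) (by rwa [hp])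
  rw [hp, hx'] at this
  simp only [Function.comp_apply, Equiv.Perm.coe_mul]
  rw [← this, hx]

theorem Covers.one : ξ.Covers id id :=
  ⟨fun _ => rfl, fun e he e' he' q hq hq' => ξ.compat e he e' he' q ⟨hq, hq'⟩⟩

theorem Covers.inv {ξ : GammaBundle IB IN IM Γ π} {f : Equiv.Perm M} {g : B → B}
    (h : ξ.Covers f g) : ∃ g' : B → B, ξ.Covers f.symm g' := by
  classical
  rcases isEmpty_or_nonempty N with hN | hN
  · have hM : IsEmpty M := ⟨fun y => by
      obtain ⟨e, -, hq⟩ := ξ.cover (π y)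
      exact hN.elim (e y).2⟩
    exact ⟨id, fun x => hM.elim x,
      fun e he e' he' q hq hq' => ⟨1, Γ.one_mem, fun x => hN.elim x⟩⟩
  have hinj : Function.Injective g := by
    intro q q' hqq
    obtain ⟨e, he, hq⟩ := ξ.cover q
    obtain ⟨e', he', hq'⟩ := ξ.cover q'
    obtain ⟨e₂, he₂, hq₂⟩ := ξ.cover (g q)
    obtain ⟨γ, -, hx⟩ := h.2 e he e₂ he₂ q hq hq₂
    obtain ⟨γ', -, hx'⟩ := h.2 e' he' e₂ he₂ q' hq' (hqq ▸ hq₂)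
    let y : N := Classical.arbitrary N
    set a := e.toOpenPartialHomeomorph.symm (q, γ.symm (γ' y)) with ha
    set b := e'.toOpenPartialHomeomorph.symm (q', y) with hb
    have pa : π (f a) = g q := by rw [h.1, ha, proj_symm hq]
    have pb : π (f b) = g q := by rw [h.1, hb, proj_symm hq', hqq]
    have h1 := symm_surj (e := e₂) (y := f a) (by rwa [pa])
    have h2 := symm_surj (e := e₂) (y := f b) (by rwa [pb])
    rw [pa, ha, hx, Equiv.apply_symm_apply] at h1
    rw [pb, hb, hx'] at h2
    have hab : a = b := f.injective (by rw [ha, ← h1, h2])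
    rw [← proj_symm hq (γ.symm (γ' y)), ← proj_symm hq' y]
    exact congrArg π hab
  have hsurj : Function.Surjective g := fun q => by
    obtain ⟨y, hy⟩ := ξ.surjective q
    exact ⟨π (f.symm y), by rw [← h.1, Equiv.apply_symm_apply, hy]⟩
  let G : Equiv.Perm B := Equiv.ofBijective g ⟨hinj, hsurj⟩
  have hG : ∀ q, g (G.symm q) = q := G.apply_symm_apply
  have h1 : ∀ x, π (f.symm x) = G.symm (π x) := fun x => hinj (by
    rw [← h.1, hG, Equiv.apply_symm_apply])
  refine ⟨G.symm, h1, fun e he e' he' q hq hq' => ?_⟩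
  obtain ⟨γ, hγ, hx⟩ := h.2 e' he' e he (G.symm q) hq' (by rwa [hG])
  refine ⟨γ⁻¹, Γ.inv_mem hγ, fun x => ?_⟩
  set y := f.symm (e.toOpenPartialHomeomorph.symm (q, x)) with hy
  have py : π y = G.symm q := by rw [hy, h1, proj_symm hq]
  have h2 := symm_surj (e := e') (y := y) (by rwa [py])
  rw [py] at h2
  have h3 := hx (e' y).2
  rw [h2, hy, Equiv.apply_symm_apply, snd_symm hq] at h3
  exact Equiv.Perm.eq_inv_iff_eq.2 h3.symm

/-- The group `Diff^r_π(M)` of `C^r` bundle diffeomorphisms. -/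
def bundleDiff (r : ℕ∞) : Subgroup (Equiv.Perm M) where
  carrier := {f | f ∈ diffGroup IM M r ∧ ∃ g : B → B, ξ.Covers f g}
  one_mem' := ⟨Subgroup.one_mem _, id, Covers.one ξ⟩
  mul_mem' := fun ⟨h1, _, hg⟩ ⟨h1', _, hg'⟩ => ⟨Subgroup.mul_mem _ h1 h1', _, hg.mul hg'⟩
  inv_mem' := fun ⟨h1, _, hg⟩ => ⟨Subgroup.inv_mem _ h1, hg.inv⟩

/-- The group `Isot^r_π(M)_0` of `C^r` isotopies `F` of bundle diffeomorphisms with `F_0 = id`. -/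
def isot₀ (r : ℕ∞) : Subgroup (I → Equiv.Perm M) where
  carrier := {F | F ∈ isotGroup IM M r ∧ (∀ t, F t ∈ ξ.bundleDiff r) ∧ F 0 = 1}
  one_mem' := ⟨Subgroup.one_mem _, fun _ => Subgroup.one_mem _, rfl⟩
  mul_mem' := fun {F G} hF hG => ⟨Subgroup.mul_mem _ hF.1 hG.1,
    fun t => Subgroup.mul_mem _ (hF.2.1 t) (hG.2.1 t), by simp [hF.2.2, hG.2.2]⟩
  inv_mem' := fun {F} hF => ⟨Subgroup.inv_mem _ hF.1,
    fun t => Subgroup.inv_mem _ (hF.2.1 t), by simp [hF.2.2]⟩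

/-- The group `Isot^r_π(M)_{id,id}` of the `F ∈ Isot^r_π(M)_0` with `F_1 = id`. -/
def isotLoop (r : ℕ∞) : Subgroup (I → Equiv.Perm M) :=
  ξ.isot₀ r ⊓ (Pi.evalMonoidHom (fun _ : I => Equiv.Perm M) 1).ker

/-- The group `Isot^r_π(M; C)_0` of the `F ∈ Isot^r_π(M)_0` for which every `F_t` is the identity
on `π⁻¹(U)`, for some neighborhood `U` of `C` in `B`. -/
def isotRel (r : ℕ∞) (C : Set B) : Subgroup (I → Equiv.Perm M) where
  carrier := {F | F ∈ ξ.isot₀ r ∧ ∃ U : Set B, IsOpen U ∧ C ⊆ U ∧ ∀ t x, π x ∈ U → F t x = x}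
  one_mem' := ⟨Subgroup.one_mem _, Set.univ, isOpen_univ, Set.subset_univ _, fun _ _ _ => rfl⟩
  mul_mem' := fun {F G} ⟨hF, U, hU, hCU, h⟩ ⟨hG, V, hV, hCV, h'⟩ =>
    ⟨Subgroup.mul_mem _ hF hG, U ∩ V, hU.inter hV, Set.subset_inter hCU hCV, fun t x hx => by
      simp [h' t x hx.2, h t x hx.1]⟩
  inv_mem' := fun {F} ⟨hF, U, hU, hCU, h⟩ => ⟨Subgroup.inv_mem _ hF, U, hU, hCU, fun t x hx => by
    simpa using (Equiv.Perm.inv_eq_iff_eq (f := F t)).2 (h t x hx).symm⟩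

/-- The support of an isotopy: the closure of the union of the supports of the `F_t`. -/
def isotSupport (F : I → Equiv.Perm M) : Set M := closure (⋃ t, {x | F t x ≠ x})

/-- The group `Isot^r_{π,c}(M)_0` of the `F ∈ Isot^r_π(M)_0` with compact support with respect
to `π`: the support of `F` lies in `π⁻¹(K)` for some compact `K ⊆ B`. -/
def isotC (r : ℕ∞) : Subgroup (I → Equiv.Perm M) where
  carrier := {F | F ∈ ξ.isot₀ r ∧ ∃ K : Set B, IsCompact K ∧ isotSupport F ⊆ π ⁻¹' K}
  one_mem' := ⟨Subgroup.one_mem _, ∅, isCompact_empty, by simp [isotSupport]⟩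
  mul_mem' := fun {F G} ⟨hF, K, hK, h⟩ ⟨hG, L, hL, h'⟩ =>
    ⟨Subgroup.mul_mem _ hF hG, K ∪ L, hK.union hL, by
      rw [Set.preimage_union]
      refine Set.Subset.trans ?_ (Set.union_subset_union h h')
      rw [isotSupport, isotSupport, isotSupport, ← closure_union, ← Set.iUnion_union_distrib]
      refine closure_mono (Set.iUnion_mono fun t x hx => ?_)
      by_contra hc
      simp only [Set.mem_union, Set.mem_ofPred_eq, not_or, not_not] at hc
      exact hx (by simp [hc.1, hc.2])⟩
  inv_mem' := fun {F} ⟨hF, K, hK, h⟩ => ⟨Subgroup.inv_mem _ hF, K, hK, by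
    refine Set.Subset.trans (closure_mono (Set.iUnion_mono fun t x hx => ?_)) h
    exact fun hc => hx (by simpa using (Equiv.Perm.inv_eq_iff_eq (f := F t)).2 hc.symm)⟩

/-- `Diff^r_π(M)_0 = {F_1 | F ∈ Isot^r_π(M)_0}`. -/
def diff₀ (r : ℕ∞) : Subgroup (Equiv.Perm M) :=
  (ξ.isot₀ r).map (Pi.evalMonoidHom (fun _ : I => Equiv.Perm M) 1)

/-- `Diff^r_π(M; C)_0 = {F_1 | F ∈ Isot^r_π(M; C)_0}`. -/
def diffRel (r : ℕ∞) (C : Set B) : Subgroup (Equiv.Perm M) :=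
  (ξ.isotRel r C).map (Pi.evalMonoidHom (fun _ : I => Equiv.Perm M) 1)

/-- `Diff^r_{π,c}(M)_0 = {F_1 | F ∈ Isot^r_{π,c}(M)_0}`. -/
def diffC (r : ℕ∞) : Subgroup (Equiv.Perm M) :=
  (ξ.isotC r).map (Pi.evalMonoidHom (fun _ : I => Equiv.Perm M) 1)

end GammaBundle

/-- The product bundle `B × N → B` with fiber `N` and structure group `Γ`: its local
trivializations are the smooth ones that are `Γ`-compatible with the identity of `B × N`. -/
def productBundle (IB : ModelWithCorners ℝ EB HB) (IN : ModelWithCorners ℝ EN HN)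
    (Γ : Subgroup (Equiv.Perm N)) :
    GammaBundle IB IN (IB.prod IN) Γ (Prod.fst : B × N → B) where
  atlas := {e | SmoothTriv IB IN (IB.prod IN) e ∧
    ∀ q ∈ e.baseSet, ∃ γ ∈ Γ, ∀ x : N, (e (q, x)).2 = γ x}
  smooth := fun e he => he.1
  cover := fun q => ⟨⟨OpenPartialHomeomorph.refl (B × N), Set.univ, isOpen_univ, by simp, by simp,
      fun _ _ => rfl⟩, ⟨⟨contMDiffOn_id, contMDiffOn_id⟩, fun q _ => ⟨1, Γ.one_mem, fun _ => rfl⟩⟩,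
      Set.mem_univ q⟩
  compat := fun e he e' he' q hq => by
    obtain ⟨γ, hγ, h⟩ := he.2 q hq.1
    obtain ⟨γ', hγ', h'⟩ := he'.2 q hq.2
    refine ⟨γ' * γ⁻¹, Γ.mul_mem hγ' (Γ.inv_mem hγ), fun x => ?_⟩
    have h1 := GammaBundle.symm_surj (e := e) (y := (q, γ⁻¹ x)) hq.1
    have h2 : γ (γ⁻¹ x) = x := γ.apply_symm_apply x
    rw [h, h2] at h1
    rw [h1, h']
    rfl
  maximal := fun e he h => ⟨he, fun q hq => by
    have := (h ⟨OpenPartialHomeomorph.refl (B × N), Set.univ, isOpen_univ, by simp, by simp,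
      fun _ _ => rfl⟩ ⟨⟨contMDiffOn_id, contMDiffOn_id⟩,
        fun q _ => ⟨1, Γ.one_mem, fun _ => rfl⟩⟩).2 q ⟨Set.mem_univ q, hq⟩
    exact this⟩

/-- Assumption `(∗)` on `(N, Γ, r)`: for every (nonempty) open interval `J`, the group
`Diff^r_{ϱ,c}(J × N)_0` of the trivial bundle `ϱ : J × N → J` with fiber `N` and structure group
`Γ` is perfect. -/
def AssumptionStar (IN : ModelWithCorners ℝ EN HN) (Γ : Subgroup (Equiv.Perm N)) (r : ℕ∞) : Prop :=
  ∀ J : TopologicalSpace.Opens ℝ, (J : Set ℝ).Nonempty → (J : Set ℝ).OrdConnected →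
    Group.IsPerfect ((productBundle 𝓘(ℝ, ℝ) IN Γ :
      GammaBundle 𝓘(ℝ, ℝ) IN (𝓘(ℝ, ℝ).prod IN) Γ (Prod.fst : J × N → J)).diffC r)

end Bundle

/-! ### Winding numbers, and bundles over the circle -/

section CircleBundle

/-- The universal covering `ℝ → S¹` with covering transformation group `ℤ`. -/
noncomputable def circleCover (s : ℝ) : Circle := Circle.exp (2 * Real.pi * s)

theorem continuous_circleCover : Continuous circleCover :=
  Circle.exp.continuous.comp (continuous_const.mul continuous_id)

theorem circleCover_eq_iff {s t : ℝ} : circleCover s = circleCover t ↔ ∃ m : ℤ, s = t + m := by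
  rw [circleCover, circleCover, Circle.exp_eq_exp]
  refine exists_congr fun m => ⟨fun h => ?_, fun h => by rw [h]; ring⟩
  have h2 : (2 * Real.pi) ≠ 0 := by positivity
  have : 2 * Real.pi * (s - (t + m)) = 0 := by linarith
  rcases mul_eq_zero.1 this with h | h
  · exact absurd h h2
  · linarith

theorem isCoveringMap_circleCover : IsCoveringMap circleCover :=
  Circle.isCoveringMap_exp.comp_homeomorph
    (Homeomorph.mulLeft₀ (2 * Real.pi) (by positivity))

open Classical in
/-- The winding number `λ(c) = c̃(1) - c̃(0)` of a path `c` in the circle, where `c̃` is a lift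
of `c` to `ℝ`. -/
noncomputable def windingNumber (c : I → Circle) : ℝ :=
  if h : ∃ c' : C(I, ℝ), ∀ t, circleCover (c' t) = c t then h.choose 1 - h.choose 0 else 0

theorem windingNumber_eq {c : I → Circle} (c' : C(I, ℝ)) (hc : ∀ t, circleCover (c' t) = c t) :
    windingNumber c = c' 1 - c' 0 := by
  have h : ∃ c' : C(I, ℝ), ∀ t, circleCover (c' t) = c t := ⟨c', hc⟩
  rw [windingNumber, dif_pos h]
  obtain ⟨m, hm⟩ := circleCover_eq_iff.1 ((h.choose_spec 0).trans (hc 0).symm)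
  have := isCoveringMap_circleCover.eq_of_comp_eq (g₁ := h.choose)
    (g₂ := fun t => c' t + m) h.choose.continuous (by fun_prop)
    (funext fun t => by
      simp only [Function.comp_apply]
      rw [h.choose_spec t, ← hc t]
      exact circleCover_eq_iff.2 ⟨-m, by push_cast; ring⟩) 0 hm
  have h1 := congrFun this 1
  rw [h1, hm]
  ring

theorem exists_lift {c : I → Circle} (hc : Continuous c) :
    ∃ c' : C(I, ℝ), ∀ t, circleCover (c' t) = c t := by
  obtain ⟨s, hs⟩ : ∃ s, circleCover s = c 0 := by
    obtain ⟨u, hu⟩ := Circle.exp_surjective (c 0)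
    refine ⟨u / (2 * Real.pi), ?_⟩
    rw [circleCover, mul_div_cancel₀ _ (by positivity), hu]
  obtain ⟨c', h, -⟩ := isCoveringMap_circleCover.exists_path_lifts ⟨c, hc⟩ s hs.symm
  exact ⟨c', fun t => congrFun h t⟩

theorem windingNumber_square (K : C(I × I, Circle)) :
    windingNumber (fun t => K (t, t)) =
      windingNumber (fun t => K (0, t)) + windingNumber (fun s => K (s, 1)) := by
  obtain ⟨a, ha⟩ := exists_lift (c := fun t => K (0, t)) (by fun_prop)
  have hK : ∀ t, K (0, t) = circleCover (a t) := fun t => (ha t).symm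
  have hl := isCoveringMap_circleCover.liftHomotopy_lifts K a hK
  set L := isCoveringMap_circleCover.liftHomotopy K a hK
  have hL : ∀ z, circleCover (L z) = K z := fun z => congrFun hl z
  rw [windingNumber_eq ⟨fun t => L (t, t), by fun_prop⟩ (fun t => hL (t, t)),
    windingNumber_eq ⟨fun t => L (0, t), by fun_prop⟩ (fun t => hL (0, t)),
    windingNumber_eq ⟨fun t => L (t, 1), by fun_prop⟩ (fun t => hL (t, 1))]
  simp

variable {EN : Type*} [NormedAddCommGroup EN] [NormedSpace ℝ EN] {HN : Type*} [TopologicalSpace HN]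
  {EM : Type*} [NormedAddCommGroup EM] [NormedSpace ℝ EM] {HM : Type*} [TopologicalSpace HM]
  {N : Type*} [TopologicalSpace N] [ChartedSpace HN N]
  {M : Type*} [TopologicalSpace M] [ChartedSpace HM M]
  {IN : ModelWithCorners ℝ EN HN} {IM : ModelWithCorners ℝ EM HM} {Γ : Subgroup (Equiv.Perm N)}
  {π : M → Circle}

open Classical in
/-- The map `g` induced on the base by a bundle map `f`, i.e. the one with `π f = g π`. -/
noncomputable def baseMap (π : M → Circle) (f : M → M) : Circle → Circle :=
  if h : ∃ g : Circle → Circle, ∀ x, π (f x) = g (π x) then h.choose else id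

/-- `ν(F)` is the winding number of the path `t ↦ g_t(p)`, where `g_t` is induced by `F_t`. -/
noncomputable def nu (π : M → Circle) (p : Circle) (F : I → Equiv.Perm M) : ℝ :=
  windingNumber (fun t => baseMap π (F t) p)

namespace GammaBundle

theorem baseMap_apply (ξ : GammaBundle (𝓡 1) IN IM Γ π) {r : ℕ∞} {f : Equiv.Perm M}
    (hf : f ∈ ξ.bundleDiff r) (x : M) : baseMap π f (π x) = π (f x) := by
  have h : ∃ g : Circle → Circle, ∀ x, π (f x) = g (π x) := hf.2.imp fun _ hg => hg.1
  rw [baseMap, dif_pos h]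
  exact (h.choose_spec x).symm

theorem continuous_proj (ξ : GammaBundle (𝓡 1) IN IM Γ π) : Continuous π :=
  continuous_iff_continuousAt.2 fun x => by
    obtain ⟨e, -, he⟩ := ξ.cover (π x)
    exact e.continuousAt_proj (e.mem_source.2 he)

theorem nu_eq (ξ : GammaBundle (𝓡 1) IN IM Γ π) {r : ℕ∞} {F : I → Equiv.Perm M}
    (hF : F ∈ ξ.isot₀ r) (x : M) : nu π (π x) F = windingNumber (fun t => π (F t x)) := by
  rw [nu]
  exact congrArg _ (funext fun t => ξ.baseMap_apply (hF.2.1 t) x)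

theorem continuous_path (ξ : GammaBundle (𝓡 1) IN IM Γ π) {r : ℕ∞} {F : I → Equiv.Perm M}
    (hF : F ∈ ξ.isot₀ r) : Continuous (fun z : M × I => F z.2 z.1) :=
  hF.1.1.continuous

theorem nu_mul (ξ : GammaBundle (𝓡 1) IN IM Γ π) [Nonempty N] {r : ℕ∞} (p : Circle)
    {F G : I → Equiv.Perm M} (hF : F ∈ ξ.isot₀ r) (hG : G ∈ ξ.isotLoop r) :
    nu π p (F * G) = nu π p F + nu π p G := by
  obtain ⟨x, rfl⟩ := ξ.surjective p
  have hG1 : G 1 = 1 := hG.2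
  rw [ξ.nu_eq (Subgroup.mul_mem _ hF hG.1), ξ.nu_eq hF, ξ.nu_eq hG.1]
  have cF := ξ.continuous_path hF
  have cG := ξ.continuous_path hG.1
  have cπ := ξ.continuous_proj
  have cg : Continuous (fun z : I × I => (G z.2 x, z.1)) :=
    (cG.comp (f := fun z : I × I => (x, z.2)) (by fun_prop)).prodMk continuous_fst
  have := windingNumber_square ⟨fun z : I × I => π (F z.1 (G z.2 x)), cπ.comp (cF.comp cg)⟩
  simp only [ContinuousMap.coe_mk, hF.2.2, hG1, Equiv.Perm.coe_one, id] at this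
  simp only [Pi.mul_apply, Equiv.Perm.coe_mul, Function.comp_apply]
  rw [this, add_comm]

theorem nu_loop_int (ξ : GammaBundle (𝓡 1) IN IM Γ π) [Nonempty N] {r : ℕ∞} (p : Circle)
    {G : I → Equiv.Perm M} (hG : G ∈ ξ.isotLoop r) : ∃ m : ℤ, nu π p G = m := by
  obtain ⟨x, rfl⟩ := ξ.surjective p
  have hG0 : G 0 = 1 := hG.1.2.2
  have hG1 : G 1 = 1 := hG.2
  have cG := ξ.continuous_path hG.1
  obtain ⟨c, hc⟩ := exists_lift (c := fun t => π (G t x))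
    (ξ.continuous_proj.comp (cG.comp (f := fun t : I => (x, t)) (by fun_prop)))
  rw [ξ.nu_eq hG.1, windingNumber_eq c hc]
  obtain ⟨m, hm⟩ := circleCover_eq_iff.1 (show circleCover (c 1) = circleCover (c 0) by
    rw [hc, hc, hG0, hG1])
  exact ⟨m, by rw [hm]; ring⟩

theorem existsUnique_index (ξ : GammaBundle (𝓡 1) IN IM Γ π) [Nonempty N] (r : ℕ∞) (p : Circle) :
    ∃! k : ℕ, nu π p '' (ξ.isotLoop r : Set (I → Equiv.Perm M)) =
      Set.range (fun m : ℤ => (k : ℝ) * m) := by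
  let A : AddSubgroup ℤ :=
    { carrier := {m | ∃ G ∈ ξ.isotLoop r, nu π p G = m}
      zero_mem' := ⟨1, Subgroup.one_mem _, by
        have := ξ.nu_mul p (Subgroup.one_mem (ξ.isot₀ r)) (Subgroup.one_mem (ξ.isotLoop r))
        rw [mul_one] at this
        simpa using this⟩
      add_mem' := by
        rintro a b ⟨F, hF, ha⟩ ⟨G, hG, hb⟩
        exact ⟨F * G, Subgroup.mul_mem _ hF hG, by rw [ξ.nu_mul p hF.1 hG, ha, hb]; simp⟩
      neg_mem' := by
        rintro a ⟨F, hF, ha⟩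
        refine ⟨F⁻¹, Subgroup.inv_mem _ hF, ?_⟩
        have h0 := ξ.nu_mul p (Subgroup.one_mem (ξ.isot₀ r)) (Subgroup.one_mem (ξ.isotLoop r))
        have h1 := ξ.nu_mul p hF.1 (Subgroup.inv_mem _ hF)
        rw [mul_one] at h0
        rw [mul_inv_cancel] at h1
        push_cast
        linarith }
  obtain ⟨k, hkA⟩ : ∃ k : ℕ, ∀ m : ℤ, m ∈ A ↔ (k : ℤ) ∣ m := by
    obtain ⟨a, ha⟩ := Int.subgroup_cyclic A
    refine ⟨a.natAbs, fun m => ?_⟩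
    rw [ha, AddSubgroup.mem_closure_singleton, Int.natAbs_dvd]
    exact exists_congr fun c => by rw [smul_eq_mul, mul_comm, eq_comm]
  have hA : nu π p '' (ξ.isotLoop r : Set (I → Equiv.Perm M)) =
      Set.range (fun m : ℤ => (k : ℝ) * m) := by
    ext y
    constructor
    · rintro ⟨G, hG, rfl⟩
      obtain ⟨m, hm⟩ := ξ.nu_loop_int p hG
      obtain ⟨c, hc⟩ := (hkA m).1 ⟨G, hG, hm⟩
      exact ⟨c, by rw [hm, hc]; push_cast; rfl⟩
    · rintro ⟨m, rfl⟩
      obtain ⟨G, hG, h⟩ := (hkA (k * m)).2 (dvd_mul_right _ _)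
      exact ⟨G, hG, by rw [h]; push_cast; rfl⟩
  refine ⟨k, hA, fun k' hk => ?_⟩
  rw [hk] at hA
  apply Nat.dvd_antisymm
  · obtain ⟨m, hm⟩ : (k : ℝ) ∈ Set.range (fun m : ℤ => (k' : ℝ) * m) := by
      rw [hA]; exact ⟨1, by simp⟩
    exact Int.natCast_dvd_natCast.1 ⟨m, by
      have hm' := hm.symm
      dsimp only at hm'
      exact_mod_cast hm'⟩
  · obtain ⟨m, hm⟩ : (k' : ℝ) ∈ Set.range (fun m : ℤ => (k : ℝ) * m) := by
      rw [← hA]; exact ⟨1, by simp⟩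
    exact Int.natCast_dvd_natCast.1 ⟨m, by
      have hm' := hm.symm
      dsimp only at hm'
      exact_mod_cast hm'⟩

/-- `k(π, r)`: the unique `k : ℕ` with `ν(Isot^r_π(M)_{id,id}) = kℤ`. -/
noncomputable def index (ξ : GammaBundle (𝓡 1) IN IM Γ π) [Nonempty N] (r : ℕ∞) (p : Circle) : ℕ :=
  (ξ.existsUnique_index r p).choose

theorem image_nu (ξ : GammaBundle (𝓡 1) IN IM Γ π) [Nonempty N] (r : ℕ∞) (p : Circle) :
    nu π p '' (ξ.isotLoop r : Set (I → Equiv.Perm M)) =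
      Set.range (fun m : ℤ => (ξ.index r p : ℝ) * m) :=
  (ξ.existsUnique_index r p).choose_spec.1

/-- The map `ν̂ : Diff^r_π(M)_0 → ℝ/kℤ`, `ν̂(F_1) = [ν(F)]` for `F ∈ Isot^r_π(M)_0`. The value does
not depend on the choice of `F`, see `nuHat_apply`. -/
noncomputable def nuHat (ξ : GammaBundle (𝓡 1) IN IM Γ π) [Nonempty N] (r : ℕ∞) (p : Circle)
    (f : ξ.diff₀ r) : AddCircle (ξ.index r p : ℝ) :=
  (nu π p (Subgroup.mem_map.1 f.2).choose : ℝ)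

theorem nuHat_apply (ξ : GammaBundle (𝓡 1) IN IM Γ π) [Nonempty N] (r : ℕ∞) (p : Circle)
    (f : ξ.diff₀ r) {F : I → Equiv.Perm M} (hF : F ∈ ξ.isot₀ r) (hf : F 1 = f) :
    ξ.nuHat r p f = (nu π p F : ℝ) := by
  obtain ⟨h, h1⟩ := (Subgroup.mem_map.1 f.2).choose_spec
  rw [nuHat]
  set G := (Subgroup.mem_map.1 f.2).choose
  have hl : F⁻¹ * G ∈ ξ.isotLoop r := ⟨Subgroup.mul_mem _ (Subgroup.inv_mem _ hF) h, by
    have h2 : G 1 = f := h1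
    refine MonoidHom.mem_ker.2 ?_
    simp [hf, h2]⟩
  have h2 := ξ.nu_mul p hF hl
  rw [mul_inv_cancel_left] at h2
  obtain ⟨m, hm⟩ : nu π p (F⁻¹ * G) ∈ Set.range (fun m : ℤ => (ξ.index r p : ℝ) * m) := by
    rw [← ξ.image_nu r p]; exact ⟨_, hl, rfl⟩
  rw [h2, ← hm, AddCircle.coe_add, add_eq_left, AddCircle.coe_eq_zero_iff]
  exact ⟨m, by simp [mul_comm]⟩

end GammaBundle

end CircleBundle

/-! ### Commutator length supported in balls -/

/-- For a subset `S` of a group `G`, the least number of factors in an expression of `g` as a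
product of elements of `S`, and `∞` if there is no such expression. -/
noncomputable def wordNorm {G : Type*} [Group G] (S : Set G) (g : G) : ℕ∞ :=
  ⨅ l : {l : List G // (∀ x ∈ l, x ∈ S) ∧ l.prod = g}, (l.1.length : ℕ∞)

/-- The closed arcs in the circle. These are the `C^r` `1`-balls in the circle, for every `r`. -/
def IsClosedArc (D : Set Circle) : Prop :=
  ∃ a b : ℝ, a < b ∧ b < a + 1 ∧ D = circleCover '' Set.Icc a b

section Clb

variable {EN : Type*} [NormedAddCommGroup EN] [NormedSpace ℝ EN] {HN : Type*} [TopologicalSpace HN]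
  {EM : Type*} [NormedAddCommGroup EM] [NormedSpace ℝ EM] {HM : Type*} [TopologicalSpace HM]
  {N : Type*} [TopologicalSpace N] [ChartedSpace HN N]
  {M : Type*} [TopologicalSpace M] [ChartedSpace HM M]
  {IN : ModelWithCorners ℝ EN HN} {IM : ModelWithCorners ℝ EM HM} {Γ : Subgroup (Equiv.Perm N)}
  {π : M → Circle}

namespace GammaBundle

/-- The set of commutators supported in balls: all
`[a, b] = a b a⁻¹ b⁻¹` with
`a, b ∈ Diff^r_π(M; S¹ - Int D)_0` for some ball `D` in the circle. -/
def ballCommutators (ξ : GammaBundle (𝓡 1) IN IM Γ π) (r : ℕ∞) : Set (ξ.diff₀ r) :=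
  {g | ∃ D : Set Circle, IsClosedArc D ∧ ∃ a ∈ ξ.diffRel r (interior D)ᶜ,
    ∃ b ∈ ξ.diffRel r (interior D)ᶜ, (g : Equiv.Perm M) = a * b * a⁻¹ * b⁻¹}

/-- The commutator length supported in balls, `clb_π : Diff^r_π(M)_0 → ℕ ∪ {∞}`. -/
noncomputable def clb (ξ : GammaBundle (𝓡 1) IN IM Γ π) (r : ℕ∞) (f : ξ.diff₀ r) : ℕ∞ :=
  wordNorm (ξ.ballCommutators r) f

end GammaBundle

end Clb

/-! Pulled back along `ℝ → S¹`, the bundle is trivial, and the trivialization can be chosen so that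
its monodromy `Ψ (x + 1, y) = Ψ (x, γ y)` is constant (`exists_developingMap`): the bundle is a
mapping torus. Consequently every isotopy `g` of the circle lifts to an isotopy of bundle
diffeomorphisms, `Ψ (x, y) ↦ Ψ (g x, y)`, and every `F` in `Isot^r_π(M)_0` is a product of such a
lift and an isotopy `V` preserving each fiber (`DevelopingMap.exists_decomposition`); `ν(F)` is the
displacement `g_1 p - p` of the lift of `g` to `ℝ`. Multiplying `F` by a loop of isotopies, one may
assume that this displacement is equal to `s`. Three facts then bound the number of commutators by
`⌊|s|⌋ + 3`.

* Displacement less than `1` (`DevelopingMap.exists_commutator_eq_near`). Near the fiber over `p`,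
  the isotopy is a product of three: the lift of translations of the circle, the lift of an isotopy
  of the circle fixing `p`, and an isotopy preserving each fiber. Each can be cut off separately
  (`exists_translation_cutoff`, `exists_right_cutoff`, `DevelopingMap.exists_vertical_cutoff`), and
  explicitly, so that this works for `r = 0` as well. The product `A` of the cut-off isotopies is
  supported over an arc `J` containing the path from `p` to `p + s`. If `B` moves to `p` a point
  outside of `J`, then `B A⁻¹ B⁻¹` is the identity near the fiber over `p`, and `[A, B]` agrees with
  the given diffeomorphism there. As `J` is not everything, `A` and `B` fit into a common arc. After
  this one commutator, what remains is the end of an isotopy supported away from the fiber over `p`.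

* A diffeomorphism supported over an arc is a product of two commutators
  (`GammaBundle.isBallProduct_two`). By assumption `(∗)` it is a product of commutators of elements
  of the group `H` of diffeomorphisms supported over the arc (`GammaBundle.commutator_arcDiff`).
  Some `φ` supported over a larger arc moves the arc off itself, so that `H` commutes with its
  conjugates by positive powers of `φ`; spreading out the commutators by these powers, all of them are
  collected in a single one, up to a commutator with `φ` (`exists_eq_mul_commutators`).

* Displacement less than `n + 1` (`DevelopingMap.isBallProduct_of_abs_lt`). The same construction in
  the base gives a commutator of isotopies of the circle, supported over an arc, which moves the
  point `p + s` back by `s / (n + 1)`; this reduces `n` by one.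
-/

open scoped commutatorElement

/-! ### Families of diffeomorphisms of the line -/

/-- The group of isotopies of the line starting at the identity, of class `C^r` jointly in time and
space together with their inverses. Time runs through all of `ℝ` (not just `[0,1]`), which keeps
differential calculus on the open set `ℝ × ℝ`. -/
def lineIsot (r : ℕ∞) : Subgroup (ℝ → Equiv.Perm ℝ) where
  carrier := {g | ContDiff ℝ r (fun z : ℝ × ℝ => g z.1 z.2) ∧
    ContDiff ℝ r (fun z : ℝ × ℝ => (g z.1).symm z.2) ∧ g 0 = 1}
  one_mem' := ⟨contDiff_snd, contDiff_snd, rfl⟩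
  mul_mem' := fun hf hg => ⟨hf.1.comp (contDiff_fst.prodMk hg.1),
    hg.2.1.comp (contDiff_fst.prodMk hf.2.1), by simp [hf.2.2, hg.2.2]⟩
  inv_mem' := fun hf => ⟨hf.2.1, hf.1, by simp [hf.2.2]⟩

/-- A `C^r` family `φ_t` of increasing bijections of the line, with nonvanishing space derivative
when `r ≥ 1`, gives an isotopy `φ_t φ_0⁻¹`: the inverses are jointly continuous by monotonicity, and
the inverse function theorem does the rest. -/
theorem exists_mem_lineIsot {r : ℕ∞} {φ : ℝ × ℝ → ℝ} (hφ : ContDiff ℝ r φ)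
    (hmono : ∀ t, StrictMono fun x => φ (t, x))
    (hsurj : ∀ t, Function.Surjective fun x => φ (t, x))
    (hder : 1 ≤ r → ∀ z, fderiv ℝ φ z (0, 1) ≠ 0) :
    ∃ g ∈ lineIsot r, ∀ t x, g t (φ (0, x)) = φ (t, x) := by
  let g : ℝ → Equiv.Perm ℝ := fun t => Equiv.ofBijective (fun x => φ (t, x))
    ⟨(hmono t).injective, hsurj t⟩
  have hg : ∀ t x, φ (t, (g t).symm x) = x := fun t x => (g t).apply_symm_apply x
  have hg' : ∀ t x, (g t).symm (φ (t, x)) = x := fun t x => (g t).symm_apply_apply x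
  have hc : Continuous (fun z : ℝ × ℝ => (g z.1).symm z.2) := by
    refine continuous_iff_continuousAt.2 fun z => Metric.tendsto_nhds.2 fun ε hε => ?_
    set x₀ := (g z.1).symm z.2 with hx₀
    have h1 : φ (z.1, x₀ - ε) < z.2 := by
      conv_rhs => rw [← hg z.1 z.2]
      exact hmono z.1 (by linarith)
    have h2 : z.2 < φ (z.1, x₀ + ε) := by
      conv_lhs => rw [← hg z.1 z.2]
      exact hmono z.1 (by linarith)
    have c := hφ.continuous
    filter_upwards [(isOpen_lt (f := fun w : ℝ × ℝ => φ (w.1, x₀ - ε)) (g := fun w => w.2)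
        (by fun_prop) (by fun_prop)).mem_nhds h1,
      (isOpen_lt (f := fun w : ℝ × ℝ => w.2) (g := fun w => φ (w.1, x₀ + ε))
        (by fun_prop) (by fun_prop)).mem_nhds h2] with w hw1 hw2
    change φ (w.1, x₀ - ε) < w.2 at hw1
    change w.2 < φ (w.1, x₀ + ε) at hw2
    rw [← hg w.1 w.2] at hw1 hw2
    have k1 := (hmono w.1).lt_iff_lt.1 hw1
    have k2 := (hmono w.1).lt_iff_lt.1 hw2
    rw [Real.dist_eq, abs_lt]
    constructor <;> linarith
  suffices hs : ContDiff ℝ r (fun z : ℝ × ℝ => (g z.1).symm z.2) by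
    refine ⟨fun t => g t * (g 0)⁻¹, ⟨?_, ?_, by simp⟩, fun t x => ?_⟩
    · exact hφ.comp (contDiff_fst.prodMk (hs.comp (contDiff_const.prodMk contDiff_snd)))
    · exact hφ.comp (contDiff_const.prodMk hs)
    · exact congrArg (g t) ((g 0).symm_apply_apply x)
  rcases eq_or_ne r 0 with rfl | hr
  · exact contDiff_zero.2 hc
  have hr1 : 1 ≤ r := Order.one_le_iff_ne_zero.2 hr
  let Φ : (ℝ × ℝ) ≃ₜ (ℝ × ℝ) :=
    { toFun := fun z => (z.1, φ z)
      invFun := fun z => (z.1, (g z.1).symm z.2)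
      left_inv := fun z => Prod.ext rfl (hg' z.1 z.2)
      right_inv := fun z => Prod.ext rfl (hg z.1 z.2)
      continuous_toFun := continuous_fst.prodMk hφ.continuous
      continuous_invFun := continuous_fst.prodMk hc }
  have hd : ∀ z, HasFDerivAt φ (fderiv ℝ φ z) z := fun z =>
    (hφ.differentiable (by exact_mod_cast hr)).differentiableAt.hasFDerivAt
  have hinj : ∀ z, Function.Injective
      ((ContinuousLinearMap.fst ℝ ℝ ℝ).prod (fderiv ℝ φ z)) := fun z => by
    refine (injective_iff_map_eq_zero _).2 fun w hw => ?_
    have h1 : w.1 = 0 := congrArg Prod.fst hw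
    have h2 : fderiv ℝ φ z w = 0 := congrArg Prod.snd hw
    have h3 : w = w.2 • ((0, 1) : ℝ × ℝ) := by ext <;> simp [h1]
    rw [h3, map_smul, smul_eq_mul, mul_eq_zero] at h2
    rw [h3, h2.resolve_right (hder hr1 z), zero_smul]
  let e : (ℝ × ℝ) → ((ℝ × ℝ) ≃L[ℝ] (ℝ × ℝ)) := fun z =>
    (LinearEquiv.ofInjectiveEndo _ (hinj z)).toContinuousLinearEquiv
  have he : ∀ z, (e z : (ℝ × ℝ) →L[ℝ] (ℝ × ℝ)) =
      (ContinuousLinearMap.fst ℝ ℝ ℝ).prod (fderiv ℝ φ z) := fun z => by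
    ext1 <;> rfl
  have := Φ.contDiff_symm (f₀' := e) (n := r) (fun z => by
    rw [he]
    exact hasFDerivAt_fst.prodMk (hd z)) (contDiff_fst.prodMk hφ)
  exact contDiff_snd.comp this

/-- The space derivative of an isotopy of class `C^r`, `r ≥ 1`, vanishes nowhere. -/
theorem fderiv_ne_zero_of_mem_lineIsot {r : ℕ∞} (hr : 1 ≤ r) {g : ℝ → Equiv.Perm ℝ}
    (hg : g ∈ lineIsot r) (z : ℝ × ℝ) :
    fderiv ℝ (fun z : ℝ × ℝ => g z.1 z.2) z (0, 1) ≠ 0 := by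
  intro h
  have hr' : (r : WithTop ℕ∞) ≠ 0 := by
    have : r ≠ 0 := Order.one_le_iff_ne_zero.1 hr
    exact_mod_cast this
  have d1 := ((hg.1.differentiable hr') z).hasFDerivAt
  have l : HasDerivAt (fun x : ℝ => (z.1, x)) ((0, 1) : ℝ × ℝ) z.2 :=
    (hasDerivAt_const _ _).prodMk (hasDerivAt_id _)
  have d2 : HasDerivAt (fun x => g z.1 x) 0 z.2 := by
    have := d1.comp_hasDerivAt z.2 l
    rwa [h] at this
  have d3 := ((hg.2.1.differentiable hr') (z.1, g z.1 z.2)).hasFDerivAt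
  have l' : HasDerivAt (fun x : ℝ => (z.1, g z.1 x)) ((0, 0) : ℝ × ℝ) z.2 :=
    (hasDerivAt_const _ _).prodMk d2
  have d4 := d3.comp_hasDerivAt z.2 l'
  have d5 : HasDerivAt (fun x : ℝ => x) 0 z.2 := by
    convert! d4 using 1
    · ext x; simp
    · exact (map_zero _).symm
  exact one_ne_zero ((hasDerivAt_id z.2).unique d5)

/-- Integrals from `0` with a `C^n` integrand depending on a parameter are of class `C^n` in the
parameter and the endpoint. -/
theorem contDiff_parametric_primitive {n : ℕ∞} {h : ℝ × ℝ → ℝ} (hh : ContDiff ℝ n h) :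
    ContDiff ℝ n (fun z : ℝ × ℝ => ∫ v in (0 : ℝ)..z.2, h (z.1, v)) := by
  -- After rescaling to `[0,1]`, the integral is a convolution with the indicator of `[0,1]`.
  let χ : ContDiffBump (0 : ℝ) := ⟨1, 2, one_pos, one_lt_two⟩
  let G : ℝ × ℝ → ℝ → ℝ := fun p s => χ s * h (p.1, p.2 * (-s))
  let f : ℝ → ℝ := (Set.Ioc (0 : ℝ) 1).indicator 1
  have hf : MeasureTheory.LocallyIntegrable f MeasureTheory.volume := by
    refine MeasureTheory.Integrable.locallyIntegrable ?_
    refine (MeasureTheory.integrable_indicator_iff measurableSet_Ioc).2 ?_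
    exact MeasureTheory.integrableOn_const (by simp)
  have key := MeasureTheory.contDiffOn_convolution_right_with_param_comp (𝕜 := ℝ) (n := n)
    (ContinuousLinearMap.mul ℝ ℝ) (s := (Set.univ : Set (ℝ × ℝ))) (v := fun _ => (0 : ℝ))
    (contDiffOn_const) (f := f) (g := G) (μ := MeasureTheory.volume) isOpen_univ
    (isCompact_closedBall (0 : ℝ) 2)
    (fun p x _ hx => by
      have : χ x = 0 := by
        by_contra hne
        have : x ∈ Function.support χ := hne
        rw [χ.support_eq] at this
        exact hx (Metric.ball_subset_closedBall this)
      simp [G, this]) hf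
    (by
      refine ContDiff.contDiffOn ?_
      have : ContDiff ℝ n (fun q : (ℝ × ℝ) × ℝ => χ q.2 * h (q.1.1, q.1.2 * (-q.2))) := by
        refine (χ.contDiff.comp contDiff_snd).mul (hh.comp ?_)
        fun_prop
      exact this)
  rw [contDiffOn_univ] at key
  have h2 : ContDiff ℝ n (fun z : ℝ × ℝ => z.2 *
      (MeasureTheory.convolution f (G z) (ContinuousLinearMap.mul ℝ ℝ) MeasureTheory.volume) 0) :=
    contDiff_snd.mul key
  convert! h2 using 2 with z
  rw [MeasureTheory.convolution_def]
  have e1 : ∀ t, (ContinuousLinearMap.mul ℝ ℝ (f t)) (G z (0 - t)) =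
      (Set.Ioc (0 : ℝ) 1).indicator (fun t => h (z.1, z.2 * t)) t := fun t => by
    by_cases ht : t ∈ Set.Ioc (0 : ℝ) 1
    · have : χ (-t) = 1 := χ.one_of_mem_closedBall (by
        rw [Metric.mem_closedBall, Real.dist_eq]
        simp [abs_of_pos ht.1, ht.2, χ])
      simp [f, G, ht, this]
    · simp [f, ht]
  simp_rw [e1]
  rw [MeasureTheory.integral_indicator measurableSet_Ioc,
    ← intervalIntegral.integral_of_le zero_le_one]
  have := intervalIntegral.smul_integral_comp_mul_left (a := 0) (b := 1)
    (fun v => h (z.1, v)) z.2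
  simp only [smul_eq_mul, mul_zero, mul_one] at this
  rw [this]

theorem surjective_of_eq_self_outside {f : ℝ → ℝ} (hf : Continuous f) {a d : ℝ}
    (h : ∀ x ∉ Set.Ioo a d, f x = x) : Function.Surjective f := by
  refine hf.surjective ?_ ?_
  · refine Filter.tendsto_id.congr' ?_
    filter_upwards [Filter.eventually_ge_atTop d] with x hx
    exact (h x fun hx' => absurd hx'.2 (not_lt.2 hx)).symm
  · refine Filter.tendsto_id.congr' ?_
    filter_upwards [Filter.eventually_le_atBot a] with x hx
    exact (h x fun hx' => absurd hx'.1 (not_lt.2 hx)).symm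

/-- A compactly supported isotopy of the line that translates a neighborhood of `b` to a
neighborhood of `c`. It is an iterate of `x ↦ x + t κ ρ(x)`, where `ρ` is a plateau function and the
step `κ` is small compared with the derivative of `ρ`. -/
theorem exists_translation_cutoff (r : ℕ∞) {a b c d : ℝ} (hab : a < b) (hac : a < c) (hbd : b < d)
    (hcd : c < d) : ∃ g ∈ lineIsot r, ∃ η > 0,
      (∀ t x, |x - b| < η → g t x = x + Real.smoothTransition t * (c - b)) ∧
      ∀ t, ∀ x ∉ Set.Ioo (a + η) (d - η), g t x = x := by
  obtain ⟨η, hη, h1, h2, h3, h4⟩ : ∃ η > 0, a + 3 * η < b ∧ a + 3 * η < c ∧ b < d - 3 * η ∧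
      c < d - 3 * η := by
    refine ⟨min (min (b - a) (c - a)) (min (d - b) (d - c)) / 4, ?_, ?_, ?_, ?_, ?_⟩
    · have : 0 < min (min (b - a) (c - a)) (min (d - b) (d - c)) := by
        simp only [lt_min_iff]
        refine ⟨⟨?_, ?_⟩, ?_, ?_⟩ <;> linarith
      linarith
    all_goals
      have k1 := min_le_left (min (b - a) (c - a)) (min (d - b) (d - c))
      have k2 := min_le_right (min (b - a) (c - a)) (min (d - b) (d - c))
      have k3 := min_le_left (b - a) (c - a)
      have k4 := min_le_right (b - a) (c - a)
      have k5 := min_le_left (d - b) (d - c)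
      have k6 := min_le_right (d - b) (d - c)
      linarith
  let χ : ContDiffBump ((b + c) / 2) :=
    ⟨|c - b| / 2 + η, |c - b| / 2 + 2 * η, by positivity, by linarith⟩
  have hχ1 : ∀ x s, |x - b| < η → s ∈ Set.Icc (0 : ℝ) 1 → χ (x + s * (c - b)) = 1 := by
    intro x s hx hs
    refine χ.one_of_mem_closedBall ?_
    rw [Metric.mem_closedBall, Real.dist_eq]
    have e : x + s * (c - b) - (b + c) / 2 = (x - b) + (s - 1 / 2) * (c - b) := by ring
    have h5 : |s - 1 / 2| ≤ 1 / 2 := by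
      rw [abs_le]; constructor <;> linarith [hs.1, hs.2]
    calc |x + s * (c - b) - (b + c) / 2| ≤ |x - b| + |s - 1 / 2| * |c - b| := by
          rw [e, ← abs_mul]; exact abs_add_le _ _
      _ ≤ η + 1 / 2 * |c - b| := by gcongr
      _ = |c - b| / 2 + η := by ring
  have hχ0 : ∀ x ∉ Set.Ioo (a + η) (d - η), χ x = 0 := by
    intro x hx
    by_contra hne
    have hs : x ∈ Function.support χ := hne
    rw [χ.support_eq, Metric.mem_ball, Real.dist_eq] at hs
    have hs' : |x - (b + c) / 2| < |c - b| / 2 + 2 * η := hs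
    refine hx ?_
    rw [abs_lt] at hs'
    rcases abs_cases (c - b) with ⟨h, _⟩ | ⟨h, _⟩ <;> rw [h] at hs' <;>
      constructor <;> linarith [hs'.1, hs'.2]
  have hχs : HasCompactSupport χ := χ.hasCompactSupport
  have hχd : ContDiff ℝ ∞ χ := χ.contDiff
  obtain ⟨C, hC⟩ := (hχd.continuous_deriv (by simp)).bounded_above_of_compact_support hχs.deriv
  have hC0 : 0 ≤ C := (norm_nonneg _).trans (hC 0)
  obtain ⟨m, hm⟩ := exists_nat_gt (|c - b| * (C + 1))
  have hm0 : (0 : ℝ) < m := lt_of_le_of_lt (by positivity) hm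
  set κ := (c - b) / m with hκ
  have hκC : |κ| * C < 1 := by
    rw [hκ, abs_div, abs_of_pos hm0, div_mul_eq_mul_div, div_lt_one hm0]
    refine lt_of_le_of_lt ?_ hm
    gcongr
    linarith
  let φ : ℝ × ℝ → ℝ := fun z => z.2 + Real.smoothTransition z.1 * κ * χ z.2
  have hφ : ∀ n : ℕ∞, ContDiff ℝ n φ := fun n => contDiff_snd.add
    (((Real.smoothTransition.contDiff.comp contDiff_fst).mul contDiff_const).mul
      (χ.contDiff.comp contDiff_snd))
  have hd : ∀ t x, HasDerivAt (fun x => φ (t, x))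
      (1 + Real.smoothTransition t * κ * deriv χ x) x := fun t x =>
    (hasDerivAt_id x).add (((hχd.differentiable (by simp)) x).hasDerivAt.const_mul
      (Real.smoothTransition t * κ))
  have hpos : ∀ t x, 0 < 1 + Real.smoothTransition t * κ * deriv χ x := fun t x => by
    have h6 : |Real.smoothTransition t * κ * deriv χ x| < 1 := by
      rw [abs_mul, abs_mul, abs_of_nonneg (Real.smoothTransition.nonneg t)]
      calc Real.smoothTransition t * |κ| * |deriv χ x| ≤ 1 * |κ| * C := by
            gcongr
            · exact Real.smoothTransition.le_one t
            · exact hC x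
        _ < 1 := by rwa [one_mul]
    linarith [(abs_lt.1 h6).1]
  obtain ⟨g, hg, hgφ⟩ := exists_mem_lineIsot (r := r) (hφ r)
    (fun t => strictMono_of_deriv_pos fun x => by rw [(hd t x).deriv]; exact hpos t x)
    (fun t => surjective_of_eq_self_outside (a := a + η) (d := d - η)
      ((hφ 0).continuous.comp (by fun_prop)) fun x hx => by simp [φ, hχ0 x hx])
    (fun _ z => by
      have d1 := ((hφ 1).differentiable (by simp) z).hasFDerivAt
      have l : HasDerivAt (fun x : ℝ => (z.1, x)) ((0, 1) : ℝ × ℝ) z.2 :=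
        (hasDerivAt_const _ _).prodMk (hasDerivAt_id _)
      rw [(d1.comp_hasDerivAt z.2 l :).unique (hd z.1 z.2)]
      exact (hpos _ _).ne')
  replace hgφ : ∀ t x, g t x = φ (t, x) := fun t x => by
    rw [← hgφ]
    simp [φ]
  refine ⟨g ^ m, Subgroup.pow_mem _ hg m, η, hη, ?_, ?_⟩
  · have key : ∀ j : ℕ, j ≤ m → ∀ t x, |x - b| < η →
        (g ^ j) t x = x + j * (Real.smoothTransition t * κ) := by
      intro j
      induction j with
      | zero => intro _ t x _; simp
      | succ j ih =>
        intro hj t x hx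
        rw [pow_succ', Pi.mul_apply, Equiv.Perm.mul_apply, ih (by omega) t x hx, hgφ]
        have e : x + j * (Real.smoothTransition t * κ) =
            x + (j / m * Real.smoothTransition t) * (c - b) := by rw [hκ]; ring
        have hjm : (j : ℝ) / m ≤ 1 := by
          rw [div_le_one hm0]
          exact_mod_cast (by omega : j ≤ m)
        have := hχ1 x (j / m * Real.smoothTransition t) hx
          ⟨mul_nonneg (by positivity) (Real.smoothTransition.nonneg t),
            mul_le_one₀ hjm (Real.smoothTransition.nonneg t) (Real.smoothTransition.le_one t)⟩
        simp only [φ]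
        rw [e, this, ← e]
        push_cast
        ring
    intro t x hx
    rw [key m le_rfl t x hx, hκ]
    field_simp
  · intro t x hx
    have : g t x = x := by rw [hgφ]; simp [φ, hχ0 x hx]
    rw [Pi.pow_apply]
    exact Equiv.Perm.pow_apply_eq_self_of_apply_eq_self this m

/-- Cutting off an isotopy of the line fixing `0` on the right of `0`. The cut-off isotopy is, up to
a correction, the Stieltjes integral `∫ ρ du` of a decreasing plateau function `ρ`, written by
partial integration as `ρ u - ∫ ρ' u`; this is increasing and as regular as `u`, for every
`r ≥ 0`. The correction consists of a multiple of a fixed increasing function and of the integral of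
a function that is positive wherever `ρ < 1`. -/
theorem exists_right_cutoff {r : ℕ∞} {u : ℝ → Equiv.Perm ℝ} (hu : u ∈ lineIsot r)
    (hmono : ∀ t, StrictMono (u t)) (hu0 : ∀ t, u t 0 = 0) {ε δ : ℝ} (hδ : 0 < δ)
    (hδε : 2 * δ < ε) (hsmall : ∀ t, u t δ < ε / 4) :
    ∃ v ∈ lineIsot r, (∀ t, StrictMono (v t)) ∧ (∀ t, ∀ x ≤ δ / 2, v t x = u t x) ∧
      ∀ t, ∀ x, ε ≤ x → v t x = x := by
  let step : ℝ → ℝ → ℝ → ℝ := fun p q x => Real.smoothTransition ((x - p) / (q - p))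
  have step0 : ∀ {p q x}, p < q → x ≤ p → step p q x = 0 := fun h hx =>
    Real.smoothTransition.zero_of_nonpos
      (div_nonpos_of_nonpos_of_nonneg (by linarith) (by linarith))
  have step1 : ∀ {p q x}, p < q → q ≤ x → step p q x = 1 := fun h hx =>
    Real.smoothTransition.one_of_one_le ((one_le_div (by linarith)).2 (by linarith))
  have stepm : ∀ {p q}, p < q → Monotone (step p q) := fun h x y hxy =>
    Real.smoothTransition.monotone (by gcongr)
  have stepd : ∀ p q (n : ℕ∞), ContDiff ℝ n (step p q) := fun p q n =>
    Real.smoothTransition.contDiff.comp (by fun_prop)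
  have stepnn : ∀ p q x, 0 ≤ step p q x := fun _ _ _ => Real.smoothTransition.nonneg _
  have steple : ∀ p q x, step p q x ≤ 1 := fun _ _ _ => Real.smoothTransition.le_one _
  have steppos : ∀ {p q x}, p < q → p < x → 0 < step p q x := fun h hx =>
    Real.smoothTransition.pos_of_pos (div_pos (by linarith) (by linarith))
  have stepd0 : ∀ p q, p < q → ∀ x, 0 ≤ deriv (step p q) x := fun p q h x => (stepm h).deriv_nonneg
  have h1 : δ / 2 < δ := by linarith
  have h2 : ε / 2 < ε := by linarith
  -- `ρ = 1 - κ` and `1 - θ` are the two plateau functions, and `θ` also serves for the correction.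
  let κ := step (δ / 2) δ
  let θ := step (ε / 2) ε
  have dκ : ∀ x, HasDerivAt κ (deriv κ x) x := fun x =>
    ((stepd (δ / 2) δ 1).differentiable (by simp) x).hasDerivAt
  have cκ' : ContDiff ℝ ∞ (deriv κ) := (contDiff_infty_iff_deriv.1 (stepd (δ / 2) δ ⊤)).2
  let S : ℝ × ℝ → ℝ := fun z => (1 - κ z.2) * u z.1 z.2 +
    ∫ v in (0 : ℝ)..z.2, deriv κ v * u z.1 v
  let W : ℝ → ℝ := fun x => ∫ v in (0 : ℝ)..x, (κ v + θ v) / 2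
  have cW : ∀ n : ℕ∞, ContDiff ℝ n W := fun n => by
    have := contDiff_parametric_primitive (n := n) (h := fun z : ℝ × ℝ => (κ z.2 + θ z.2) / 2)
      ((((stepd _ _ n).comp contDiff_snd).add ((stepd _ _ n).comp contDiff_snd)).div_const 2)
    exact this.comp (contDiff_prodMk_right (0 : ℝ))
  have cS : ContDiff ℝ r S := by
    refine ((contDiff_const.sub ((stepd _ _ r).comp contDiff_snd)).mul hu.1).add
      (contDiff_parametric_primitive (h := fun z : ℝ × ℝ => deriv κ z.2 * u z.1 z.2) ?_)
    exact ((cκ'.of_le (by exact_mod_cast le_top)).comp contDiff_snd).mul hu.1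
  have cu : ∀ t, Continuous (u t) := fun t => hu.1.continuous.comp (Continuous.prodMk_right t)
  have cint : ∀ t (x y : ℝ), IntervalIntegrable (fun v => deriv κ v * u t v)
      MeasureTheory.volume x y := fun t x y =>
    (cκ'.continuous.mul (cu t)).intervalIntegrable _ _
  have cint' : ∀ (x y : ℝ), IntervalIntegrable (deriv κ) MeasureTheory.volume x y := fun x y =>
    cκ'.continuous.intervalIntegrable _ _
  have hSsub : ∀ t x y, S (t, y) - S (t, x) = (1 - κ y) * (u t y - u t x) +
      ∫ v in x..y, deriv κ v * (u t v - u t x) := by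
    intro t x y
    have e1 : (∫ v in (0 : ℝ)..y, deriv κ v * u t v) - ∫ v in (0 : ℝ)..x, deriv κ v * u t v =
        ∫ v in x..y, deriv κ v * u t v :=
      intervalIntegral.integral_interval_sub_left (cint t 0 y) (cint t 0 x)
    have e2 : ∫ v in x..y, deriv κ v = κ y - κ x :=
      intervalIntegral.integral_eq_sub_of_hasDerivAt (fun v _ => dκ v) (cint' x y)
    have e3 : ∫ v in x..y, deriv κ v * (u t v - u t x) =
        (∫ v in x..y, deriv κ v * u t v) - (κ y - κ x) * u t x := by
      simp_rw [mul_sub]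
      rw [intervalIntegral.integral_sub (cint t x y) ((cint' x y).mul_const _),
        intervalIntegral.integral_mul_const, e2]
    simp only [S]
    rw [e3, ← e1]
    ring
  have Smono : ∀ t, Monotone fun x => S (t, x) := by
    intro t x y hxy
    have := hSsub t x y
    have i0 : 0 ≤ ∫ v in x..y, deriv κ v * (u t v - u t x) :=
      intervalIntegral.integral_nonneg hxy fun v hv =>
        mul_nonneg (stepd0 _ _ h1 v) (sub_nonneg.2 ((hmono t).monotone hv.1))
    have i1 : 0 ≤ (1 - κ y) * (u t y - u t x) :=
      mul_nonneg (sub_nonneg.2 (steple _ _ _)) (sub_nonneg.2 ((hmono t).monotone hxy))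
    show S (t, x) ≤ S (t, y)
    linarith
  have κder0 : ∀ v, v ∉ Set.Icc (δ / 2) δ → deriv κ v = 0 := by
    intro v hv
    rcases lt_or_ge v (δ / 2) with h | h
    · have : κ =ᶠ[nhds v] fun _ => 0 := by
        filter_upwards [Iio_mem_nhds h] with w hw
        exact step0 h1 (le_of_lt hw)
      rw [this.deriv_eq, deriv_const]
    · have h' : δ < v := by
        by_contra hc
        exact hv ⟨h, not_lt.1 hc⟩
      have : κ =ᶠ[nhds v] fun _ => 1 := by
        filter_upwards [Ioi_mem_nhds h'] with w hw
        exact step1 h1 (le_of_lt hw)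
      rw [this.deriv_eq, deriv_const]
  have Sleft : ∀ t, ∀ x ≤ δ / 2, S (t, x) = u t x := by
    intro t x hx
    have i0 : ∫ v in (0 : ℝ)..x, deriv κ v * u t v = ∫ v in (0 : ℝ)..x, (0 : ℝ) := by
      refine intervalIntegral.integral_congr fun v hv => ?_
      have hv' : v ≤ δ / 2 := hv.2.trans (sup_le (by linarith) hx)
      rcases hv'.lt_or_eq with h | h
      · simp [κder0 v fun hc => absurd hc.1 (not_le.2 h)]
      · -- At the endpoint the derivative vanishes because `κ` is minimal there.
        have : deriv κ v = 0 := by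
          refine IsLocalMin.deriv_eq_zero (Filter.Eventually.of_forall fun w => ?_)
          rw [show κ v = 0 from step0 h1 hv']
          exact stepnn _ _ _
        simp [this]
    simp only [S]
    rw [i0, show κ x = 0 from step0 h1 hx]
    simp
  have Sright : ∀ t, ∀ x, δ ≤ x → S (t, x) = S (t, δ) := by
    intro t x hx
    have := hSsub t δ x
    have i0 : ∫ v in δ..x, deriv κ v * (u t v - u t δ) = ∫ v in δ..x, (0 : ℝ) := by
      refine intervalIntegral.integral_congr fun v hv => ?_
      rw [Set.uIcc_of_le hx] at hv
      rcases hv.1.lt_or_eq with h | h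
      · simp [κder0 v fun hc => absurd hc.2 (not_le.2 h)]
      · simp [← h]
    rw [i0, show κ x = 1 from step1 h1 hx] at this
    simp at this
    linarith
  have SR : ∀ t, S (t, δ) < ε / 4 := by
    intro t
    have := hSsub t 0 δ
    have e0 : S (t, 0) = 0 := by rw [Sleft t 0 (by linarith), hu0]
    have i0 : ∫ v in (0 : ℝ)..δ, deriv κ v * (u t v - u t 0) ≤
        ∫ v in (0 : ℝ)..δ, deriv κ v * u t δ := by
      refine intervalIntegral.integral_mono_on hδ.le ?_ ((cint' _ _).mul_const _) fun v hv => ?_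
      · exact (cκ'.continuous.mul ((cu t).sub continuous_const)).intervalIntegrable _ _
      · rw [hu0, sub_zero]
        exact mul_le_mul_of_nonneg_left ((hmono t).monotone hv.2) (stepd0 _ _ h1 v)
    have i1 : ∫ v in (0 : ℝ)..δ, deriv κ v = κ δ - κ 0 :=
      intervalIntegral.integral_eq_sub_of_hasDerivAt (fun v _ => dκ v) (cint' _ _)
    rw [intervalIntegral.integral_mul_const, i1, show κ δ = 1 from step1 h1 le_rfl,
      show κ 0 = 0 from step0 h1 (by linarith)] at i0
    rw [e0, show κ δ = 1 from step1 h1 le_rfl] at this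
    have := hsmall t
    linarith
  have dW : ∀ x, HasDerivAt W ((κ x + θ x) / 2) x := fun x =>
    intervalIntegral.integral_hasDerivAt_right
      ((((stepd _ _ 0).add (stepd _ _ 0)).div_const 2).continuous.intervalIntegrable _ _)
      ((((stepd _ _ 0).add (stepd _ _ 0)).div_const 2).continuous.stronglyMeasurableAtFilter _ _)
      (((stepd _ _ 0).add (stepd _ _ 0)).div_const 2).continuous.continuousAt
  have Wleft : ∀ x ≤ δ / 2, W x = 0 := by
    intro x hx
    have i0 : W x = ∫ v in (0 : ℝ)..x, (0 : ℝ) := by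
      refine intervalIntegral.integral_congr fun v hv => ?_
      have hv' : v ≤ δ / 2 := hv.2.trans (sup_le (by linarith) hx)
      have k1 : κ v = 0 := step0 h1 hv'
      have k2 : θ v = 0 := step0 h2 (by linarith)
      simp [k1, k2]
    simpa using i0
  have cint2 : ∀ (x y : ℝ), IntervalIntegrable (fun v => (κ v + θ v) / 2)
      MeasureTheory.volume x y := fun x y =>
    (((stepd _ _ 0).add (stepd _ _ 0)).div_const 2).continuous.intervalIntegrable _ _
  have Wright : ∀ x, ε ≤ x → W x = x - ε + W ε := by
    intro x hx
    have e1 : W x - W ε = ∫ v in ε..x, (κ v + θ v) / 2 :=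
      intervalIntegral.integral_interval_sub_left (cint2 0 x) (cint2 0 ε)
    have i0 : ∫ v in ε..x, (κ v + θ v) / 2 = ∫ v in ε..x, (1 : ℝ) := by
      refine intervalIntegral.integral_congr fun v hv => ?_
      rw [Set.uIcc_of_le hx] at hv
      have k1 : κ v = 1 := step1 h1 (by linarith [hv.1])
      have k2 : θ v = 1 := step1 h2 hv.1
      simp [k1, k2]
    rw [i0] at e1
    simp at e1
    linarith
  have Wε : W ε ≤ 3 / 4 * ε := by
    have e1 : W ε - W (ε / 2) = ∫ v in (ε / 2)..ε, (κ v + θ v) / 2 :=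
      intervalIntegral.integral_interval_sub_left (cint2 0 _) (cint2 0 _)
    have i1 : ∫ v in (ε / 2)..ε, (κ v + θ v) / 2 ≤ ∫ v in (ε / 2)..ε, (1 : ℝ) :=
      intervalIntegral.integral_mono_on h2.le (cint2 _ _) (by simp) fun v hv => by
        have := steple (δ / 2) δ v
        have := steple (ε / 2) ε v
        change (step (δ / 2) δ v + step (ε / 2) ε v) / 2 ≤ 1
        linarith
    have i2 : W (ε / 2) ≤ ∫ v in (0 : ℝ)..(ε / 2), (1 / 2 : ℝ) :=
      intervalIntegral.integral_mono_on (by linarith) (cint2 _ _) (by simp) fun v hv => by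
        have := steple (δ / 2) δ v
        have : θ v = 0 := step0 h2 hv.2
        change (step (δ / 2) δ v + θ v) / 2 ≤ 1 / 2
        linarith
    rw [← e1] at i1
    simp only [intervalIntegral.integral_const, smul_eq_mul] at i1 i2
    linarith
  let cc : ℝ → ℝ := fun t => ε - W ε - S (t, δ)
  have cc0 : ∀ t, 0 < cc t := fun t => by have := SR t; simp only [cc]; linarith
  let φ : ℝ × ℝ → ℝ := fun z => S z + W z.2 + cc z.1 * θ z.2
  have cφ : ContDiff ℝ r φ := (cS.add ((cW r).comp contDiff_snd)).add
    ((contDiff_const.sub (cS.comp (contDiff_fst.prodMk contDiff_const))).mul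
      ((stepd _ _ r).comp contDiff_snd))
  have φleft : ∀ t, ∀ x ≤ δ / 2, φ (t, x) = u t x := fun t x hx => by
    simp only [φ]
    rw [Sleft t x hx, Wleft x hx, show θ x = 0 from step0 h2 (by linarith)]
    ring
  have φright : ∀ t, ∀ x, ε ≤ x → φ (t, x) = x := fun t x hx => by
    simp only [φ, cc]
    rw [Sright t x (by linarith), Wright x hx, show θ x = 1 from step1 h2 hx]
    ring
  have Wpos : ∀ x, δ / 2 < x → 0 < (κ x + θ x) / 2 := fun x hx => by
    have k1 : 0 < κ x := steppos h1 hx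
    have k2 : 0 ≤ θ x := stepnn _ _ _
    linarith
  have Wmono : StrictMonoOn W (Set.Ici (δ / 2)) := by
    refine strictMonoOn_of_deriv_pos (convex_Ici _) (cW 0).continuous.continuousOn fun x hx => ?_
    rw [interior_Ici] at hx
    rw [(dW x).deriv]
    exact Wpos x hx
  have φmono : ∀ t, StrictMono fun x => φ (t, x) := by
    intro t
    have m1 : StrictMonoOn (fun x => φ (t, x)) (Set.Iic (δ / 2)) := fun x hx y hy hxy => by
      show φ (t, x) < φ (t, y)
      rw [φleft t x hx, φleft t y hy]
      exact hmono t hxy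
    have m2 : StrictMonoOn (fun x => φ (t, x)) (Set.Ici (δ / 2)) := fun x hx y hy hxy => by
      have k1 := Smono t hxy.le
      have k2 := Wmono hx hy hxy
      have k3 := mul_le_mul_of_nonneg_left (stepm h2 hxy.le) (cc0 t).le
      show S (t, x) + W x + cc t * step (ε / 2) ε x < S (t, y) + W y + cc t * step (ε / 2) ε y
      simp only at k1
      linarith
    exact m1.Iic_union_Ici m2
  have φsurj : ∀ t, Function.Surjective fun x => φ (t, x) := fun t => by
    have c := cφ.continuous
    refine Continuous.surjective (by fun_prop) ?_ ?_
    · refine Filter.tendsto_id.congr' ?_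
      filter_upwards [Filter.eventually_ge_atTop ε] with x hx
      exact (φright t x hx).symm
    · refine Filter.Tendsto.congr' (f₁ := u t) ?_ ?_
      · filter_upwards [Filter.eventually_le_atBot (δ / 2)] with x hx
        exact (φleft t x hx).symm
      · exact Filter.tendsto_atBot_atBot.2 fun b => ⟨(u t).symm b, fun a ha => by
          simpa using (hmono t).monotone ha⟩
  obtain ⟨v, hv, hvφ⟩ := exists_mem_lineIsot cφ φmono φsurj
    (fun hr z => by
      have hr' : (r : WithTop ℕ∞) ≠ 0 := by
        have : r ≠ 0 := Order.one_le_iff_ne_zero.1 hr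
        exact_mod_cast this
      have l : HasDerivAt (fun x : ℝ => (z.1, x)) ((0, 1) : ℝ × ℝ) z.2 :=
        (hasDerivAt_const _ _).prodMk (hasDerivAt_id _)
      have d0 := ((hu.1.differentiable hr') z).hasFDerivAt.comp_hasDerivAt z.2 l
      have n0 := fderiv_ne_zero_of_mem_lineIsot hr hu z
      set D := fderiv ℝ (fun z : ℝ × ℝ => u z.1 z.2) z (0, 1) with hD
      have Dpos : 0 < D := by
        refine lt_of_le_of_ne ?_ n0.symm
        rw [← d0.deriv]
        exact (hmono z.1).monotone.deriv_nonneg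
      have d1 := (cφ.differentiable hr' z).hasFDerivAt.comp_hasDerivAt z.2 l
      have dI : HasDerivAt (fun x => ∫ v in (0 : ℝ)..x, deriv κ v * u z.1 v)
          (deriv κ z.2 * u z.1 z.2) z.2 :=
        intervalIntegral.integral_hasDerivAt_right (cint _ _ _)
          ((cκ'.continuous.mul (cu z.1)).stronglyMeasurableAtFilter _ _)
          (cκ'.continuous.mul (cu z.1)).continuousAt
      have dθ : HasDerivAt θ (deriv θ z.2) z.2 :=
        ((stepd (ε / 2) ε 1).differentiable (by simp) z.2).hasDerivAt
      have d2 : HasDerivAt (fun x => φ (z.1, x)) (((-deriv κ z.2) * u z.1 z.2 +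
          (1 - κ z.2) * D + deriv κ z.2 * u z.1 z.2) + (κ z.2 + θ z.2) / 2 +
          cc z.1 * deriv θ z.2) z.2 :=
        (((((dκ z.2).const_sub 1).mul d0).add dI).add (dW z.2)).add (dθ.const_mul (cc z.1))
      rw [d1.unique d2]
      have k1 : 0 ≤ cc z.1 * deriv θ z.2 := mul_nonneg (cc0 _).le (stepd0 _ _ h2 _)
      have k2 : 0 ≤ κ z.2 := stepnn _ _ _
      have k3 : 0 ≤ θ z.2 := stepnn _ _ _
      have k4 : κ z.2 ≤ 1 := steple _ _ _
      have k5 : 0 < (1 - κ z.2) * D + (κ z.2 + θ z.2) / 2 := by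
        rcases k4.lt_or_eq with h | h
        · have := mul_pos (sub_pos.2 h) Dpos
          linarith
        · rw [h]; linarith
      have : 0 < ((-deriv κ z.2) * u z.1 z.2 +
          (1 - κ z.2) * D + deriv κ z.2 * u z.1 z.2) + (κ z.2 + θ z.2) / 2 +
          cc z.1 * deriv θ z.2 := by nlinarith
      exact this.ne')
  have hv0 : ∀ t x, ∃ y, v t x = φ (t, y) ∧ φ (0, y) = x := fun t x => by
    obtain ⟨y, hy⟩ := φsurj 0 x
    exact ⟨y, by rw [← hvφ, ← hy], hy⟩
  have e0 : ∀ x, u 0 x = x := fun x => by rw [hu.2.2]; rfl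
  refine ⟨v, hv, fun t x x' hx => ?_, fun t x hx => ?_, fun t x hx => ?_⟩
  · obtain ⟨y, hy, rfl⟩ := hv0 t x
    obtain ⟨y', hy', rfl⟩ := hv0 t x'
    rw [hy, hy']
    exact φmono t ((φmono 0).lt_iff_lt.1 hx)
  · have h3 : φ (0, x) = x := by rw [φleft 0 x hx, e0]
    have h4 := hvφ t x
    rwa [h3, φleft t x hx] at h4
  · have h4 := hvφ t x
    rwa [φright 0 x hx, φright t x hx] at h4

/-- Cutting off an isotopy of the line fixing `0` on both sides of `0`. -/
theorem exists_cutoff {r : ℕ∞} {u : ℝ → Equiv.Perm ℝ} (hu : u ∈ lineIsot r)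
    (hmono : ∀ t, StrictMono (u t)) (hu0 : ∀ t, u t 0 = 0)
    (hsmall : ∀ ε > 0, ∃ δ > 0, ∀ t x, |x| ≤ δ → |u t x| < ε) {ε : ℝ} (hε : 0 < ε) :
    ∃ v ∈ lineIsot r, ∃ δ > 0, (∀ t x, |x| < δ → v t x = u t x) ∧
      ∀ t x, ε ≤ |x| → v t x = x := by
  obtain ⟨δ₀, hδ₀, hs⟩ := hsmall (ε / 4) (by linarith)
  set δ := min δ₀ (ε / 4) with hδ
  have hδ0 : 0 < δ := lt_min hδ₀ (by linarith)
  have hδε : 2 * δ < ε := by linarith [min_le_right δ₀ (ε / 4)]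
  have hδδ : δ ≤ δ₀ := min_le_left _ _
  obtain ⟨v, hv, vm, vl, vr⟩ := exists_right_cutoff hu hmono hu0 hδ0 hδε fun t =>
    (le_abs_self _).trans_lt (hs t δ (by rwa [abs_of_pos hδ0]))
  let R : Equiv.Perm ℝ := Equiv.neg ℝ
  have conj : ∀ {g : ℝ → Equiv.Perm ℝ}, g ∈ lineIsot r →
      (fun t => R * g t * R) ∈ lineIsot r := fun {g} hg =>
    ⟨(hg.1.comp (contDiff_fst.prodMk contDiff_snd.neg)).neg,
      (hg.2.1.comp (contDiff_fst.prodMk contDiff_snd.neg)).neg, by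
        ext x; simp [hg.2.2, R]⟩
  have mono : ∀ {g : Equiv.Perm ℝ}, StrictMono g → StrictMono (R * g * R) := fun hg x y hxy =>
    neg_lt_neg (hg (neg_lt_neg hxy))
  obtain ⟨w, hw, -, wl, wr⟩ := exists_right_cutoff (conj hv) (fun t => mono (vm t))
    (fun t => by
      have : v t 0 = 0 := by rw [vl t 0 (by linarith), hu0]
      simp [R, this]) hδ0 hδε fun t => by
      have h1 : v t (-δ) = u t (-δ) := vl t _ (by linarith)
      have h2 := hs t (-δ) (by rw [abs_neg, abs_of_pos hδ0]; exact hδδ)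
      show -(v t (-δ)) < ε / 4
      rw [h1]
      exact (neg_le_abs _).trans_lt h2
  refine ⟨_, conj hw, δ / 2, by linarith, fun t x hx => ?_, fun t x hx => ?_⟩
  · rw [abs_lt] at hx
    show -(w t (-x)) = u t x
    rw [wl t (-x) (by linarith)]
    show - -(v t (- -x)) = u t x
    rw [neg_neg, neg_neg, vl t x (by linarith)]
  · show -(w t (-x)) = x
    rcases le_abs.1 hx with h | h
    · rw [wl t (-x) (by linarith)]
      show - -(v t (- -x)) = x
      rw [neg_neg, neg_neg, vr t x h]
    · rw [wr t (-x) h, neg_neg]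

/-! ### Isotopies of the circle -/

/-- The bijections of the line commuting with the deck transformations of `ℝ → ℝ/ℤ`. -/
def equivPerm : Subgroup (Equiv.Perm ℝ) where
  carrier := {c | ∀ x, c (x + 1) = c x + 1}
  one_mem' := fun _ => rfl
  mul_mem' := fun {c d} hc hd x => by
    rw [Equiv.Perm.mul_apply, hd x, hc]; rfl
  inv_mem' := fun {c} hc x => by
    rw [Equiv.Perm.inv_eq_iff_eq, hc]
    exact congrArg (· + 1) (c.apply_symm_apply x).symm

theorem equivPerm_add_int {c : Equiv.Perm ℝ} (hc : c ∈ equivPerm) (x : ℝ) (n : ℤ) :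
    c (x + n) = c x + n := by
  induction n with
  | zero => simp
  | succ i ih => push_cast at ih ⊢; rw [← add_assoc, hc, ih, add_assoc]
  | pred i ih =>
    push_cast at ih ⊢
    have := hc (x + (-i - 1))
    rw [show x + (-(i : ℝ) - 1) + 1 = x + -i by ring, ih] at this
    linarith

/-- The group of isotopies of the line that lift isotopies of the circle. -/
def equivIsot (r : ℕ∞) : Subgroup (ℝ → Equiv.Perm ℝ) :=
  lineIsot r ⊓ Subgroup.pi Set.univ fun _ => equivPerm

theorem mem_equivIsot {r : ℕ∞} {g : ℝ → Equiv.Perm ℝ} :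
    g ∈ equivIsot r ↔ g ∈ lineIsot r ∧ ∀ t, g t ∈ equivPerm := by
  rw [equivIsot, Subgroup.mem_inf, Subgroup.mem_pi]
  exact and_congr_right fun _ => ⟨fun h t => h t trivial, fun h t _ => h t⟩

theorem continuous_of_mem_lineIsot {r : ℕ∞} {g : ℝ → Equiv.Perm ℝ} (hg : g ∈ lineIsot r) (t : ℝ) :
    Continuous (g t) :=
  hg.1.continuous.comp (Continuous.prodMk_right t)

theorem strictMono_of_equivPerm {c : Equiv.Perm ℝ} (hc : c ∈ equivPerm) (h : Continuous c) :
    StrictMono c := by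
  rcases h.strictMono_of_inj c.injective with h | h
  · exact h
  · have h1 := h (show (0 : ℝ) < 0 + 1 by norm_num)
    rw [hc] at h1
    linarith

theorem strictMono_of_mem_equivIsot {r : ℕ∞} {g : ℝ → Equiv.Perm ℝ} (hg : g ∈ equivIsot r) (t : ℝ) :
    StrictMono (g t) :=
  strictMono_of_equivPerm ((mem_equivIsot.1 hg).2 t)
    (continuous_of_mem_lineIsot (mem_equivIsot.1 hg).1 t)

/-- An isotopy of the line supported in an interval of length less than `1` extends periodically to
an isotopy commuting with integer translations. -/
theorem exists_periodic_extension {r : ℕ∞} {g : ℝ → Equiv.Perm ℝ} (hg : g ∈ lineIsot r) {a η : ℝ}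
    (hη : 0 < η) (h : ∀ t, ∀ x ∉ Set.Ioo (a + η) (a + 1 - η), g t x = x) :
    ∃ p ∈ equivIsot r, ∀ t, ∀ x ∈ Set.Icc a (a + 1), p t x = g t x := by
  let P : (ℝ → Equiv.Perm ℝ) → ℝ → ℝ → ℝ := fun g t x => g t (x - ⌊x - a⌋) + ⌊x - a⌋
  set η' := min η 1 with hη'
  have hη'0 : 0 < η' := lt_min hη one_pos
  have l1 : η' ≤ η := min_le_left _ _
  have l2 : η' ≤ 1 := min_le_right _ _
  have P1 : ∀ {g : ℝ → Equiv.Perm ℝ}, (∀ t, ∀ x ∉ Set.Ioo (a + η) (a + 1 - η), g t x = x) →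
      ∀ (m : ℤ) t x, a + m - η' < x → x < a + m + 1 + η' → P g t x = g t (x - m) + m := by
    intro g h m t x hx1 hx2
    rcases lt_or_ge x (a + m) with h1 | h1
    · have hf : ⌊x - a⌋ = m - 1 := by
        rw [Int.floor_eq_iff]; push_cast; constructor <;> linarith
      simp only [P]
      rw [hf, h t _ fun hc => ?_, h t _ fun hc => ?_]
      · push_cast; ring
      · linarith [hc.1]
      · have := hc.2; push_cast at this; linarith
    · rcases lt_or_ge x (a + m + 1) with h2 | h2
      · have hf : ⌊x - a⌋ = m := by
          rw [Int.floor_eq_iff]; constructor <;> linarith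
        simp only [P, hf]
      · have hf : ⌊x - a⌋ = m + 1 := by
          rw [Int.floor_eq_iff]; push_cast; constructor <;> linarith
        simp only [P]
        rw [hf, h t _ fun hc => ?_, h t _ fun hc => ?_]
        · push_cast; ring
        · linarith [hc.2]
        · have := hc.1; push_cast at this; linarith
  have P2 : ∀ {g : ℝ → Equiv.Perm ℝ}, (∀ t, ∀ x ∉ Set.Ioo (a + η) (a + 1 - η), g t x = x) →
      ContDiff ℝ r (fun z : ℝ × ℝ => g z.1 z.2) → ContDiff ℝ r (fun z : ℝ × ℝ => P g z.1 z.2) := by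
    intro g h hg
    refine contDiff_iff_contDiffAt.2 fun z => ?_
    set m := ⌊z.2 - a⌋ with hm
    have k1 : (m : ℝ) ≤ z.2 - a := Int.floor_le _
    have k2 : z.2 - a < m + 1 := Int.lt_floor_add_one _
    have : (fun z : ℝ × ℝ => P g z.1 z.2) =ᶠ[nhds z] fun z => g z.1 (z.2 - m) + m := by
      filter_upwards [continuousAt_snd.preimage_mem_nhds (Ioo_mem_nhds
        (show a + m - η' < z.2 by linarith) (show z.2 < a + m + 1 + η' by linarith))] with w hw
      exact P1 h m w.1 w.2 hw.1 hw.2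
    refine ContDiffAt.congr_of_eventuallyEq ?_ this
    exact ((hg.comp (contDiff_fst.prodMk (contDiff_snd.sub contDiff_const))).add
      contDiff_const).contDiffAt
  have h' : ∀ t, ∀ x ∉ Set.Ioo (a + η) (a + 1 - η), g⁻¹ t x = x := fun t x hx =>
    Equiv.Perm.inv_eq_iff_eq.2 (h t x hx).symm
  have maps : ∀ {g : ℝ → Equiv.Perm ℝ}, (∀ t, ∀ x ∉ Set.Ioo (a + η) (a + 1 - η), g t x = x) →
      ∀ t, ∀ x ∈ Set.Ico a (a + 1), g t x ∈ Set.Ico a (a + 1) := by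
    intro g h t x hx
    by_contra hc
    have h1 : g t x ∉ Set.Ioo (a + η) (a + 1 - η) := fun h2 =>
      hc ⟨by linarith [h2.1], by linarith [h2.2]⟩
    have h2 := (g t).injective (h t _ h1)
    rw [h2] at hc
    exact hc hx
  have inv : ∀ {g : ℝ → Equiv.Perm ℝ}, (∀ t, ∀ x ∉ Set.Ioo (a + η) (a + 1 - η), g t x = x) →
      ∀ t x, P g⁻¹ t (P g t x) = x := by
    intro g h t x
    have k1 : (⌊x - a⌋ : ℝ) ≤ x - a := Int.floor_le _
    have k2 : x - a < ⌊x - a⌋ + 1 := Int.lt_floor_add_one _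
    have h1 := maps h t (x - ⌊x - a⌋) ⟨by linarith, by linarith⟩
    have hf : ⌊P g t x - a⌋ = ⌊x - a⌋ := by
      rw [Int.floor_eq_iff]
      constructor <;> simp only [P] <;> linarith [h1.1, h1.2]
    rw [show P g⁻¹ t (P g t x) = g⁻¹ t (P g t x - ⌊P g t x - a⌋) + ⌊P g t x - a⌋ from rfl, hf]
    simp [P]
  let p : ℝ → Equiv.Perm ℝ := fun t =>
    { toFun := P g t
      invFun := P g⁻¹ t
      left_inv := inv h t
      right_inv := by
        have := inv h' t
        rwa [inv_inv] at this }
  refine ⟨p, mem_equivIsot.2 ⟨⟨P2 h hg.1, P2 h' hg.2.1, ?_⟩, fun t x => ?_⟩, fun t x hx => ?_⟩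
  · ext x
    show P g 0 x = x
    simp [P, hg.2.2]
  · show P g t (x + 1) = P g t x + 1
    have : ⌊x + 1 - a⌋ = ⌊x - a⌋ + 1 := by
      rw [← Int.floor_add_one]; congr 1; ring
    simp only [P, this]
    push_cast
    rw [show x + 1 - ((⌊x - a⌋ : ℝ) + 1) = x - ⌊x - a⌋ by ring]
    ring
  · have := P1 h 0 t x (by simp; linarith [hx.1]) (by simp; linarith [hx.2])
    rw [Int.cast_zero, sub_zero, add_zero] at this
    exact this

/-- An isotopy of the circle supported in the arc `(a, d)` that moves a neighborhood of `b` to a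
neighborhood of `c` by translations. -/
theorem exists_arc_translation (r : ℕ∞) {a b c d : ℝ} (hab : a < b) (hac : a < c) (hbd : b < d)
    (hcd : c < d) (hda : d ≤ a + 1) : ∃ g ∈ equivIsot r, ∃ η > 0,
      (∀ t x, |x - b| < η → g t x = x + Real.smoothTransition t * (c - b)) ∧
      ∀ t, ∀ x ∈ Set.Icc a (a + 1), x ∉ Set.Ioo (a + η) (d - η) → g t x = x := by
  obtain ⟨g, hg, η, hη, h1, h2⟩ := exists_translation_cutoff r hab hac hbd hcd
  obtain ⟨p, hp, hpg⟩ := exists_periodic_extension hg (a := a) hη fun t x hx =>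
    h2 t x fun hc => hx ⟨hc.1, by linarith [hc.2]⟩
  refine ⟨p, hp, min η (min (b - a) (d - b)), by simp [hη, hab, hbd], fun t x hx => ?_,
    fun t x hx hx' => ?_⟩
  · simp only [lt_min_iff, abs_lt] at hx
    rw [hpg t x ⟨by linarith, by linarith⟩, h1 t x (abs_lt.2 hx.1)]
  · rw [hpg t x hx, h2 t x fun hc => hx' ⟨?_, ?_⟩]
    · linarith [min_le_left η (min (b - a) (d - b)), hc.1]
    · linarith [min_le_left η (min (b - a) (d - b)), hc.2]

theorem smoothTransition_comp_mem_equivIsot {r : ℕ∞} {g : ℝ → Equiv.Perm ℝ} (hg : g ∈ equivIsot r) :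
    (fun t => g (Real.smoothTransition t)) ∈ equivIsot r := by
  obtain ⟨h1, h2⟩ := mem_equivIsot.1 hg
  have c : ContDiff ℝ r fun z : ℝ × ℝ => (Real.smoothTransition z.1, z.2) :=
    (Real.smoothTransition.contDiff.comp contDiff_fst).prodMk contDiff_snd
  exact mem_equivIsot.2 ⟨⟨h1.1.comp c, h1.2.1.comp c, by
    show g (Real.smoothTransition 0) = 1
    rw [Real.smoothTransition.zero, h1.2.2]⟩, fun t => h2 _⟩

/-- An isotopy of the circle that keeps the point `p` fixed can be changed outside a neighborhood of
`p` so as to be supported near `p`. -/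
theorem exists_arc_cutoff {r : ℕ∞} {u : ℝ → Equiv.Perm ℝ} (hu : u ∈ equivIsot r) {p : ℝ}
    (hup : ∀ t, u t p = p) {ε : ℝ} (hε : 0 < ε) (hε' : ε < 1 / 2) :
    ∃ v ∈ equivIsot r, ∃ δ > 0,
      (∀ t x, |x - p| < δ → v t x = u (Real.smoothTransition t) x) ∧
      ∀ t x, ε ≤ |x - p| → |x - p| ≤ 1 / 2 → v t x = x := by
  have hτ := smoothTransition_comp_mem_equivIsot hu
  -- Conjugation by a translation moves `p` to `0`.
  let T : Equiv.Perm ℝ := Equiv.addRight p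
  let w : ℝ → Equiv.Perm ℝ := fun t => T⁻¹ * u (Real.smoothTransition t) * T
  have wx : ∀ t x, w t x = u (Real.smoothTransition t) (x + p) - p := fun t x => by
    simp [w, T, Equiv.Perm.mul_apply, sub_eq_add_neg]
  have hw : w ∈ equivIsot r := by
    obtain ⟨h1, h2⟩ := mem_equivIsot.1 hτ
    have c : ContDiff ℝ r fun z : ℝ × ℝ => (z.1, z.2 + p) := by fun_prop
    refine mem_equivIsot.2 ⟨⟨?_, ?_, ?_⟩, fun t x => ?_⟩
    · simp_rw [wx]
      exact (h1.1.comp c).sub contDiff_const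
    · have : ∀ z : ℝ × ℝ, (w z.1).symm z.2 =
          (u (Real.smoothTransition z.1)).symm (z.2 + p) - p := fun z => by
        rw [Equiv.symm_apply_eq, wx]; simp
      simp_rw [this]
      exact (h1.2.1.comp c).sub contDiff_const
    · have : u (Real.smoothTransition 0) = 1 := h1.2.2
      show T⁻¹ * u (Real.smoothTransition 0) * T = 1
      rw [this, mul_one, inv_mul_cancel]
    · rw [wx, wx, show x + 1 + p = x + p + 1 by ring, h2 t]; ring
  have hsm : ∀ ε > 0, ∃ δ > 0, ∀ t x, |x| ≤ δ → |w t x| < ε := by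
    intro ε hε
    have hc : Continuous fun z : ℝ × ℝ => u z.1 (z.2 + p) - p :=
      ((mem_equivIsot.1 hu).1.1.continuous.comp (by fun_prop : Continuous
        fun z : ℝ × ℝ => (z.1, z.2 + p))).sub continuous_const
    obtain ⟨U, V, hU, hV, hU', hV', hUV⟩ := generalized_tube_lemma
      (s := Set.Icc (0 : ℝ) 1) isCompact_Icc (t := {(0 : ℝ)}) isCompact_singleton
      (n := {z | |u z.1 (z.2 + p) - p| < ε}) (isOpen_lt hc.abs continuous_const)
      (by rintro ⟨t, x⟩ ⟨_, rfl⟩; simp [hup, hε])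
    obtain ⟨δ, hδ, hb⟩ := Metric.isOpen_iff.1 hV 0 (hV' rfl)
    refine ⟨δ / 2, by linarith, fun t x hx => ?_⟩
    rw [wx]
    exact hUV (Set.mk_mem_prod (hU' ⟨Real.smoothTransition.nonneg t,
      Real.smoothTransition.le_one t⟩) (hb (by
        rw [Metric.mem_ball, Real.dist_eq, sub_zero]; linarith)))
  obtain ⟨v, hv, δ, hδ, v1, v2⟩ := exists_cutoff (mem_equivIsot.1 hw).1
    (strictMono_of_mem_equivIsot hw) (fun t => by rw [wx]; simp [hup]) hsm hε
  let v' : ℝ → Equiv.Perm ℝ := fun t => T * v t * T⁻¹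
  have v'x : ∀ t x, v' t x = v t (x - p) + p := fun t x => by
    simp [v', T, Equiv.Perm.mul_apply, sub_eq_add_neg]
  have hv' : v' ∈ lineIsot r := by
    have c : ContDiff ℝ r fun z : ℝ × ℝ => (z.1, z.2 - p) := by fun_prop
    refine ⟨?_, ?_, by simp [v', hv.2.2]⟩
    · simp_rw [v'x]
      exact (hv.1.comp c).add contDiff_const
    · have : ∀ z : ℝ × ℝ, (v' z.1).symm z.2 = (v z.1).symm (z.2 - p) + p := fun z => by
        rw [Equiv.symm_apply_eq, v'x]; simp
      simp_rw [this]
      exact (hv.2.1.comp c).add contDiff_const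
  obtain ⟨q, hq, hqv⟩ := exists_periodic_extension hv' (a := p - 1 / 2) (η := 1 / 2 - ε)
    (by linarith) fun t x hx => by
      rw [v'x, v2 t (x - p) ?_]
      · ring
      · by_contra hc
        rw [not_le, abs_lt] at hc
        exact hx ⟨by linarith, by linarith⟩
  refine ⟨q, hq, min δ (1 / 2), by simp [hδ], fun t x hx => ?_, fun t x h1 h2 => ?_⟩
  · rw [lt_min_iff] at hx
    have h3 := abs_lt.1 hx.2
    rw [hqv t x ⟨by linarith, by linarith⟩, v'x, v1 t _ hx.1, wx]
    simp
  · have h3 := abs_le.1 h2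
    rw [hqv t x ⟨by linarith, by linarith⟩, v'x, v2 t _ h1]
    ring

/-! ### The circle as a quotient of the line -/

theorem contMDiff_circleCover {n : ℕ∞ω} : ContMDiff 𝓘(ℝ, ℝ) (𝓡 1) n circleCover :=
  contMDiff_circleExp.comp (contDiff_const.mul contDiff_id).contMDiff

theorem circleCover_add (s t : ℝ) : circleCover (s + t) = circleCover s * circleCover t := by
  rw [circleCover, mul_add, Circle.exp_add]; rfl

theorem circleCover_add_one (x : ℝ) : circleCover (x + 1) = circleCover x :=
  circleCover_eq_iff.2 ⟨1, by simp⟩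

theorem circleCover_add_int (x : ℝ) (n : ℤ) : circleCover (x + n) = circleCover x :=
  circleCover_eq_iff.2 ⟨n, rfl⟩

theorem isOpenMap_circleCover : IsOpenMap circleCover :=
  isCoveringMap_circleCover.isLocalHomeomorph.isOpenMap

/-- The section of `circleCover` with values in `(x₀ - 1/2, x₀ + 1/2]`. -/
noncomputable def circleLift (x₀ : ℝ) (q : Circle) : ℝ :=
  x₀ + Complex.arg (q / circleCover x₀ : Circle) / (2 * Real.pi)

theorem circleCover_circleLift (x₀ : ℝ) (q : Circle) : circleCover (circleLift x₀ q) = q := by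
  rw [circleLift, circleCover_add]
  have : circleCover (Complex.arg (q / circleCover x₀ : Circle) / (2 * Real.pi)) =
      q / circleCover x₀ := by
    rw [circleCover, mul_div_cancel₀ _ (by positivity), Circle.exp_arg]
  rw [this, mul_div_cancel]

theorem circleLift_circleCover {x₀ x : ℝ} (h : |x - x₀| < 1 / 2) :
    circleLift x₀ (circleCover x) = x := by
  have e : circleCover x / circleCover x₀ = Circle.exp (2 * Real.pi * (x - x₀)) := by
    rw [div_eq_iff_eq_mul]
    change _ = circleCover (x - x₀) * _
    rw [← circleCover_add, sub_add_cancel]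
  have hp := Real.pi_pos
  rw [abs_lt] at h
  rw [circleLift, e, Circle.arg_exp (by nlinarith) (by nlinarith)]
  field_simp
  ring

theorem contMDiffAt_circleLift {n : ℕ∞ω} {x₀ x : ℝ} (h : |x - x₀| < 1 / 2) :
    ContMDiffAt (𝓡 1) 𝓘(ℝ, ℝ) n (circleLift x₀) (circleCover x) := by
  have := finrank_real_complex_fact'
  have hp := Real.pi_pos
  have e : circleCover x / circleCover x₀ = Circle.exp (2 * Real.pi * (x - x₀)) := by
    rw [div_eq_iff_eq_mul]
    change _ = circleCover (x - x₀) * _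
    rw [← circleCover_add, sub_add_cancel]
  have hs : ((circleCover x / circleCover x₀ : Circle) : ℂ) ∈ Complex.slitPlane := by
    rw [Complex.mem_slitPlane_iff_arg, e]
    rw [abs_lt] at h
    rw [Circle.arg_exp (by nlinarith) (by nlinarith)]
    refine ⟨fun hc => ?_, Circle.coe_ne_zero _⟩
    nlinarith
  have h1 : ContMDiff (𝓡 1) 𝓘(ℝ, ℂ) n (fun q : Circle => (q : ℂ)) := contMDiff_coe_sphere
  have h2 : ContMDiff (𝓡 1) (𝓡 1) n (fun q : Circle => q / circleCover x₀) := by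
    have : ContMDiff (𝓡 1) (𝓡 1) ω (fun q : Circle => q / circleCover x₀) := by
      simp_rw [div_eq_mul_inv]
      exact contMDiff_mul_right
    exact this.of_le le_top
  have h3 : ContDiffAt ℝ n (fun z : ℂ => x₀ + Complex.arg z / (2 * Real.pi))
      (circleCover x / circleCover x₀ : Circle) := by
    have h4 : ContDiffAt ℝ n (fun z : ℂ => Complex.imCLM (Complex.log z))
        (circleCover x / circleCover x₀ : Circle) :=
      Complex.imCLM.contDiff.contDiffAt.comp _ ((Complex.contDiffAt_log hs).restrict_scalars ℝ)
    simp only [Complex.imCLM_apply, Complex.log_im] at h4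
    exact contDiffAt_const.add (h4.div_const _)
  exact ContMDiffAt.comp (g := fun z : ℂ => x₀ + Complex.arg z / (2 * Real.pi))
    (f := fun q : Circle => ((q / circleCover x₀ : Circle) : ℂ)) (circleCover x) h3.contMDiffAt
    (h1.comp h2).contMDiffAt

/-! ### Developing maps of a bundle over the circle -/

section Developing

variable {EN : Type*} [NormedAddCommGroup EN] [NormedSpace ℝ EN] {HN : Type*} [TopologicalSpace HN]
  {EM : Type*} [NormedAddCommGroup EM] [NormedSpace ℝ EM] {HM : Type*} [TopologicalSpace HM]
  {N : Type*} [TopologicalSpace N] [ChartedSpace HN N]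
  {M : Type*} [TopologicalSpace M] [ChartedSpace HM M]
  {IN : ModelWithCorners ℝ EN HN} {IM : ModelWithCorners ℝ EM HM} {Γ : Subgroup (Equiv.Perm N)}
  {π : M → Circle}

/-- A trivialization over `U ⊆ ℝ` of the pullback of a bundle over the circle to the line: a smooth
map `(x, y) ↦ toMap (x, y)` sending `{x} × N` to the fiber over `circleCover x` in a way
compatible with `Γ`. The inverse on fibers `fib (x, m)` is meaningful when `m` lies over
`circleCover x`, and smoothness is only required there. -/
structure DevelopingChart (ξ : GammaBundle (𝓡 1) IN IM Γ π) (U : Set ℝ) where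
  /-- the trivialization -/
  toMap : ℝ × N → M
  /-- its inverse on the fibers -/
  fib : ℝ × M → N
  proj : ∀ x ∈ U, ∀ y, π (toMap (x, y)) = circleCover x
  fib_toMap : ∀ x ∈ U, ∀ y, fib (x, toMap (x, y)) = y
  toMap_fib : ∀ x ∈ U, ∀ m, π m = circleCover x → toMap (x, fib (x, m)) = m
  smooth : ContMDiffOn (𝓘(ℝ, ℝ).prod IN) IM ∞ toMap {z | z.1 ∈ U}
  smooth_fib : ContMDiffOn (𝓘(ℝ, ℝ).prod IM) IN ∞ fib {z | z.1 ∈ U ∧ π z.2 = circleCover z.1}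
  gamma : ∀ x ∈ U, ∀ e ∈ ξ.atlas, circleCover x ∈ e.baseSet →
    ∃ γ ∈ Γ, ∀ y, (e (toMap (x, y))).2 = γ y

namespace DevelopingChart

variable {ξ : GammaBundle (𝓡 1) IN IM Γ π} {U V : Set ℝ}

/-- A local trivialization of the bundle is a developing chart. -/
noncomputable def ofTriv {e : Bundle.Trivialization N π} (he : e ∈ ξ.atlas) :
    DevelopingChart ξ (circleCover ⁻¹' e.baseSet) where
  toMap z := e.toOpenPartialHomeomorph.symm (circleCover z.1, z.2)
  fib z := (e z.2).2
  proj x hx y := GammaBundle.proj_symm hx y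
  fib_toMap x hx y := GammaBundle.snd_symm hx y
  toMap_fib x hx m hm := by
    rw [← hm]
    refine GammaBundle.symm_surj ?_
    rw [hm]
    exact hx
  smooth := by
    refine (ξ.smooth e he).2.comp
      ((contMDiff_circleCover.comp contMDiff_fst).prodMk contMDiff_snd).contMDiffOn fun z hz => ?_
    exact e.mem_target.2 hz
  smooth_fib := by
    refine contMDiff_snd.comp_contMDiffOn ((ξ.smooth e he).1.comp contMDiff_snd.contMDiffOn ?_)
    intro z hz
    refine e.mem_source.2 ?_
    rw [hz.2]
    exact hz.1
  gamma x hx e' he' hx' := ξ.compat e he e' he' _ ⟨hx, hx'⟩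

/-- The coordinate change between two developing charts takes values in `Γ`. -/
theorem exists_transition (A : DevelopingChart ξ U) (B : DevelopingChart ξ V) {x x' : ℝ}
    (hx : x ∈ U) (hx' : x' ∈ V) (h : circleCover x = circleCover x') :
    ∃ γ ∈ Γ, ∀ y, B.fib (x', A.toMap (x, y)) = γ y := by
  obtain ⟨e, he, hq⟩ := ξ.cover (circleCover x)
  obtain ⟨γ, hγ, h1⟩ := A.gamma x hx e he hq
  obtain ⟨γ', hγ', h2⟩ := B.gamma x' hx' e he (h ▸ hq)
  refine ⟨γ'⁻¹ * γ, Γ.mul_mem (Γ.inv_mem hγ') hγ, fun y => ?_⟩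
  rw [Equiv.Perm.mul_apply, Equiv.Perm.eq_inv_iff_eq, ← h2, B.toMap_fib x' hx' _
    ((A.proj x hx y).trans h), h1]

/-- Pulling back a developing chart by an integer translation. -/
noncomputable def shift (A : DevelopingChart ξ U) (n : ℤ) :
    DevelopingChart ξ {x | x - n ∈ U} where
  toMap z := A.toMap (z.1 - n, z.2)
  fib z := A.fib (z.1 - n, z.2)
  proj x hx y := by rw [A.proj _ hx, ← circleCover_add_int _ n, sub_add_cancel]
  fib_toMap x hx y := A.fib_toMap _ hx y
  toMap_fib x hx m hm := A.toMap_fib _ hx m (by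
    rw [hm, ← circleCover_add_int (x - n) n, sub_add_cancel])
  smooth := A.smooth.comp ((contMDiff_fst.sub contMDiff_const).prodMk contMDiff_snd).contMDiffOn
    fun z hz => hz
  smooth_fib := A.smooth_fib.comp
    ((contMDiff_fst.sub contMDiff_const).prodMk contMDiff_snd).contMDiffOn fun z hz => ⟨hz.1, by
      rw [hz.2, ← circleCover_add_int (z.1 - n) n, sub_add_cancel]⟩
  gamma x hx e he hq := A.gamma _ hx e he (by
    rwa [← circleCover_add_int (x - n) n, sub_add_cancel])

/-- Two developing charts that overlap near `c` can be glued. To the right of `c` the second chart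
is corrected by the coordinate change at the point `β x`, where `β` is the identity near `c` and
constant away from `c`. -/
theorem exists_glue (A : DevelopingChart ξ U) (B : DevelopingChart ξ V) {c η : ℝ} (hη : 0 < η)
    (hU : Set.Ioo (c - η) (c + η) ⊆ U) (hV : Set.Ioo (c - η) (c + η) ⊆ V) :
    ∃ D : DevelopingChart ξ ((U ∩ Set.Iio (c + η)) ∪ (V ∩ Set.Ioi (c - η))),
      (∀ x ≤ c, ∀ y, D.toMap (x, y) = A.toMap (x, y)) ∧
      ∀ x, c + η ≤ x → ∀ y, D.toMap (x, y) = B.toMap (x, B.fib (c, A.toMap (c, y))) := by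
  classical
  let χ : ContDiffBump c := ⟨η / 2, η, by linarith, by linarith⟩
  let β : ℝ → ℝ := fun x => c + χ x * (x - c)
  have βs : ContMDiff 𝓘(ℝ, ℝ) 𝓘(ℝ, ℝ) ∞ β :=
    (contDiff_const.add (χ.contDiff.mul (contDiff_id.sub contDiff_const))).contMDiff
  have β1 : ∀ x, |x - c| ≤ η / 2 → β x = x := fun x hx => by
    have : χ x = 1 := χ.one_of_mem_closedBall (by rwa [Metric.mem_closedBall, Real.dist_eq])
    simp [β, this]
  have β0 : ∀ x, η ≤ |x - c| → β x = c := fun x hx => by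
    have : χ x = 0 := by
      by_contra hne
      have hs : x ∈ Function.support χ := hne
      rw [χ.support_eq, Metric.mem_ball, Real.dist_eq] at hs
      exact absurd hs (not_lt.2 hx)
    simp [β, this]
  have βmem : ∀ x, β x ∈ Set.Ioo (c - η) (c + η) := fun x => by
    have : |χ x * (x - c)| < η := by
      rcases lt_or_ge |x - c| η with h | h
      · rw [abs_mul, abs_of_nonneg χ.nonneg]
        exact (mul_le_of_le_one_left (abs_nonneg _) χ.le_one).trans_lt h
      · have := β0 x h
        simp only [β, add_eq_left] at this
        rwa [this, abs_zero]
    rw [abs_lt] at this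
    constructor <;> simp only [β] <;> linarith
  have βU : ∀ x, β x ∈ U := fun x => hU (βmem x)
  have βV : ∀ x, β x ∈ V := fun x => hV (βmem x)
  set W := (U ∩ Set.Iio (c + η)) ∪ (V ∩ Set.Ioi (c - η)) with hW
  have WU : ∀ x ∈ W, x < c + η → x ∈ U := by
    rintro x (hx | hx) h
    · exact hx.1
    · exact hU ⟨hx.2, h⟩
  have WV : ∀ x ∈ W, c - η < x → x ∈ V := by
    rintro x (hx | hx) h
    · exact hV ⟨h, hx.2⟩
    · exact hx.1
  have iAB : ∀ x y, A.fib (β x, B.toMap (β x, B.fib (β x, A.toMap (β x, y)))) = y := fun x y => by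
    rw [B.toMap_fib _ (βV x) _ (A.proj _ (βU x) _), A.fib_toMap _ (βU x)]
  have iBA : ∀ x y, B.fib (β x, A.toMap (β x, A.fib (β x, B.toMap (β x, y)))) = y := fun x y => by
    rw [A.toMap_fib _ (βU x) _ (B.proj _ (βV x) _), B.fib_toMap _ (βV x)]
  let F : ℝ × N → M := fun z => B.toMap (z.1, B.fib (β z.1, A.toMap (β z.1, z.2)))
  let G : ℝ × M → N := fun z => A.fib (β z.1, B.toMap (β z.1, B.fib z))
  have cβ : ContMDiff (𝓘(ℝ, ℝ).prod IN) 𝓘(ℝ, ℝ) ∞ (fun z : ℝ × N => β z.1) :=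
    βs.comp contMDiff_fst
  have cF : ContMDiffOn (𝓘(ℝ, ℝ).prod IN) IM ∞ F {z | z.1 ∈ V} := by
    have k1 : ContMDiff (𝓘(ℝ, ℝ).prod IN) IM ∞ (fun z : ℝ × N => A.toMap (β z.1, z.2)) :=
      contMDiffOn_univ.1 (A.smooth.comp (cβ.prodMk contMDiff_snd).contMDiffOn fun z _ => βU z.1)
    have k2 : ContMDiff (𝓘(ℝ, ℝ).prod IN) IN ∞
        (fun z : ℝ × N => B.fib (β z.1, A.toMap (β z.1, z.2))) :=
      contMDiffOn_univ.1 (B.smooth_fib.comp (cβ.prodMk k1).contMDiffOn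
        fun z _ => ⟨βV z.1, A.proj _ (βU z.1) _⟩)
    exact B.smooth.comp (contMDiff_fst.prodMk k2).contMDiffOn fun z hz => hz
  have cG : ContMDiffOn (𝓘(ℝ, ℝ).prod IM) IN ∞ G {z | z.1 ∈ V ∧ π z.2 = circleCover z.1} := by
    have cβ' : ContMDiff (𝓘(ℝ, ℝ).prod IM) 𝓘(ℝ, ℝ) ∞ (fun z : ℝ × M => β z.1) :=
      βs.comp contMDiff_fst
    have k1 := B.smooth.comp (cβ'.contMDiffOn.prodMk B.smooth_fib) fun z _ => βV z.1
    exact A.smooth_fib.comp (cβ'.contMDiffOn.prodMk k1) fun z _ => ⟨βU z.1, B.proj _ (βV z.1) _⟩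
  -- Both formulas are valid near `c`.
  have agreeF : ∀ z : ℝ × N, |z.1 - c| ≤ η / 2 → F z = A.toMap z := fun z hz => by
    have hm : z.1 ∈ V := by rw [← β1 _ hz]; exact βV _
    have hm' : z.1 ∈ U := by rw [← β1 _ hz]; exact βU _
    simp only [F]
    rw [β1 _ hz, B.toMap_fib _ hm _ (A.proj _ hm' _)]
  have agreeG : ∀ z : ℝ × M, |z.1 - c| ≤ η / 2 → π z.2 = circleCover z.1 → G z = A.fib z :=
    fun z hz hπ => by
      have hm : z.1 ∈ V := by rw [← β1 _ hz]; exact βV _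
      simp only [G]
      rw [β1 _ hz, B.toMap_fib _ hm _ hπ]
  have near : ∀ x ≤ c, ∃ ε > 0, x + ε < c + η ∧ ∀ w, |w - x| < ε → w ≤ c ∨ |w - c| ≤ η / 2 := by
    intro x hx
    refine ⟨η / 2, by linarith, by linarith, fun w hw => ?_⟩
    rcases le_or_gt w c with h | h
    · exact Or.inl h
    · refine Or.inr ?_
      rw [abs_lt] at hw
      rw [abs_le]
      constructor <;> linarith
  let D : DevelopingChart ξ W :=
    { toMap := fun z => if z.1 ≤ c then A.toMap z else F z
      fib := fun z => if z.1 ≤ c then A.fib z else G z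
      proj := fun x hx y => by
        by_cases h : x ≤ c
        · simp only [h, if_true]
          exact A.proj x (WU x hx (by linarith)) y
        · simp only [h, if_false]
          exact B.proj x (WV x hx (by linarith)) _
      fib_toMap := fun x hx y => by
        by_cases h : x ≤ c
        · simp only [h, if_true]
          exact A.fib_toMap x (WU x hx (by linarith)) y
        · simp only [h, if_false, F, G]
          rw [B.fib_toMap x (WV x hx (by linarith)), iAB]
      toMap_fib := fun x hx m hm => by
        by_cases h : x ≤ c
        · simp only [h, if_true]
          exact A.toMap_fib x (WU x hx (by linarith)) m hm
        · simp only [h, if_false, F, G]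
          rw [iBA, B.toMap_fib x (WV x hx (by linarith)) m hm]
      smooth := fun z hz => by
        rcases le_or_gt z.1 c with h | h
        · obtain ⟨ε, hε, h1, h2⟩ := near z.1 h
          have hn : {w : ℝ × N | |w.1 - z.1| < ε} ∈ nhds z :=
            (isOpen_lt (by fun_prop) continuous_const).mem_nhds (by simpa using hε)
          refine ((A.smooth z (WU _ hz (by linarith))).mono_of_mem_nhdsWithin
            ?_).congr_of_eventuallyEq_of_mem (s := {z : ℝ × N | z.1 ∈ W}) ?_ hz
          · filter_upwards [self_mem_nhdsWithin, mem_nhdsWithin_of_mem_nhds hn] with w hw hw'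
            exact WU _ hw (by linarith [(abs_lt.1 hw').2])
          · filter_upwards [mem_nhdsWithin_of_mem_nhds hn] with w hw
            rcases h2 _ hw with h3 | h3
            · simp [h3]
            · split_ifs
              · rfl
              · exact agreeF w h3
        · have hn : {w : ℝ × N | c < w.1} ∈ nhds z :=
            (isOpen_lt continuous_const (by fun_prop)).mem_nhds h
          refine ((cF z (WV _ hz (by linarith))).mono_of_mem_nhdsWithin
            ?_).congr_of_eventuallyEq_of_mem (s := {z : ℝ × N | z.1 ∈ W}) ?_ hz
          · filter_upwards [self_mem_nhdsWithin, mem_nhdsWithin_of_mem_nhds hn] with w hw hw'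
            exact WV _ hw (by linarith [show c < w.1 from hw'])
          · filter_upwards [mem_nhdsWithin_of_mem_nhds hn] with w hw
            rw [if_neg (not_le.2 hw)]
      smooth_fib := fun z hz => by
        rcases le_or_gt z.1 c with h | h
        · obtain ⟨ε, hε, h1, h2⟩ := near z.1 h
          have hn : {w : ℝ × M | |w.1 - z.1| < ε} ∈ nhds z :=
            (isOpen_lt (by fun_prop) continuous_const).mem_nhds (by simpa using hε)
          refine ((A.smooth_fib z ⟨WU _ hz.1 (by linarith), hz.2⟩).mono_of_mem_nhdsWithin
            ?_).congr_of_eventuallyEq_of_mem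
            (s := {z : ℝ × M | z.1 ∈ W ∧ π z.2 = circleCover z.1}) ?_ hz
          · filter_upwards [self_mem_nhdsWithin, mem_nhdsWithin_of_mem_nhds hn] with w hw hw'
            exact ⟨WU _ hw.1 (by linarith [(abs_lt.1 hw').2]), hw.2⟩
          · filter_upwards [self_mem_nhdsWithin, mem_nhdsWithin_of_mem_nhds hn] with w hws hw
            rcases h2 _ hw with h3 | h3
            · simp [h3]
            · split_ifs
              · rfl
              · exact agreeG w h3 hws.2
        · have hn : {w : ℝ × M | c < w.1} ∈ nhds z :=
            (isOpen_lt continuous_const (by fun_prop)).mem_nhds h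
          refine ((cG z ⟨WV _ hz.1 (by linarith), hz.2⟩).mono_of_mem_nhdsWithin
            ?_).congr_of_eventuallyEq_of_mem
            (s := {z : ℝ × M | z.1 ∈ W ∧ π z.2 = circleCover z.1}) ?_ hz
          · filter_upwards [self_mem_nhdsWithin, mem_nhdsWithin_of_mem_nhds hn] with w hw hw'
            exact ⟨WV _ hw.1 (by linarith [show c < w.1 from hw']), hw.2⟩
          · filter_upwards [mem_nhdsWithin_of_mem_nhds hn] with w hw
            rw [if_neg (not_le.2 hw)]
      gamma := fun x hx e he hq => by
        by_cases h : x ≤ c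
        · simp only [h, if_true]
          exact A.gamma x (WU x hx (by linarith)) e he hq
        · simp only [h, if_false, F]
          obtain ⟨γ, hγ, h1⟩ := B.gamma x (WV x hx (by linarith)) e he hq
          obtain ⟨γ', hγ', h2⟩ := A.exists_transition B (βU x) (βV x) rfl
          exact ⟨γ * γ', Γ.mul_mem hγ hγ', fun y => by rw [h1, h2]; rfl⟩ }
  refine ⟨D, fun x hx y => if_pos hx, fun x hx y => ?_⟩
  have : ¬ x ≤ c := by linarith
  show (if x ≤ c then A.toMap (x, y) else F (x, y)) = _
  simp only [this, if_false, F]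
  rw [β0 x (by rw [abs_of_nonneg] <;> linarith)]

end DevelopingChart

end Developing

section Developing

variable {EN : Type*} [NormedAddCommGroup EN] [NormedSpace ℝ EN] {HN : Type*} [TopologicalSpace HN]
  {EM : Type*} [NormedAddCommGroup EM] [NormedSpace ℝ EM] {HM : Type*} [TopologicalSpace HM]
  {N : Type*} [TopologicalSpace N] [ChartedSpace HN N]
  {M : Type*} [TopologicalSpace M] [ChartedSpace HM M]
  {IN : ModelWithCorners ℝ EN HN} {IM : ModelWithCorners ℝ EM HM} {Γ : Subgroup (Equiv.Perm N)}
  {π : M → Circle}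

/-- A global trivialization of the pullback of a bundle over the circle to the line, whose monodromy
over the deck transformation `x ↦ x + 1` is constant. It presents the bundle as the mapping torus of
`holonomy`. -/
structure DevelopingMap (ξ : GammaBundle (𝓡 1) IN IM Γ π) extends
    DevelopingChart ξ Set.univ where
  /-- the monodromy of the bundle -/
  holonomy : Equiv.Perm N
  holonomy_mem : holonomy ∈ Γ
  toMap_add_one : ∀ x y, toMap (x + 1, y) = toMap (x, holonomy y)

variable {ξ : GammaBundle (𝓡 1) IN IM Γ π}

theorem exists_developingChart_Icc (ξ : GammaBundle (𝓡 1) IN IM Γ π) :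
    ∃ U : Set ℝ, IsOpen U ∧ Set.Icc 0 1 ⊆ U ∧ Nonempty (DevelopingChart ξ U) := by
  obtain ⟨δ, hδ, hδc⟩ := lebesgue_number_lemma_of_metric (s := Set.Icc (0 : ℝ) 1) isCompact_Icc
    (ι := ξ.atlas) (c := fun e => circleCover ⁻¹' (e : Bundle.Trivialization N π).baseSet)
    (fun e => e.1.open_baseSet.preimage continuous_circleCover) (fun x _ => by
      obtain ⟨e, he, hq⟩ := ξ.cover (circleCover x)
      exact Set.mem_iUnion.2 ⟨⟨e, he⟩, hq⟩)
  have key : ∀ n : ℕ, ∃ U : Set ℝ, IsOpen U ∧ Set.Icc 0 (min 1 (n * (δ / 2))) ⊆ U ∧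
      Nonempty (DevelopingChart ξ U) := by
    intro n
    induction n with
    | zero =>
      obtain ⟨⟨e, he⟩, h⟩ := hδc 0 (by simp)
      refine ⟨_, e.open_baseSet.preimage continuous_circleCover, ?_,
        ⟨DevelopingChart.ofTriv he⟩⟩
      refine Set.Subset.trans ?_ h
      intro x hx
      simp only [Nat.cast_zero, zero_mul, zero_le_one, inf_of_le_right, Set.Icc_self,
        Set.mem_singleton_iff] at hx
      simp [hx, hδ]
    | succ n ih =>
      obtain ⟨U, hU, hUs, ⟨A⟩⟩ := ih
      set b := min 1 (n * (δ / 2)) with hb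
      have hb0 : 0 ≤ b := le_min zero_le_one (by positivity)
      have hb1 : b ≤ 1 := min_le_left _ _
      obtain ⟨⟨e, he⟩, h⟩ := hδc b ⟨hb0, hb1⟩
      obtain ⟨ρ, hρ, hρU⟩ := Metric.isOpen_iff.1 hU b (hUs ⟨hb0, le_rfl⟩)
      have hη : 0 < min ρ δ := lt_min hρ hδ
      have hs1 : Set.Ioo (b - min ρ δ) (b + min ρ δ) ⊆ U := by
        rw [← Real.ball_eq_Ioo]
        exact (Metric.ball_subset_ball (min_le_left _ _)).trans hρU
      have hs2 : Set.Ioo (b - min ρ δ) (b + min ρ δ) ⊆ circleCover ⁻¹' e.baseSet := by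
        rw [← Real.ball_eq_Ioo]
        exact (Metric.ball_subset_ball (min_le_right _ _)).trans h
      obtain ⟨D, -, -⟩ := A.exists_glue (DevelopingChart.ofTriv he) hη hs1 hs2
      refine ⟨_, (hU.inter isOpen_Iio).union
        ((e.open_baseSet.preimage continuous_circleCover).inter isOpen_Ioi), ?_, ⟨D⟩⟩
      intro x hx
      rcases le_or_gt x b with hxb | hxb
      · exact Or.inl ⟨hUs ⟨hx.1, hxb⟩, by show x < _; linarith⟩
      · refine Or.inr ⟨h ?_, by show _ < x; linarith⟩
        rw [Metric.mem_ball, Real.dist_eq, abs_of_pos (by linarith)]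
        have hx1 : x ≤ 1 := hx.2.trans (min_le_left _ _)
        have hx2 : x ≤ (n + 1 : ℕ) * (δ / 2) := hx.2.trans (min_le_right _ _)
        push_cast at hx2
        rcases min_choice 1 (n * (δ / 2)) with h3 | h3 <;> rw [← hb] at h3 <;> linarith
  obtain ⟨n, hn⟩ := exists_nat_gt (1 / (δ / 2))
  obtain ⟨U, h1, h2, h3⟩ := key n
  rw [div_lt_iff₀ (by linarith)] at hn
  rw [min_eq_left hn.le] at h2
  exact ⟨U, h1, h2, h3⟩

/-- Every bundle over the circle is a mapping torus. A trivialization over a neighborhood of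
`[0,1]` is glued to its own translate, which makes the monodromy constant near `1/2`; then it is
extended periodically. -/
theorem exists_developingMap (hΓ : Γ ≤ diffGroup IN N ⊤) (ξ : GammaBundle (𝓡 1) IN IM Γ π) :
    Nonempty (DevelopingMap ξ) := by
  obtain ⟨U, hU, hUs, ⟨A⟩⟩ := exists_developingChart_Icc ξ
  obtain ⟨η₁, h1, h1U⟩ := Metric.isOpen_iff.1 hU 0 (hUs (by simp))
  obtain ⟨η₂, h2, h2U⟩ := Metric.isOpen_iff.1 hU 1 (hUs (by simp))
  obtain ⟨η, hη, hη1, hη2, hη3⟩ : ∃ η > 0, η ≤ η₁ ∧ η ≤ η₂ ∧ η ≤ 1 / 4 :=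
    ⟨min (min η₁ η₂) (1 / 4), by positivity, (min_le_left _ _).trans (min_le_left _ _),
      (min_le_left _ _).trans (min_le_right _ _), min_le_right _ _⟩
  have hUm : ∀ x, -η < x → x < 1 + η → x ∈ U := fun x hx hx' => by
    rcases lt_or_ge x 0 with h | h
    · refine h1U ?_
      rw [Metric.mem_ball, Real.dist_eq, abs_lt]
      constructor <;> linarith
    · rcases le_or_gt x 1 with h' | h'
      · exact hUs ⟨h, h'⟩
      · refine h2U ?_
        rw [Metric.mem_ball, Real.dist_eq, abs_lt]
        constructor <;> linarith
  let B := A.shift 1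
  have hBm : ∀ x, 1 - η < x → x < 2 + η → x - (1 : ℤ) ∈ U := fun x hx hx' => by
    push_cast
    exact hUm _ (by linarith) (by linarith)
  obtain ⟨W, hWm, D, DA, DB⟩ : ∃ W : Set ℝ, (∀ x, -η < x → x < 2 + η → x ∈ W) ∧
      ∃ D : DevelopingChart ξ W, (∀ x ≤ 1, ∀ y, D.toMap (x, y) = A.toMap (x, y)) ∧
        ∀ x, 1 + η ≤ x → ∀ y, D.toMap (x, y) = B.toMap (x, B.fib (1, A.toMap (1, y))) := by
    refine ⟨_, fun x hx hx' => ?_, A.exists_glue B (c := 1) hη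
      (fun x hx => hUm x (by linarith [hx.1]) hx.2)
      (fun x hx => hBm x hx.1 (by linarith [hx.2]))⟩
    rcases lt_or_ge x (1 + η) with h | h
    · exact Or.inl ⟨hUm x hx h, h⟩
    · exact Or.inr ⟨hBm x (by linarith) hx', by show 1 - η < x; linarith⟩
  have h1B : (1 : ℝ) ∈ {x : ℝ | x - (1 : ℤ) ∈ U} := hBm 1 (by linarith) (by linarith)
  obtain ⟨γ, hγ, hγy⟩ := A.exists_transition B (hUm 1 (by linarith) (by linarith)) h1B rfl
  have rel : ∀ x, η ≤ x → x ≤ 1 → ∀ y, D.toMap (x + 1, y) = D.toMap (x, γ y) := fun x hx hx' y => by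
    rw [DB (x + 1) (by linarith), hγy, DA x hx']
    show A.toMap (x + 1 - (1 : ℤ), γ y) = _
    simp
  have relf : ∀ x, η ≤ x → x ≤ 1 → ∀ m, π m = circleCover x →
      D.fib (x, m) = γ (D.fib (x + 1, m)) := fun x hx hx' m hm => by
    have e1 := D.toMap_fib (x + 1) (hWm _ (by linarith) (by linarith)) m
      (by rw [hm, circleCover_add_one])
    rw [rel x hx hx'] at e1
    conv_lhs => rw [← e1]
    exact D.fib_toMap x (hWm _ (by linarith) (by linarith)) _
  have γs : ∀ n : ℤ, ContMDiff IN IN ∞ ((γ ^ n : Equiv.Perm N) : N → N) := fun n =>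
    (hΓ (Γ.zpow_mem hγ n)).1
  let fl : ℝ → ℤ := fun x => ⌊x - 1 / 2⌋
  have flb : ∀ x, 1 / 2 ≤ x - fl x ∧ x - fl x < 3 / 2 := fun x => by
    have k1 : (fl x : ℝ) ≤ x - 1 / 2 := Int.floor_le _
    have k2 : x - 1 / 2 < fl x + 1 := Int.lt_floor_add_one _
    constructor <;> linarith
  have flW : ∀ x, x - fl x ∈ W := fun x =>
    hWm _ (by linarith [(flb x).1]) (by linarith [(flb x).2])
  have cfl : ∀ x (n : ℤ), circleCover (x - n) = circleCover x := fun x n => by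
    rw [← circleCover_add_int (x - n) n, sub_add_cancel]
  let F : ℝ × N → M := fun z => D.toMap (z.1 - fl z.1, (γ ^ fl z.1) z.2)
  let G : ℝ × M → N := fun z => (γ ^ (-fl z.1)) (D.fib (z.1 - fl z.1, z.2))
  have flcase : ∀ x (m : ℤ), η < x - m → x - m < 3 / 2 → fl x = m ∨
      (fl x = m - 1 ∧ x - m ≤ 1) := by
    intro x m hx hx'
    rcases lt_or_ge (x - m) (1 / 2) with h | h
    · refine Or.inr ⟨?_, by linarith⟩
      show ⌊x - 1 / 2⌋ = m - 1
      rw [Int.floor_eq_iff]; push_cast; constructor <;> linarith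
    · refine Or.inl ?_
      show ⌊x - 1 / 2⌋ = m
      rw [Int.floor_eq_iff]; constructor <;> linarith
  have Feq : ∀ x (m : ℤ), η < x - m → x - m < 3 / 2 → ∀ y,
      F (x, y) = D.toMap (x - m, (γ ^ m) y) := by
    intro x m hx hx' y
    rcases flcase x m hx hx' with h | ⟨h, h'⟩ <;> simp only [F, h]
    have := rel (x - m) hx.le h' ((γ ^ (m - 1)) y)
    rw [← Equiv.Perm.mul_apply, ← zpow_one_add, add_sub_cancel] at this
    rw [← this]
    push_cast
    ring_nf
  have Geq : ∀ x (m : ℤ), η < x - m → x - m < 3 / 2 → ∀ p, π p = circleCover x →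
      G (x, p) = (γ ^ (-m)) (D.fib (x - m, p)) := by
    intro x m hx hx' p hp
    rcases flcase x m hx hx' with h | ⟨h, h'⟩ <;> simp only [G, h]
    rw [relf (x - m) hx.le h' p (by rw [cfl, hp]), ← Equiv.Perm.mul_apply, ← zpow_add_one]
    push_cast
    ring_nf
  have hnear : ∀ x : ℝ, Set.Ioo (fl x + η) (fl x + 3 / 2) ∈ nhds x := fun x =>
    Ioo_mem_nhds (by linarith [(flb x).1]) (by linarith [(flb x).2])
  refine ⟨⟨⟨F, G, fun x _ y => ?_, fun x _ y => ?_, fun x _ m hm => ?_, fun z _ => ?_,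
    fun z hz => ?_, fun x _ e he hq => ?_⟩, γ, hγ, fun x y => ?_⟩⟩
  · rw [D.proj _ (flW x), cfl]
  · simp only [F, G]
    rw [D.fib_toMap _ (flW x), zpow_neg]
    exact (γ ^ fl x).symm_apply_apply y
  · simp only [F, G]
    have e : ∀ y, (γ ^ fl x) ((γ ^ (-fl x)) y) = y := fun y => by
      rw [zpow_neg]
      exact (γ ^ fl x).apply_symm_apply y
    rw [e, D.toMap_fib _ (flW x) _ (by rw [cfl, hm])]
  · have hn : {w : ℝ × N | w.1 ∈ Set.Ioo (fl z.1 + η) (fl z.1 + 3 / 2)} ∈ nhds z :=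
      continuousAt_fst.preimage_mem_nhds (hnear z.1)
    refine ContMDiffAt.contMDiffWithinAt ?_
    have h3 : ContMDiffAt (𝓘(ℝ, ℝ).prod IN) IM ∞
        (fun w : ℝ × N => D.toMap (w.1 - fl z.1, (γ ^ fl z.1) w.2)) z := by
      have hW' : {w : ℝ × N | w.1 ∈ W} ∈ nhds (z.1 - fl z.1, (γ ^ fl z.1) z.2) := by
        refine continuousAt_fst.preimage_mem_nhds (Filter.mem_of_superset
          (Ioo_mem_nhds (a := -η) (b := 2 + η) ?_ ?_) fun x hx => hWm x hx.1 hx.2)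
        · have := (flb z.1).1
          show -η < z.1 - fl z.1
          linarith
        · have := (flb z.1).2
          show z.1 - fl z.1 < 2 + η
          linarith
      have c : ContMDiff (𝓘(ℝ, ℝ).prod IN) (𝓘(ℝ, ℝ).prod IN) ∞
          (fun w : ℝ × N => (w.1 - (fl z.1 : ℝ), (γ ^ fl z.1) w.2)) :=
        (contMDiff_fst.sub contMDiff_const).prodMk ((γs _).comp contMDiff_snd)
      exact (D.smooth.contMDiffAt hW').comp z c.contMDiffAt
    refine h3.congr_of_eventuallyEq ?_
    filter_upwards [hn] with w hw
    exact Feq w.1 (fl z.1) (by linarith [hw.1]) (by linarith [hw.2]) w.2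
  · have hn : {w : ℝ × M | w.1 ∈ Set.Ioo (fl z.1 + η) (fl z.1 + 3 / 2)} ∈ nhds z :=
      continuousAt_fst.preimage_mem_nhds (hnear z.1)
    have c : ContMDiff (𝓘(ℝ, ℝ).prod IM) (𝓘(ℝ, ℝ).prod IM) ∞
        (fun w : ℝ × M => (w.1 - (fl z.1 : ℝ), w.2)) :=
      (contMDiff_fst.sub contMDiff_const).prodMk contMDiff_snd
    have h3 := (γs (-fl z.1)).contMDiffAt.comp_contMDiffWithinAt z
      (ContMDiffWithinAt.comp (t := {z | z.1 ∈ W ∧ π z.2 = circleCover z.1}) z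
        (D.smooth_fib (z.1 - fl z.1, z.2) ⟨flW z.1, by rw [hz.2, cfl]⟩)
        (c.contMDiffAt.contMDiffWithinAt (s := {w : ℝ × M |
          w.1 ∈ Set.Ioo (fl z.1 + η) (fl z.1 + 3 / 2) ∧ π w.2 = circleCover w.1}))
        fun w hw => ⟨hWm _ (by have := hw.1.1; show -η < w.1 - fl z.1; linarith)
          (by have := hw.1.2; show w.1 - fl z.1 < 2 + η; linarith), by rw [hw.2, cfl]⟩)
    refine (h3.mono_of_mem_nhdsWithin ?_).congr_of_eventuallyEq_of_mem
      (s := {w : ℝ × M | w.1 ∈ Set.univ ∧ π w.2 = circleCover w.1}) ?_ hz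
    · filter_upwards [self_mem_nhdsWithin, mem_nhdsWithin_of_mem_nhds hn] with w hw hw'
      exact ⟨hw', hw.2⟩
    · filter_upwards [self_mem_nhdsWithin, mem_nhdsWithin_of_mem_nhds hn] with w hw hw'
      exact Geq w.1 (fl z.1) (by linarith [hw'.1]) (by linarith [hw'.2]) w.2 hw.2
  · obtain ⟨γ', hγ', h3⟩ := D.gamma _ (flW x) e he (by rwa [cfl])
    exact ⟨γ' * γ ^ fl x, Γ.mul_mem hγ' (Γ.zpow_mem hγ _), fun y => h3 _⟩
  · have : fl (x + 1) = fl x + 1 := by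
      show ⌊x + 1 - 1 / 2⌋ = ⌊x - 1 / 2⌋ + 1
      rw [← Int.floor_add_one]; congr 1; ring
    simp only [F, this]
    rw [zpow_add_one]
    push_cast
    rw [show x + 1 - ((fl x : ℝ) + 1) = x - fl x by ring]
    rfl

end Developing

/-! ### Isotopies of the bundle -/

/-- A continuous lift to the line of a `C^r` map to the circle is of class `C^r`. -/
theorem contDiff_of_circleCover_comp {r : ℕ∞} {φ : ℝ × ℝ → ℝ} (hc : Continuous φ)
    (h : ContMDiff (𝓘(ℝ, ℝ).prod 𝓘(ℝ, ℝ)) (𝓡 1) r (fun z => circleCover (φ z))) :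
    ContDiff ℝ r φ := by
  rw [← contMDiff_iff_contDiff, modelWithCornersSelf_prod, ← chartedSpaceSelf_prod]
  intro z
  have h1 : ContMDiffAt (𝓘(ℝ, ℝ).prod 𝓘(ℝ, ℝ)) 𝓘(ℝ, ℝ) r
      (fun w => circleLift (φ z) (circleCover (φ w))) z :=
    ContMDiffAt.comp (g := circleLift (φ z)) (f := fun w => circleCover (φ w)) z
      (contMDiffAt_circleLift (by simp)) (h z)
  refine h1.congr_of_eventuallyEq ?_
  filter_upwards [(isOpen_lt (f := fun w => |φ w - φ z|) (g := fun _ => 1 / 2) (by fun_prop)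
    continuous_const).mem_nhds (by simp)] with w hw
  exact (circleLift_circleCover hw).symm

/-- The smooth time change `ℝ → [0,1]`, which is constant for `t ≤ 0` and for `t ≥ 1`. -/
noncomputable def timeChange (t : ℝ) : I :=
  ⟨Real.smoothTransition t, Real.smoothTransition.nonneg t, Real.smoothTransition.le_one t⟩

theorem contMDiff_timeChange {n : ℕ∞} : ContMDiff 𝓘(ℝ, ℝ) (𝓡∂ 1) n timeChange :=
  contMDiff_iff_comp_subtypeVal_Icc.2 ⟨by
    exact Continuous.subtype_mk Real.smoothTransition.continuous _,
    Real.smoothTransition.contDiff.contMDiff⟩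

@[simp] theorem timeChange_zero : timeChange 0 = 0 := Subtype.ext Real.smoothTransition.zero

@[simp] theorem timeChange_one : timeChange 1 = 1 := Subtype.ext Real.smoothTransition.one

section Isotopies

variable {EN : Type*} [NormedAddCommGroup EN] [NormedSpace ℝ EN] {HN : Type*} [TopologicalSpace HN]
  {EM : Type*} [NormedAddCommGroup EM] [NormedSpace ℝ EM] {HM : Type*} [TopologicalSpace HM]
  {N : Type*} [TopologicalSpace N] [ChartedSpace HN N]
  {M : Type*} [TopologicalSpace M] [ChartedSpace HM M]
  {IN : ModelWithCorners ℝ EN HN} {IM : ModelWithCorners ℝ EM HM} {Γ : Subgroup (Equiv.Perm N)}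
  {π : M → Circle}

theorem GammaBundle.contMDiff_proj (ξ : GammaBundle (𝓡 1) IN IM Γ π) :
    ContMDiff IM (𝓡 1) ∞ π := fun m => by
  obtain ⟨e, he, hq⟩ := ξ.cover (π m)
  have hs : e.source ∈ nhds m := e.open_source.mem_nhds (e.mem_source.2 hq)
  refine (contMDiff_fst.contMDiffAt.comp m
    ((ξ.smooth e he).1.contMDiffAt hs)).congr_of_eventuallyEq ?_
  filter_upwards [hs] with w hw
  exact (e.coe_fst hw).symm

/-- Isotopies of bundle diffeomorphisms starting at the identity, parametrized by all of `ℝ`. -/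
def GammaBundle.isotR (ξ : GammaBundle (𝓡 1) IN IM Γ π) (r : ℕ∞) :
    Subgroup (ℝ → Equiv.Perm M) where
  carrier := {F | ContMDiff (IM.prod 𝓘(ℝ, ℝ)) IM r (fun z : M × ℝ => F z.2 z.1) ∧
    ContMDiff (IM.prod 𝓘(ℝ, ℝ)) IM r (fun z : M × ℝ => (F z.2).symm z.1) ∧
    (∀ t, F t ∈ ξ.bundleDiff r) ∧ F 0 = 1}
  one_mem' := ⟨contMDiff_fst, contMDiff_fst, fun _ => Subgroup.one_mem _, rfl⟩
  mul_mem' := fun {F G} hF hG => ⟨hF.1.comp (hG.1.prodMk contMDiff_snd),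
    hG.2.1.comp (hF.2.1.prodMk contMDiff_snd),
    fun t => Subgroup.mul_mem _ (hF.2.2.1 t) (hG.2.2.1 t), by simp [hF.2.2.2, hG.2.2.2]⟩
  inv_mem' := fun {F} hF => ⟨hF.2.1, hF.1, fun t => Subgroup.inv_mem _ (hF.2.2.1 t),
    by simp [hF.2.2.2]⟩

theorem GammaBundle.restrict_mem_isot₀ {ξ : GammaBundle (𝓡 1) IN IM Γ π} {r : ℕ∞}
    {F : ℝ → Equiv.Perm M} (hF : F ∈ ξ.isotR r) : (fun t : I => F t) ∈ ξ.isot₀ r := by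
  have c : ContMDiff (IM.prod (𝓡∂ 1)) (IM.prod 𝓘(ℝ, ℝ)) r (fun z : M × I => (z.1, (z.2 : ℝ))) :=
    contMDiff_fst.prodMk (contMDiff_subtypeVal_Icc.comp contMDiff_snd)
  exact ⟨⟨hF.1.comp c, hF.2.1.comp c⟩, fun t => hF.2.2.1 t, hF.2.2.2⟩

theorem GammaBundle.timeChange_mem_isotR {ξ : GammaBundle (𝓡 1) IN IM Γ π} {r : ℕ∞}
    {F : I → Equiv.Perm M} (hF : F ∈ ξ.isot₀ r) : (fun t => F (timeChange t)) ∈ ξ.isotR r := by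
  have c : ContMDiff (IM.prod 𝓘(ℝ, ℝ)) (IM.prod (𝓡∂ 1)) r
      (fun z : M × ℝ => (z.1, timeChange z.2)) :=
    contMDiff_fst.prodMk (contMDiff_timeChange.comp contMDiff_snd)
  exact ⟨hF.1.1.comp c, hF.1.2.comp c, fun t => hF.2.1 _, by
    show F (timeChange 0) = 1
    rw [timeChange_zero, hF.2.2]⟩

namespace DevelopingMap

variable {ξ : GammaBundle (𝓡 1) IN IM Γ π} (Ψ : DevelopingMap ξ)

theorem proj' (x : ℝ) (y : N) : π (Ψ.toMap (x, y)) = circleCover x := Ψ.proj x trivial y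

theorem fib_toMap' (x : ℝ) (y : N) : Ψ.fib (x, Ψ.toMap (x, y)) = y := Ψ.fib_toMap x trivial y

theorem toMap_fib' {x : ℝ} {m : M} (h : π m = circleCover x) : Ψ.toMap (x, Ψ.fib (x, m)) = m :=
  Ψ.toMap_fib x trivial m h

theorem exists_eq (m : M) : ∃ x y, m = Ψ.toMap (x, y) :=
  ⟨circleLift 0 (π m), _, (Ψ.toMap_fib' (circleCover_circleLift _ _).symm).symm⟩

theorem toMap_add_int (x : ℝ) (n : ℤ) (y : N) :
    Ψ.toMap (x + n, y) = Ψ.toMap (x, (Ψ.holonomy ^ n) y) := by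
  induction n generalizing y with
  | zero => simp
  | succ i ih =>
    have := Ψ.toMap_add_one (x + i) y
    push_cast at ih ⊢
    rw [← add_assoc, this, ih, zpow_add_one]
    rfl
  | pred i ih =>
    have := Ψ.toMap_add_one (x + (-i - 1)) (Ψ.holonomy⁻¹ y)
    push_cast at ih ⊢
    rw [show x + (-(i : ℝ) - 1) + 1 = x + -i by ring, ih] at this
    rw [show Ψ.holonomy (Ψ.holonomy⁻¹ y) = y from Ψ.holonomy.apply_symm_apply y] at this
    rw [← this, zpow_sub_one]
    rfl

/-- Smooth local sections of the developing map. -/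
theorem contMDiffAt_coord {x₀ : ℝ} {m : M} {x : ℝ} (hm : π m = circleCover x)
    (hx : |x - x₀| < 1 / 2) : ContMDiffAt IM (𝓘(ℝ, ℝ).prod IN) ∞
      (fun m => (circleLift x₀ (π m), Ψ.fib (circleLift x₀ (π m), m))) m := by
  have h1 : ContMDiffAt IM 𝓘(ℝ, ℝ) ∞ (fun m => circleLift x₀ (π m)) m :=
    ContMDiffAt.comp (g := circleLift x₀) m (by rw [hm]; exact contMDiffAt_circleLift hx)
      (ξ.contMDiff_proj m)
  refine h1.prodMk ?_
  exact ContMDiffWithinAt.comp (t := {z | z.1 ∈ Set.univ ∧ π z.2 = circleCover z.1}) (s := Set.univ)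
    (f := fun m => (circleLift x₀ (π m), m)) m
    (Ψ.smooth_fib _ ⟨trivial, (circleCover_circleLift _ _).symm⟩) (h1.prodMk contMDiffAt_id)
    fun w _ => ⟨trivial, (circleCover_circleLift _ _).symm⟩

section Descent

variable {EQ : Type*} [NormedAddCommGroup EQ] [NormedSpace ℝ EQ] {HQ : Type*} [TopologicalSpace HQ]
  {IQ : ModelWithCorners ℝ EQ HQ} {Q : Type*} [TopologicalSpace Q] [ChartedSpace HQ Q]
  {EX : Type*} [NormedAddCommGroup EX] [NormedSpace ℝ EX] {HX : Type*} [TopologicalSpace HX]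
  {IX : ModelWithCorners ℝ EX HX} {X : Type*} [TopologicalSpace X] [ChartedSpace HX X]

/-- A map defined on the total space (times a parameter space) is of class `C^r` if its composition
with the developing map is. -/
theorem contMDiff_of_comp {r : ℕ∞} {f : M × Q → X}
    (h : ContMDiff ((𝓘(ℝ, ℝ).prod IN).prod IQ) IX r
      (fun z : (ℝ × N) × Q => f (Ψ.toMap z.1, z.2))) : ContMDiff (IM.prod IQ) IX r f := by
  intro z
  obtain ⟨x, y, hxy⟩ := Ψ.exists_eq z.1
  have hm : π z.1 = circleCover x := by rw [hxy, Ψ.proj']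
  have c := (Ψ.contMDiffAt_coord (x₀ := x) hm (by simp)).of_le
    (show (r : ℕ∞ω) ≤ ∞ by exact_mod_cast le_top)
  have c' : ContMDiffAt (IM.prod IQ) ((𝓘(ℝ, ℝ).prod IN).prod IQ) r
      (fun z : M × Q => ((circleLift x (π z.1), Ψ.fib (circleLift x (π z.1), z.1)), z.2)) z :=
    (c.comp z contMDiffAt_fst).prodMk contMDiffAt_snd
  refine (ContMDiffAt.comp z (h _) c').congr_of_eventuallyEq (Filter.Eventually.of_forall ?_)
  intro w
  show f w = f (Ψ.toMap _, w.2)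
  rw [Ψ.toMap_fib' (circleCover_circleLift _ _).symm]

end Descent

theorem contMDiff_toMap : ContMDiff (𝓘(ℝ, ℝ).prod IN) IM ∞ Ψ.toMap := fun z =>
  (Ψ.smooth z trivial).contMDiffAt Filter.univ_mem

/-- In terms of the developing map, the bundle maps are those given by elements of `Γ` on fibers. -/
theorem exists_covers {f : M → M}
    (h : ∀ x, ∃ x', ∃ γ ∈ Γ, ∀ y, f (Ψ.toMap (x, y)) = Ψ.toMap (x', γ y)) :
    ∃ g, ξ.Covers f g := by
  choose x' γ hγ hx using h
  refine ⟨fun q => circleCover (x' (circleLift 0 q)), fun m => ?_, fun e he e' he' q hq hq' => ?_⟩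
  · have := Ψ.toMap_fib' (circleCover_circleLift 0 (π m)).symm
    conv_lhs => rw [← this]
    rw [hx, Ψ.proj']
  · have hl := circleCover_circleLift 0 q
    obtain ⟨γ₁, h1, h2⟩ := Ψ.gamma (circleLift 0 q) trivial e he (by rwa [hl])
    obtain ⟨γ₂, h3, h4⟩ := Ψ.gamma (x' (circleLift 0 q)) trivial e' he' hq'
    refine ⟨γ₂ * γ (circleLift 0 q) * γ₁⁻¹, Γ.mul_mem (Γ.mul_mem h3 (hγ _)) (Γ.inv_mem h1),
      fun y => ?_⟩
    have h5 : e.toOpenPartialHomeomorph.symm (q, y) = Ψ.toMap (circleLift 0 q, γ₁⁻¹ y) := by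
      have h6 := GammaBundle.symm_surj (e := e) (y := Ψ.toMap (circleLift 0 q, γ₁⁻¹ y))
        (by rw [Ψ.proj', hl]; exact hq)
      rw [h2, Ψ.proj', hl] at h6
      rw [← h6]
      exact congrArg (fun y => e.toOpenPartialHomeomorph.symm (q, y))
        (γ₁.apply_symm_apply y).symm
    rw [h5, hx, h4]
    rfl

theorem exists_gamma {f : M → M} {g : Circle → Circle} (h : ξ.Covers f g) {x x' : ℝ}
    (hx : circleCover x' = g (circleCover x)) :
    ∃ γ ∈ Γ, ∀ y, f (Ψ.toMap (x, y)) = Ψ.toMap (x', γ y) := by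
  obtain ⟨e, he, hq⟩ := ξ.cover (circleCover x)
  obtain ⟨e', he', hq'⟩ := ξ.cover (circleCover x')
  obtain ⟨γ₁, h1, h2⟩ := Ψ.gamma x trivial e he hq
  obtain ⟨γ₂, h3, h4⟩ := Ψ.gamma x' trivial e' he' hq'
  obtain ⟨γ, hγ, h5⟩ := h.2 e he e' he' _ hq (hx ▸ hq')
  refine ⟨γ₂⁻¹ * γ * γ₁, Γ.mul_mem (Γ.mul_mem (Γ.inv_mem h3) hγ) h1, fun y => ?_⟩
  have h6 := GammaBundle.symm_surj (e := e) (y := Ψ.toMap (x, y)) (by rw [Ψ.proj']; exact hq)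
  rw [h2, Ψ.proj'] at h6
  have h7 := h5 (γ₁ y)
  rw [h6] at h7
  have hp : π (f (Ψ.toMap (x, y))) = circleCover x' := by rw [h.1, Ψ.proj', hx]
  have h8 := h4 (Ψ.fib (x', f (Ψ.toMap (x, y))))
  rw [Ψ.toMap_fib' hp, h7] at h8
  have h9 : (γ₂⁻¹ * γ * γ₁) y = Ψ.fib (x', f (Ψ.toMap (x, y))) := by
    rw [mul_assoc, Equiv.Perm.mul_apply, Equiv.Perm.inv_eq_iff_eq, ← h8]
    rfl
  rw [h9, Ψ.toMap_fib' hp]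

theorem mem_isotR {r : ℕ∞} {F : ℝ → Equiv.Perm M}
    (h1 : ContMDiff (IM.prod 𝓘(ℝ, ℝ)) IM r (fun z : M × ℝ => F z.2 z.1))
    (h2 : ContMDiff (IM.prod 𝓘(ℝ, ℝ)) IM r (fun z : M × ℝ => (F z.2).symm z.1))
    (h3 : ∀ t x, ∃ x', ∃ γ ∈ Γ, ∀ y, F t (Ψ.toMap (x, y)) = Ψ.toMap (x', γ y))
    (h4 : F 0 = 1) : F ∈ ξ.isotR r :=
  ⟨h1, h2, fun t => ⟨⟨h1.comp (contMDiff_id.prodMk contMDiff_const),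
    h2.comp (contMDiff_id.prodMk contMDiff_const)⟩, Ψ.exists_covers (h3 t)⟩, h4⟩

/-! ### Lifting isotopies of the base -/

theorem lift_aux {c : Equiv.Perm ℝ} (hc : c ∈ equivPerm) (x : ℝ) (y : N) :
    Ψ.toMap (c (circleLift 0 (π (Ψ.toMap (x, y)))),
      Ψ.fib (circleLift 0 (π (Ψ.toMap (x, y))), Ψ.toMap (x, y))) = Ψ.toMap (c x, y) := by
  rw [Ψ.proj']
  obtain ⟨n, hn⟩ := circleCover_eq_iff.1 (circleCover_circleLift 0 (circleCover x))
  rw [hn, equivPerm_add_int hc, Ψ.toMap_add_int]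
  have h1 : Ψ.toMap (x, y) = Ψ.toMap (x + n, (Ψ.holonomy ^ n)⁻¹ y) := by
    rw [Ψ.toMap_add_int]
    exact congrArg (fun y => Ψ.toMap (x, y)) ((Ψ.holonomy ^ n).apply_symm_apply y).symm
  rw [h1, Ψ.fib_toMap']
  exact congrArg (fun y => Ψ.toMap (c x, y)) ((Ψ.holonomy ^ n).apply_symm_apply y)

open Classical in
/-- The bijection of the total space induced by a bijection of the line commuting with integer
translations, through the presentation of the bundle as a mapping torus (and the identity for
other bijections of the line). -/
noncomputable def lift (c : Equiv.Perm ℝ) : Equiv.Perm M :=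
  if hc : c ∈ equivPerm then
    { toFun := fun m => Ψ.toMap (c (circleLift 0 (π m)), Ψ.fib (circleLift 0 (π m), m))
      invFun := fun m => Ψ.toMap (c⁻¹ (circleLift 0 (π m)), Ψ.fib (circleLift 0 (π m), m))
      left_inv := fun m => by
        obtain ⟨x, y, rfl⟩ := Ψ.exists_eq m
        simp only [Ψ.lift_aux hc, Ψ.lift_aux (equivPerm.inv_mem hc)]
        rw [show c⁻¹ (c x) = x from c.symm_apply_apply x]
      right_inv := fun m => by
        obtain ⟨x, y, rfl⟩ := Ψ.exists_eq m
        simp only [Ψ.lift_aux hc, Ψ.lift_aux (equivPerm.inv_mem hc)]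
        rw [show c (c⁻¹ x) = x from c.apply_symm_apply x] }
  else 1

theorem lift_toMap {c : Equiv.Perm ℝ} (hc : c ∈ equivPerm) (x : ℝ) (y : N) :
    Ψ.lift c (Ψ.toMap (x, y)) = Ψ.toMap (c x, y) := by
  rw [lift, dif_pos hc]
  exact Ψ.lift_aux hc x y

theorem lift_mul {c d : Equiv.Perm ℝ} (hc : c ∈ equivPerm) (hd : d ∈ equivPerm) :
    Ψ.lift (c * d) = Ψ.lift c * Ψ.lift d := by
  ext m
  obtain ⟨x, y, rfl⟩ := Ψ.exists_eq m
  rw [Ψ.lift_toMap (equivPerm.mul_mem hc hd)]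
  show _ = Ψ.lift c (Ψ.lift d (Ψ.toMap (x, y)))
  rw [Ψ.lift_toMap hd, Ψ.lift_toMap hc]
  rfl

theorem lift_one : Ψ.lift 1 = 1 := by
  ext m
  obtain ⟨x, y, rfl⟩ := Ψ.exists_eq m
  rw [Ψ.lift_toMap equivPerm.one_mem]
  rfl

theorem lift_inv {c : Equiv.Perm ℝ} (hc : c ∈ equivPerm) : Ψ.lift c⁻¹ = (Ψ.lift c)⁻¹ := by
  rw [eq_inv_iff_mul_eq_one, ← Ψ.lift_mul (equivPerm.inv_mem hc) hc, inv_mul_cancel, lift_one]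

theorem lift_mem_isotR {r : ℕ∞} {g : ℝ → Equiv.Perm ℝ} (hg : g ∈ equivIsot r) :
    (fun t => Ψ.lift (g t)) ∈ ξ.isotR r := by
  have key : ∀ {g : ℝ → Equiv.Perm ℝ}, g ∈ equivIsot r →
      ContMDiff (IM.prod 𝓘(ℝ, ℝ)) IM r (fun z : M × ℝ => Ψ.lift (g z.2) z.1) := by
    intro g hg
    obtain ⟨h1, h2⟩ := mem_equivIsot.1 hg
    refine Ψ.contMDiff_of_comp ?_
    have e : (fun z : (ℝ × N) × ℝ => Ψ.lift (g z.2) (Ψ.toMap z.1)) =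
        fun z => Ψ.toMap (g z.2 z.1.1, z.1.2) := funext fun z => Ψ.lift_toMap (h2 _) _ _
    rw [e]
    refine (Ψ.contMDiff_toMap.of_le (by exact_mod_cast le_top)).comp
      (ContMDiff.prodMk ?_ (contMDiff_snd.comp contMDiff_fst))
    have h3 : ContMDiff (𝓘(ℝ, ℝ).prod 𝓘(ℝ, ℝ)) 𝓘(ℝ, ℝ) r (fun z : ℝ × ℝ => g z.1 z.2) := by
      have := h1.1.contMDiff
      rwa [modelWithCornersSelf_prod, ← chartedSpaceSelf_prod] at this
    exact h3.comp (contMDiff_snd.prodMk (contMDiff_fst.comp contMDiff_fst))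
  obtain ⟨h1, h2⟩ := mem_equivIsot.1 hg
  refine Ψ.mem_isotR (key hg) ?_ (fun t x => ⟨g t x, 1, Γ.one_mem, fun y =>
    Ψ.lift_toMap (h2 t) x y⟩) (by simp only [h1.2.2, lift_one])
  have := key ((equivIsot r).inv_mem hg)
  convert! this using 2 with z
  have e := Ψ.lift_inv (h2 z.2)
  rw [Pi.inv_apply, e]
  rfl

end DevelopingMap

end Isotopies

/-! ### Decomposition of isotopies of the bundle -/

section Isotopies

variable {EN : Type*} [NormedAddCommGroup EN] [NormedSpace ℝ EN] {HN : Type*} [TopologicalSpace HN]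
  {EM : Type*} [NormedAddCommGroup EM] [NormedSpace ℝ EM] {HM : Type*} [TopologicalSpace HM]
  {N : Type*} [TopologicalSpace N] [ChartedSpace HN N]
  {M : Type*} [TopologicalSpace M] [ChartedSpace HM M]
  {IN : ModelWithCorners ℝ EN HN} {IM : ModelWithCorners ℝ EM HM} {Γ : Subgroup (Equiv.Perm N)}
  {π : M → Circle}

namespace DevelopingMap

variable {ξ : GammaBundle (𝓡 1) IN IM Γ π} (Ψ : DevelopingMap ξ)

theorem eq_of_circleCover_eq {a b : I → ℝ} (ha : Continuous a) (hb : Continuous b)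
    (h : ∀ s, circleCover (a s) = circleCover (b s)) (h0 : a 0 = b 0) : a = b :=
  isCoveringMap_circleCover.eq_of_comp_eq ha hb (funext h) 0 h0

/-- The isotopy of the circle induced by an isotopy of bundle diffeomorphisms lifts to the line. -/
theorem exists_continuous_lift [Nonempty N] {r : ℕ∞} {F : I → Equiv.Perm M} (hF : F ∈ ξ.isot₀ r) :
    ∃ L : C(I × ℝ, ℝ), (∀ s x y, π (F s (Ψ.toMap (x, y))) = circleCover (L (s, x))) ∧
      ∀ x, L (0, x) = x := by
  let y₀ : N := Classical.arbitrary N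
  have hc : Continuous fun z : I × ℝ => π (F z.1 (Ψ.toMap (z.2, y₀))) := by
    have c1 := ξ.continuous_path hF
    have c2 : Continuous fun z : I × ℝ => (Ψ.toMap (z.2, y₀), z.1) :=
      (Ψ.contMDiff_toMap.continuous.comp (by fun_prop)).prodMk continuous_fst
    exact ξ.continuous_proj.comp (c1.comp c2)
  have h0 : ∀ x : ℝ, (⟨_, hc⟩ : C(I × ℝ, Circle)) (0, x) =
      circleCover (ContinuousMap.id ℝ x) := fun x => by
    show π (F 0 (Ψ.toMap (x, y₀))) = _
    rw [hF.2.2]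
    exact Ψ.proj' _ _
  refine ⟨isCoveringMap_circleCover.liftHomotopy _ _ h0, fun s x y => ?_,
    isCoveringMap_circleCover.liftHomotopy_zero _ _ h0⟩
  have h1 := congrFun (isCoveringMap_circleCover.liftHomotopy_lifts _ _ h0) (s, x)
  refine Eq.trans ?_ h1.symm
  obtain ⟨g, hg⟩ := (hF.2.1 s).2
  show π (F s (Ψ.toMap (x, y))) = π (F s (Ψ.toMap (x, y₀)))
  rw [hg.1, hg.1, Ψ.proj', Ψ.proj']

/-- The lift to the line of the base isotopy, as an isotopy of the line; it computes `ν`. -/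
theorem exists_equivIsot [Nonempty N] {r : ℕ∞} {F : I → Equiv.Perm M} (hF : F ∈ ξ.isot₀ r) :
    ∃ g ∈ equivIsot r,
      (∀ t x y, π (F (timeChange t) (Ψ.toMap (x, y))) = circleCover (g t x)) ∧
      ∀ p, nu π (circleCover p) F = g 1 p - p := by
  obtain ⟨L, hL, hL0⟩ := Ψ.exists_continuous_lift hF
  obtain ⟨L', hL', hL'0⟩ := Ψ.exists_continuous_lift ((ξ.isot₀ r).inv_mem hF)
  let y₀ : N := Classical.arbitrary N
  have cancel : ∀ {F : I → Equiv.Perm M} {L L' : C(I × ℝ, ℝ)},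
      (∀ s x y, π (F s (Ψ.toMap (x, y))) = circleCover (L (s, x))) → (∀ x, L (0, x) = x) →
      (∀ s x y, π (F⁻¹ s (Ψ.toMap (x, y))) = circleCover (L' (s, x))) → (∀ x, L' (0, x) = x) →
      ∀ s x, L' (s, L (s, x)) = x := by
    intro F L L' hL hL0 hL' hL'0 s x
    refine congrFun (eq_of_circleCover_eq (a := fun s => L' (s, L (s, x))) (b := fun _ => x)
      (by fun_prop) continuous_const (fun s => ?_) ?_) s
    · have h1 := Ψ.toMap_fib' (hL s x y₀)
      rw [← hL' s _ (Ψ.fib (L (s, x), F s (Ψ.toMap (x, y₀)))), h1, Pi.inv_apply]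
      rw [show (F s)⁻¹ (F s (Ψ.toMap (x, y₀))) = _ from (F s).symm_apply_apply _, Ψ.proj']
    · show L' (0, L (0, x)) = x
      rw [hL0, hL'0]
  have inv1 := cancel hL hL0 hL' hL'0
  have inv2 := cancel (F := F⁻¹) hL' hL'0 (by rwa [inv_inv]) hL0
  let g : ℝ → Equiv.Perm ℝ := fun t =>
    { toFun := fun x => L (timeChange t, x)
      invFun := fun x => L' (timeChange t, x)
      left_inv := inv1 _
      right_inv := inv2 _ }
  have smooth : ∀ {F : I → Equiv.Perm M} {L : C(I × ℝ, ℝ)}, F ∈ ξ.isot₀ r →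
      (∀ s x y, π (F s (Ψ.toMap (x, y))) = circleCover (L (s, x))) →
      ContDiff ℝ r (fun z : ℝ × ℝ => L (timeChange z.1, z.2)) := by
    intro F L hF hL
    refine contDiff_of_circleCover_comp (L.continuous.comp
      (((contMDiff_timeChange (n := 0)).continuous.comp continuous_fst).prodMk
        continuous_snd)) ?_
    simp_rw [← fun (z : ℝ × ℝ) => hL (timeChange z.1) z.2 y₀]
    have hr : (r : ℕ∞ω) ≤ ∞ := by exact_mod_cast le_top
    have c1 : ContMDiff (𝓘(ℝ, ℝ).prod 𝓘(ℝ, ℝ)) (IM.prod 𝓘(ℝ, ℝ)) r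
        (fun z : ℝ × ℝ => (Ψ.toMap (z.2, y₀), z.1)) :=
      ((Ψ.contMDiff_toMap.of_le hr).comp (contMDiff_snd.prodMk contMDiff_const)).prodMk
        contMDiff_fst
    exact (ξ.contMDiff_proj.of_le hr).comp ((GammaBundle.timeChange_mem_isotR hF).1.comp c1)
  refine ⟨g, mem_equivIsot.2 ⟨⟨smooth hF hL, smooth ((ξ.isot₀ r).inv_mem hF) hL', ?_⟩,
    fun t x => ?_⟩, fun t x y => hL _ x y, fun p => ?_⟩
  · ext x
    show L (timeChange 0, x) = x
    rw [timeChange_zero, hL0]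
  · refine congrFun (eq_of_circleCover_eq (a := fun s => L (s, x + 1)) (b := fun s => L (s, x) + 1)
      (by fun_prop) (by fun_prop) (fun s => ?_) ?_) (timeChange t)
    · rw [circleCover_add_one, ← hL s _ y₀, ← hL s _ (Ψ.holonomy y₀), Ψ.toMap_add_one]
    · show L (0, x + 1) = L (0, x) + 1
      rw [hL0, hL0]
  · rw [← Ψ.proj' p y₀, ξ.nu_eq hF, windingNumber_eq ⟨fun s => L (s, p), by fun_prop⟩
      fun s => (hL s p y₀).symm]
    show L (1, p) - L (0, p) = L (timeChange 1, p) - p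
    rw [hL0, timeChange_one]

/-- Every isotopy of bundle diffeomorphisms is, up to a change of time, the product of the lift of
an isotopy of the circle and an isotopy preserving each fiber. -/
theorem exists_decomposition [Nonempty N] {r : ℕ∞} {F : I → Equiv.Perm M} (hF : F ∈ ξ.isot₀ r) :
    ∃ g ∈ equivIsot r, ∃ V ∈ ξ.isotR r, (∀ t m, π (V t m) = π m) ∧ F 1 = Ψ.lift (g 1) * V 1 ∧
      ∀ p, nu π (circleCover p) F = g 1 p - p := by
  obtain ⟨g, hg, h1, h2⟩ := Ψ.exists_equivIsot hF
  have hg' := (mem_equivIsot.1 hg).2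
  refine ⟨g, hg, _, (ξ.isotR r).mul_mem ((ξ.isotR r).inv_mem (Ψ.lift_mem_isotR hg))
    (GammaBundle.timeChange_mem_isotR hF), fun t m => ?_, ?_, h2⟩
  · obtain ⟨x, y, rfl⟩ := Ψ.exists_eq m
    have h3 := Ψ.toMap_fib' (h1 t x y)
    show π ((Ψ.lift (g t))⁻¹ (F (timeChange t) (Ψ.toMap (x, y)))) = _
    rw [← h3, ← Ψ.lift_inv (hg' t), Ψ.lift_toMap (equivPerm.inv_mem (hg' t)), Ψ.proj', Ψ.proj']
    exact congrArg circleCover ((g t).symm_apply_apply x)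
  · show F 1 = Ψ.lift (g 1) * ((Ψ.lift (g 1))⁻¹ * F (timeChange 1))
    rw [mul_inv_cancel_left, timeChange_one]

/-- An isotopy preserving each fiber can be cut off by letting time depend on the base point. -/
theorem exists_vertical_cutoff (Ψ : DevelopingMap ξ) {r : ℕ∞} {V : ℝ → Equiv.Perm M}
    (hV : V ∈ ξ.isotR r)
    (hVπ : ∀ t m, π (V t m) = π m) {μ : Circle → ℝ} (hμ : ContMDiff (𝓡 1) 𝓘(ℝ, ℝ) ∞ μ) :
    ∃ W ∈ ξ.isotR r, ∀ t m, W t m = V (t * μ (π m)) m := by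
  have hVπ' : ∀ t m, π ((V t).symm m) = π m := fun t m => by
    rw [← hVπ t, Equiv.apply_symm_apply]
  let W : ℝ → Equiv.Perm M := fun t =>
    { toFun := fun m => V (t * μ (π m)) m
      invFun := fun m => (V (t * μ (π m))).symm m
      left_inv := fun m => by dsimp only; rw [hVπ, Equiv.symm_apply_apply]
      right_inv := fun m => by dsimp only; rw [hVπ', Equiv.apply_symm_apply] }
  have hr : (r : ℕ∞ω) ≤ ∞ := by exact_mod_cast le_top
  have c : ContMDiff (IM.prod 𝓘(ℝ, ℝ)) (IM.prod 𝓘(ℝ, ℝ)) r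
      (fun z : M × ℝ => (z.1, z.2 * μ (π z.1))) :=
    contMDiff_fst.prodMk (contMDiff_snd.mul
      (((hμ.comp ξ.contMDiff_proj).of_le hr).comp contMDiff_fst))
  refine ⟨W, Ψ.mem_isotR (hV.1.comp c) (hV.2.1.comp c) (fun t x => ?_) ?_, fun t m => rfl⟩
  · obtain ⟨g, hg⟩ := (hV.2.2.1 (t * μ (circleCover x))).2
    rcases isEmpty_or_nonempty N with hN | ⟨⟨y₀⟩⟩
    · exact ⟨x, 1, Γ.one_mem, fun y => hN.elim y⟩
    obtain ⟨γ, hγ, h⟩ := Ψ.exists_gamma hg (x := x) (x' := x) (by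
      rw [← Ψ.proj' x y₀, ← hg.1, hVπ])
    refine ⟨x, γ, hγ, fun y => ?_⟩
    rw [← h]
    show V (t * μ (π (Ψ.toMap (x, y)))) _ = _
    rw [Ψ.proj']
  · ext m
    show V (0 * μ (π m)) m = m
    rw [zero_mul, hV.2.2.2]
    rfl

end DevelopingMap

end Isotopies

/-! ### Products of commutators as products of two commutators -/

/-- If the conjugates of `H` by the positive powers of `φ` commute with `H`, then every product of
commutators of elements of `H` is a product of two commutators. For `h = c₁ ⋯ cₙ` the first
commutator is the product of the commuting elements `φ^(j-1) cⱼ φ^(1-j)`. -/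
theorem exists_eq_mul_commutators {G : Type*} [Group G] {H K : Subgroup G} (hHK : H ≤ K) {φ : G}
    (hφ : φ ∈ K) (hc : ∀ i : ℕ, ∀ h ∈ H, ∀ h' ∈ H, Commute h (φ ^ (i + 1) * h' * (φ ^ (i + 1))⁻¹))
    {h : G} (hh : h ∈ ⁅H, H⁆) :
    ∃ A ∈ K, ∃ B ∈ K, ∃ W ∈ K, h = ⁅A, B⁆ * ⁅φ⁻¹, W⁆ := by
  -- `L` consists of the elements of `K` whose conjugates by positive powers of `φ` commute with
  -- `H`; it contains `H` and is mapped into itself by conjugation with `φ`.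
  let L : Subgroup G := K ⊓ ⨅ i : ℕ, (Subgroup.centralizer (H : Set G)).comap
    (MulAut.conj (φ ^ (i + 1))).toMonoidHom
  have memL : ∀ x, x ∈ L ↔ x ∈ K ∧ ∀ i : ℕ, ∀ h ∈ H,
      h * (φ ^ (i + 1) * x * (φ ^ (i + 1))⁻¹) = φ ^ (i + 1) * x * (φ ^ (i + 1))⁻¹ * h := by
    intro x
    simp only [L, Subgroup.mem_inf, Subgroup.mem_iInf, Subgroup.mem_comap,
      Subgroup.mem_centralizer_iff, SetLike.mem_coe]
    rfl
  have HL : H ≤ L := fun x hx => (memL x).2 ⟨hHK hx, fun i h hh => hc i h hh x hx⟩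
  have conjL : ∀ x ∈ L, φ * x * φ⁻¹ ∈ L := fun x hx => by
    rw [memL] at hx ⊢
    refine ⟨K.mul_mem (K.mul_mem hφ hx.1) (K.inv_mem hφ), fun i h hh => ?_⟩
    have := hx.2 (i + 1) h hh
    rwa [show φ ^ (i + 1) * (φ * x * φ⁻¹) * (φ ^ (i + 1))⁻¹ =
      φ ^ (i + 1 + 1) * x * (φ ^ (i + 1 + 1))⁻¹ by rw [pow_succ φ (i + 1)]; group]
  have comm : ∀ h ∈ H, ∀ x ∈ L, Commute h (φ * x * φ⁻¹) := fun h hh x hx => by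
    have := ((memL x).1 hx).2 0 h hh
    rwa [zero_add, pow_one] at this
  have key : h ∈ H ∧ ∃ A ∈ L, ∃ B ∈ L, ∃ W ∈ L, h * W = ⁅A, B⁆ * (φ⁻¹ * W * φ) := by
    -- Conjugation with `φ` makes room for one more commutator `⁅a, b⁆` in front.
    have step : ∀ a ∈ H, ∀ b ∈ H, ∀ h : G,
        (h ∈ H ∧ ∃ A ∈ L, ∃ B ∈ L, ∃ W ∈ L, h * W = ⁅A, B⁆ * (φ⁻¹ * W * φ)) →
        (⁅a, b⁆ * h ∈ H ∧ ∃ A ∈ L, ∃ B ∈ L, ∃ W ∈ L,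
          ⁅a, b⁆ * h * W = ⁅A, B⁆ * (φ⁻¹ * W * φ)) := by
      rintro a ha b hb h ⟨hh, A, hA, B, hB, W, hW, e⟩
      have hab : ⁅a, b⁆ ∈ H := H.mul_mem (H.mul_mem (H.mul_mem ha hb) (H.inv_mem ha)) (H.inv_mem hb)
      have hAB : ⁅A, B⁆ ∈ L := L.mul_mem (L.mul_mem (L.mul_mem hA hB) (L.inv_mem hA)) (L.inv_mem hB)
      refine ⟨H.mul_mem hab hh, a * (φ * A * φ⁻¹), L.mul_mem (HL ha) (conjL A hA),
        b * (φ * B * φ⁻¹), L.mul_mem (HL hb) (conjL B hB), φ * (h * W) * φ⁻¹,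
        conjL _ (L.mul_mem (HL hh) hW), ?_⟩
      have e1 : ⁅a * (φ * A * φ⁻¹), b * (φ * B * φ⁻¹)⁆ = ⁅a, b⁆ * (φ * ⁅A, B⁆ * φ⁻¹) := by
        have c1 := (comm a ha B hB).eq
        have c2 := (comm b hb A hA).eq
        have c3 := (comm a ha A hA).eq
        have c4 := (comm b hb B hB).eq
        have d1 : Commute (φ * A * φ⁻¹) b := (comm b hb A hA).symm
        have d2 : Commute (φ * A * φ⁻¹ * (φ * B * φ⁻¹)) a⁻¹ :=
          (((comm a ha A hA).symm).mul_left (comm a ha B hB).symm).inv_right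
        have d3 : Commute (φ * A * φ⁻¹ * (φ * B * φ⁻¹) * (φ * A * φ⁻¹)⁻¹) b⁻¹ :=
          ((((comm b hb A hA).symm).mul_left (comm b hb B hB).symm).mul_left
            (comm b hb A hA).symm.inv_left).inv_right
        have e2 : (φ * A * φ⁻¹)⁻¹ * a⁻¹ = a⁻¹ * (φ * A * φ⁻¹)⁻¹ :=
          ((comm a ha A hA).symm.inv_left.inv_right).eq
        have e3 : (φ * B * φ⁻¹)⁻¹ * b⁻¹ = b⁻¹ * (φ * B * φ⁻¹)⁻¹ :=
          ((comm b hb B hB).symm.inv_left.inv_right).eq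
        have e4 : φ * ⁅A, B⁆ * φ⁻¹ = (φ * A * φ⁻¹) * (φ * B * φ⁻¹) * (φ * A * φ⁻¹)⁻¹ *
            (φ * B * φ⁻¹)⁻¹ := by
          rw [commutatorElement_def]; group
        rw [e4, commutatorElement_def, commutatorElement_def]
        generalize φ * A * φ⁻¹ = A' at *
        generalize φ * B * φ⁻¹ = B' at *
        calc a * A' * (b * B') * (a * A')⁻¹ * (b * B')⁻¹
            = a * (A' * b) * B' * (A'⁻¹ * a⁻¹) * (B'⁻¹ * b⁻¹) := by group
          _ = a * (b * A') * B' * (a⁻¹ * A'⁻¹) * (b⁻¹ * B'⁻¹) := by rw [d1.eq, e2, e3]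
          _ = a * b * (A' * B' * a⁻¹) * A'⁻¹ * b⁻¹ * B'⁻¹ := by group
          _ = a * b * (a⁻¹ * (A' * B')) * A'⁻¹ * b⁻¹ * B'⁻¹ := by rw [d2.eq]
          _ = a * b * a⁻¹ * (A' * B' * A'⁻¹ * b⁻¹) * B'⁻¹ := by group
          _ = a * b * a⁻¹ * (b⁻¹ * (A' * B' * A'⁻¹)) * B'⁻¹ := by rw [d3.eq]
          _ = a * b * a⁻¹ * b⁻¹ * (A' * B' * A'⁻¹ * B'⁻¹) := by group
      have c5 := (comm h hh _ hAB).eq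
      rw [e1]
      calc ⁅a, b⁆ * h * (φ * (h * W) * φ⁻¹) = ⁅a, b⁆ * (h * (φ * ⁅A, B⁆ * φ⁻¹)) * W := by
            rw [e]; group
        _ = ⁅a, b⁆ * (φ * ⁅A, B⁆ * φ⁻¹ * h) * W := by rw [c5]
        _ = ⁅a, b⁆ * (φ * ⁅A, B⁆ * φ⁻¹) * (φ⁻¹ * (φ * (h * W) * φ⁻¹) * φ) := by group
    rw [Subgroup.commutator_def] at hh
    induction hh using Subgroup.closure_induction_left with
    | one => exact ⟨H.one_mem, 1, L.one_mem, 1, L.one_mem, 1, L.one_mem, by simp⟩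
    | mul_left x hx y _ ih =>
      obtain ⟨a, ha, b, hb, rfl⟩ := hx
      exact step a ha b hb y ih
    | inv_mul_cancel x hx y _ ih =>
      obtain ⟨a, ha, b, hb, rfl⟩ := hx
      rw [commutatorElement_inv]
      exact step b hb a ha y ih
  obtain ⟨-, A, hA, B, hB, W, hW, e⟩ := key
  refine ⟨A, ((memL A).1 hA).1, B, ((memL B).1 hB).1, W, ((memL W).1 hW).1, ?_⟩
  rw [commutatorElement_def φ⁻¹, inv_inv, ← mul_assoc, eq_mul_inv_iff_mul_eq, e]

/-! ### Diffeomorphisms supported over an arc -/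

section Arc

variable {EN : Type*} [NormedAddCommGroup EN] [NormedSpace ℝ EN] {HN : Type*} [TopologicalSpace HN]
  {EM : Type*} [NormedAddCommGroup EM] [NormedSpace ℝ EM] {HM : Type*} [TopologicalSpace HM]
  {N : Type*} [TopologicalSpace N] [ChartedSpace HN N]
  {M : Type*} [TopologicalSpace M] [ChartedSpace HM M]
  {IN : ModelWithCorners ℝ EN HN} {IM : ModelWithCorners ℝ EM HM} {Γ : Subgroup (Equiv.Perm N)}
  {π : M → Circle}

theorem apply_mem_diffGroup {r : ℕ∞} {F : I → Equiv.Perm M} (hF : F ∈ isotGroup IM M r) (t : I) :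
    F t ∈ diffGroup IM M r := by
  have slice : ContMDiff IM (IM.prod (𝓡∂ 1)) r (fun m : M => (m, t)) :=
    contMDiff_id.prodMk contMDiff_const
  exact ⟨hF.1.comp slice, hF.2.comp slice⟩

/-- The bundle diffeomorphisms supported over the open arc `(α, β)`. -/
noncomputable def GammaBundle.arcDiff (ξ : GammaBundle (𝓡 1) IN IM Γ π) (r : ℕ∞) (α β : ℝ) :
    Subgroup (Equiv.Perm M) :=
  ξ.diffRel r (circleCover '' Set.Ioo α β)ᶜ

theorem GammaBundle.isotRel_mono (ξ : GammaBundle (𝓡 1) IN IM Γ π) (r : ℕ∞) {C C' : Set Circle}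
    (h : C ⊆ C') : ξ.isotRel r C' ≤ ξ.isotRel r C :=
  fun _ ⟨h1, U, hU, hC, h2⟩ => ⟨h1, U, hU, h.trans hC, h2⟩

theorem GammaBundle.diffRel_mono (ξ : GammaBundle (𝓡 1) IN IM Γ π) (r : ℕ∞) {C C' : Set Circle}
    (h : C ⊆ C') : ξ.diffRel r C' ≤ ξ.diffRel r C :=
  Subgroup.map_mono (ξ.isotRel_mono r h)

theorem GammaBundle.arcDiff_mono (ξ : GammaBundle (𝓡 1) IN IM Γ π) (r : ℕ∞) {α β α' β' : ℝ}
    (h1 : α' ≤ α) (h2 : β ≤ β') : ξ.arcDiff r α β ≤ ξ.arcDiff r α' β' :=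
  ξ.diffRel_mono r (Set.compl_subset_compl.2 (Set.image_mono (Set.Ioo_subset_Ioo h1 h2)))

theorem eq_of_circleCover_eq_of_abs_lt {x x' : ℝ} (h : circleCover x = circleCover x')
    (h' : |x - x'| < 1) : x = x' := by
  obtain ⟨n, hn⟩ := circleCover_eq_iff.1 h
  rw [hn, add_sub_cancel_left] at h'
  have : n = 0 := by
    rw [← Int.abs_lt_one_iff]
    exact_mod_cast h'
  rw [hn, this]
  simp

/-- The interval `(α, β)` as an open subset of the line. -/
def intervalOpens (α β : ℝ) : TopologicalSpace.Opens ℝ := ⟨Set.Ioo α β, isOpen_Ioo⟩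

theorem covers_productBundle {J : TopologicalSpace.Opens ℝ} {f : J × N → J × N}
    (h : ∀ x, ∃ x', ∃ γ ∈ Γ, ∀ y, f (x, y) = (x', γ y)) :
    ∃ g, (productBundle 𝓘(ℝ, ℝ) IN Γ :
      GammaBundle 𝓘(ℝ, ℝ) IN (𝓘(ℝ, ℝ).prod IN) Γ (Prod.fst : J × N → J)).Covers f g := by
  choose x' γ hγ hx using h
  refine ⟨x', fun z => by rw [hx z.1 z.2], fun e he e' he' q hq hq' => ?_⟩
  obtain ⟨γ₁, h1, h2⟩ := he.2 q hq
  obtain ⟨γ₂, h3, h4⟩ := he'.2 (x' q) hq'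
  refine ⟨γ₂ * γ q * γ₁⁻¹, Γ.mul_mem (Γ.mul_mem h3 (hγ _)) (Γ.inv_mem h1), fun y => ?_⟩
  have h5 := GammaBundle.symm_surj (e := e) (y := (q, γ₁⁻¹ y)) hq
  rw [h2, show γ₁ (γ₁⁻¹ y) = y from γ₁.apply_symm_apply y] at h5
  rw [h5, hx, h4]
  rfl

theorem gamma_of_covers_productBundle {J : TopologicalSpace.Opens ℝ} {f : J × N → J × N}
    {g : J → J} (h : (productBundle 𝓘(ℝ, ℝ) IN Γ :
      GammaBundle 𝓘(ℝ, ℝ) IN (𝓘(ℝ, ℝ).prod IN) Γ (Prod.fst : J × N → J)).Covers f g) (x : J) :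
    ∃ γ ∈ Γ, ∀ y, f (x, y) = (g x, γ y) := by
  let e₀ : Bundle.Trivialization N (Prod.fst : J × N → J) :=
    ⟨OpenPartialHomeomorph.refl (J × N), Set.univ, isOpen_univ, by simp, by simp, fun _ _ => rfl⟩
  have he₀ : e₀ ∈ (productBundle 𝓘(ℝ, ℝ) IN Γ :
      GammaBundle 𝓘(ℝ, ℝ) IN (𝓘(ℝ, ℝ).prod IN) Γ (Prod.fst : J × N → J)).atlas :=
    ⟨⟨contMDiffOn_id, contMDiffOn_id⟩, fun q _ => ⟨1, Γ.one_mem, fun _ => rfl⟩⟩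
  obtain ⟨γ, hγ, h1⟩ := h.2 e₀ he₀ e₀ he₀ x trivial trivial
  exact ⟨γ, hγ, fun y => Prod.ext (h.1 (x, y)) (h1 y)⟩

namespace DevelopingMap

variable {ξ : GammaBundle (𝓡 1) IN IM Γ π} (Ψ : DevelopingMap ξ)

/-- The trivialization of the bundle over an arc of length at most `1`. -/
noncomputable def arcEmbedding {α β : ℝ} (hβ : β ≤ α + 1) : intervalOpens α β × N ↪ M where
  toFun z := Ψ.toMap (z.1, z.2)
  inj' z w h := by
    have h1 : (z.1 : ℝ) = w.1 := by
      refine eq_of_circleCover_eq_of_abs_lt ?_ ?_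
      · rw [← Ψ.proj' z.1 z.2, ← Ψ.proj' w.1 w.2]
        exact congrArg π h
      · rw [abs_lt]
        have h2 := z.1.2.1
        have h3 := z.1.2.2
        have h4 := w.1.2.1
        have h5 := w.1.2.2
        constructor <;> linarith
    refine Prod.ext (Subtype.ext h1) ?_
    rw [← Ψ.fib_toMap' z.1 z.2, ← Ψ.fib_toMap' w.1 w.2, ← h1]
    dsimp only at h
    rw [h, h1]

theorem mem_range_arcEmbedding {α β : ℝ} (hβ : β ≤ α + 1) {m : M} :
    m ∈ Set.range (Ψ.arcEmbedding hβ) ↔ π m ∈ circleCover '' Set.Ioo α β := by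
  constructor
  · rintro ⟨z, rfl⟩
    exact ⟨z.1, z.1.2, (Ψ.proj' _ _).symm⟩
  · rintro ⟨x, hx, h⟩
    exact ⟨(⟨x, hx⟩, Ψ.fib (x, m)), Ψ.toMap_fib' h.symm⟩

theorem arcEmbedding_apply {α β : ℝ} (hβ : β ≤ α + 1) (z : intervalOpens α β × N) :
    Ψ.arcEmbedding hβ z = Ψ.toMap (z.1, z.2) := rfl

theorem exists_sub_int_mem_Ioo {α β x : ℝ} (h : circleCover x ∈ circleCover '' Set.Ioo α β) :
    ∃ n : ℤ, x - (n : ℝ) ∈ Set.Ioo α β := by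
  obtain ⟨x', hx', h⟩ := h
  obtain ⟨n, hn⟩ := circleCover_eq_iff.1 h.symm
  exact ⟨n, by rwa [hn, add_sub_cancel_right]⟩

theorem toMap_eq_arcEmbedding {α β : ℝ} (hβ : β ≤ α + 1) {x : ℝ} {n : ℤ}
    (hx : x - (n : ℝ) ∈ Set.Ioo α β) (y : N) : Ψ.toMap (x, y) =
      Ψ.arcEmbedding hβ ((⟨x - n, hx⟩ : intervalOpens α β), (Ψ.holonomy ^ n) y) := by
  have := Ψ.toMap_add_int (x - n) n y
  rwa [sub_add_cancel] at this

/-- The extension by the identity of a map with compact support over an open arc is smooth. -/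
theorem contMDiff_extension {r : ℕ∞} {α β : ℝ} (hβ : β ≤ α + 1) (hΓ : Γ ≤ diffGroup IN N ⊤)
    {F : I → intervalOpens α β × N → intervalOpens α β × N} {G : I → M → M}
    (hF : ContMDiff ((𝓘(ℝ, ℝ).prod IN).prod (𝓡∂ 1)) (𝓘(ℝ, ℝ).prod IN) r
      (fun z : (intervalOpens α β × N) × I => F z.2 z.1))
    (h1 : ∀ t z, G t (Ψ.arcEmbedding hβ z) = Ψ.arcEmbedding hβ (F t z))
    {U : Set Circle} (hU : IsOpen U) (hUs : (circleCover '' Set.Ioo α β)ᶜ ⊆ U)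
    (h2 : ∀ t m, π m ∈ U → G t m = m) :
    ContMDiff (IM.prod (𝓡∂ 1)) IM r (fun z : M × I => G z.2 z.1) := by
  have hr : (r : ℕ∞ω) ≤ ∞ := by exact_mod_cast le_top
  refine Ψ.contMDiff_of_comp fun z => ?_
  by_cases h : circleCover z.1.1 ∈ circleCover '' Set.Ioo α β
  · obtain ⟨n, hn⟩ := exists_sub_int_mem_Ioo h
    classical
    let E : ℝ → intervalOpens α β := fun x =>
      if hx : x - (n : ℝ) ∈ Set.Ioo α β then ⟨x - n, hx⟩ else ⟨z.1.1 - n, hn⟩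
    have hnear : ∀ᶠ x in nhds z.1.1, x - (n : ℝ) ∈ Set.Ioo α β :=
      (continuous_id.sub continuous_const).continuousAt.preimage_mem_nhds
        (isOpen_Ioo.mem_nhds hn)
    have cE : ContMDiffAt 𝓘(ℝ, ℝ) 𝓘(ℝ, ℝ) r E z.1.1 := by
      refine (ChartedSpace.liftPropWithinAt_subtypeVal_comp_iff E _ _).1 ?_
      have c1 : ContMDiffAt 𝓘(ℝ, ℝ) 𝓘(ℝ, ℝ) r (fun x : ℝ => x - n) z.1.1 :=
        (contMDiff_id.sub contMDiff_const).contMDiffAt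
      refine c1.congr_of_eventuallyEq ?_
      filter_upwards [hnear] with x hx
      simp only [Function.comp_apply, E]
      rw [dif_pos hx]
    have c2 : ContMDiffAt ((𝓘(ℝ, ℝ).prod IN).prod (𝓡∂ 1))
        ((𝓘(ℝ, ℝ).prod IN).prod (𝓡∂ 1)) r
        (fun w : (ℝ × N) × I => ((E w.1.1, (Ψ.holonomy ^ n) w.1.2), w.2)) z :=
      ((cE.comp z (contMDiffAt_fst.comp z contMDiffAt_fst)).prodMk
        ((((hΓ (Γ.zpow_mem Ψ.holonomy_mem n)).1.of_le hr).comp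
          (contMDiff_snd.comp contMDiff_fst)).contMDiffAt)).prodMk contMDiffAt_snd
    have c3 : ContMDiff (𝓘(ℝ, ℝ).prod IN) IM r (Ψ.arcEmbedding hβ) :=
      (Ψ.contMDiff_toMap.of_le hr).comp
        ((contMDiff_subtype_val.comp contMDiff_fst).prodMk contMDiff_snd)
    refine (ContMDiffAt.comp z (c3.comp hF).contMDiffAt c2).congr_of_eventuallyEq ?_
    filter_upwards [(continuousAt_fst.comp continuousAt_fst).eventually hnear] with w hw
    have hw' : w.1.1 - (n : ℝ) ∈ Set.Ioo α β := hw
    show G w.2 (Ψ.toMap (w.1.1, w.1.2)) = Ψ.arcEmbedding hβ (F w.2 (E w.1.1, _))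
    rw [Ψ.toMap_eq_arcEmbedding hβ hw', h1]
    simp only [E]
    rw [dif_pos hw']
  · have c4 : ContMDiffAt ((𝓘(ℝ, ℝ).prod IN).prod (𝓡∂ 1)) IM r
        (fun w : (ℝ × N) × I => Ψ.toMap w.1) z :=
      ((Ψ.contMDiff_toMap.of_le hr).comp contMDiff_fst).contMDiffAt
    refine c4.congr_of_eventuallyEq ?_
    have hn : {w : (ℝ × N) × I | circleCover w.1.1 ∈ U} ∈ nhds z :=
      (hU.preimage (continuous_circleCover.comp
        (continuous_fst.comp continuous_fst))).mem_nhds (hUs h)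
    filter_upwards [hn] with w hw
    exact h2 _ _ (by rw [Ψ.proj']; exact hw)

theorem viaEmbeddingHom_arcEmbedding {α β : ℝ} (hβ : β ≤ α + 1)
    (f : Equiv.Perm (intervalOpens α β × N)) (z : intervalOpens α β × N) :
    Equiv.Perm.viaEmbeddingHom (Ψ.arcEmbedding hβ) f (Ψ.arcEmbedding hβ z) =
      Ψ.arcEmbedding hβ (f z) :=
  Equiv.Perm.viaEmbedding_apply f _ z

theorem viaEmbeddingHom_of_notMem {α β : ℝ} (hβ : β ≤ α + 1)
    (f : Equiv.Perm (intervalOpens α β × N)) {m : M} (hm : π m ∉ circleCover '' Set.Ioo α β) :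
    Equiv.Perm.viaEmbeddingHom (Ψ.arcEmbedding hβ) f m = m :=
  Equiv.Perm.viaEmbedding_apply_of_notMem f _ m
    fun h => hm ((Ψ.mem_range_arcEmbedding hβ).1 h)

theorem exists_isOpen_viaEmbeddingHom {α β : ℝ} (hβ : β ≤ α + 1)
    {F : I → Equiv.Perm (intervalOpens α β × N)} {K : Set (intervalOpens α β)} (hK : IsCompact K)
    (hFK : GammaBundle.isotSupport F ⊆ Prod.fst ⁻¹' K) :
    ∃ U : Set Circle, IsOpen U ∧ (circleCover '' Set.Ioo α β)ᶜ ⊆ U ∧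
      ∀ t m, π m ∈ U → Equiv.Perm.viaEmbeddingHom (Ψ.arcEmbedding hβ) (F t) m = m := by
  refine ⟨(circleCover '' (Subtype.val '' K))ᶜ,
    (((hK.image continuous_subtype_val).image continuous_circleCover).isClosed).isOpen_compl,
    Set.compl_subset_compl.2 (Set.image_mono ?_), fun t m hm => ?_⟩
  · rintro _ ⟨x, -, rfl⟩
    exact x.2
  · by_cases h : π m ∈ circleCover '' Set.Ioo α β
    · obtain ⟨z, rfl⟩ := (Ψ.mem_range_arcEmbedding hβ).2 h
      rw [viaEmbeddingHom_arcEmbedding]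
      by_contra hne
      have h1 : z ∈ GammaBundle.isotSupport F := subset_closure
        (Set.mem_iUnion.2 ⟨t, fun he => hne (congrArg (Ψ.arcEmbedding hβ) he)⟩)
      exact hm ⟨z.1, ⟨z.1, hFK h1, rfl⟩, (Ψ.proj' _ _).symm⟩
    · exact Ψ.viaEmbeddingHom_of_notMem hβ _ h

/-- Extension by the identity of an isotopy with compact support over an open arc. -/
theorem viaEmbedding_mem_isotRel {r : ℕ∞} {α β : ℝ} (hβ : β ≤ α + 1)
    (hΓ : Γ ≤ diffGroup IN N ⊤)
    {F : I → Equiv.Perm (intervalOpens α β × N)}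
    (hF : F ∈ (productBundle 𝓘(ℝ, ℝ) IN Γ : GammaBundle 𝓘(ℝ, ℝ) IN (𝓘(ℝ, ℝ).prod IN) Γ
      (Prod.fst : intervalOpens α β × N → intervalOpens α β)).isotC r) :
    (fun t => Equiv.Perm.viaEmbeddingHom (Ψ.arcEmbedding hβ) (F t)) ∈
      ξ.isotRel r (circleCover '' Set.Ioo α β)ᶜ := by
  obtain ⟨⟨hF1, hF2, hF3⟩, K, hK, hFK⟩ := hF
  obtain ⟨U, hU, hUs, hUF⟩ := Ψ.exists_isOpen_viaEmbeddingHom hβ hK hFK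
  have s1 : ContMDiff (IM.prod (𝓡∂ 1)) IM r
      (fun z : M × I => Equiv.Perm.viaEmbeddingHom (Ψ.arcEmbedding hβ) (F z.2) z.1) :=
    Ψ.contMDiff_extension (F := fun t => F t)
      (G := fun t => Equiv.Perm.viaEmbeddingHom (Ψ.arcEmbedding hβ) (F t)) hβ hΓ hF1.1
      (fun t z => Ψ.viaEmbeddingHom_arcEmbedding hβ (F t) z) hU hUs hUF
  have s2 : ContMDiff (IM.prod (𝓡∂ 1)) IM r
      (fun z : M × I => (Equiv.Perm.viaEmbeddingHom (Ψ.arcEmbedding hβ) (F z.2)).symm z.1) := by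
    refine Ψ.contMDiff_extension (F := fun t => (F t).symm)
      (G := fun t => (Equiv.Perm.viaEmbeddingHom (Ψ.arcEmbedding hβ) (F t)).symm) hβ hΓ hF1.2
      (fun t z => ?_) hU hUs fun t m hm => ?_
    · rw [Equiv.symm_apply_eq, viaEmbeddingHom_arcEmbedding, Equiv.apply_symm_apply]
    · rw [Equiv.symm_apply_eq, hUF t m hm]
  have s3 : ∀ t, Equiv.Perm.viaEmbeddingHom (Ψ.arcEmbedding hβ) (F t) ∈ diffGroup IM M r :=
    apply_mem_diffGroup
      (F := fun t => Equiv.Perm.viaEmbeddingHom (Ψ.arcEmbedding hβ) (F t)) ⟨s1, s2⟩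
  have s4 : ∀ t, ∃ g, ξ.Covers (Equiv.Perm.viaEmbeddingHom (Ψ.arcEmbedding hβ) (F t)) g := by
    refine fun t => Ψ.exists_covers fun x => ?_
    by_cases h : circleCover x ∈ circleCover '' Set.Ioo α β
    · obtain ⟨g, hg⟩ := (hF2 t).2
      obtain ⟨n, hn⟩ := exists_sub_int_mem_Ioo h
      obtain ⟨γ, hγ, h1⟩ := gamma_of_covers_productBundle hg ⟨x - n, hn⟩
      refine ⟨g ⟨x - n, hn⟩, γ * Ψ.holonomy ^ n,
        Γ.mul_mem hγ (Γ.zpow_mem Ψ.holonomy_mem n), fun y => ?_⟩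
      rw [Ψ.toMap_eq_arcEmbedding hβ hn, viaEmbeddingHom_arcEmbedding, h1]
      rfl
    · exact ⟨x, 1, Γ.one_mem, fun y => Ψ.viaEmbeddingHom_of_notMem hβ _ (by rwa [Ψ.proj'])⟩
  have s5 : Equiv.Perm.viaEmbeddingHom (Ψ.arcEmbedding hβ) (F 0) = 1 := by rw [hF3, map_one]
  have s6 : (fun t => Equiv.Perm.viaEmbeddingHom (Ψ.arcEmbedding hβ) (F t)) ∈ ξ.isot₀ r :=
    ⟨⟨s1, s2⟩, fun t => ⟨s3 t, s4 t⟩, s5⟩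
  exact ⟨s6, U, hU, hUs, hUF⟩

end DevelopingMap

end Arc

section Arc

variable {EN : Type*} [NormedAddCommGroup EN] [NormedSpace ℝ EN] {HN : Type*} [TopologicalSpace HN]
  {EM : Type*} [NormedAddCommGroup EM] [NormedSpace ℝ EM] {HM : Type*} [TopologicalSpace HM]
  {N : Type*} [TopologicalSpace N] [ChartedSpace HN N]
  {M : Type*} [TopologicalSpace M] [ChartedSpace HM M]
  {IN : ModelWithCorners ℝ EN HN} {IM : ModelWithCorners ℝ EM HM} {Γ : Subgroup (Equiv.Perm N)}
  {π : M → Circle}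

namespace DevelopingMap

variable {ξ : GammaBundle (𝓡 1) IN IM Γ π} (Ψ : DevelopingMap ξ)

theorem circleLift_mem_Ioo {α β : ℝ} (hβ : β ≤ α + 1) {q : Circle}
    (hq : q ∈ circleCover '' Set.Ioo α β) :
    circleLift ((α + β) / 2) q ∈ Set.Ioo α β ∧
      |circleLift ((α + β) / 2) q - (α + β) / 2| < 1 / 2 := by
  obtain ⟨x, ⟨h1, h2⟩, rfl⟩ := hq
  have h3 : |x - (α + β) / 2| < 1 / 2 := by rw [abs_lt]; constructor <;> linarith
  rw [circleLift_circleCover h3]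
  exact ⟨⟨h1, h2⟩, h3⟩

/-- A smooth family of maps preserving the part of the bundle over an open arc is smooth in terms of
the trivialization over that arc. -/
theorem exists_restriction {r : ℕ∞} {α β : ℝ} (hβ : β ≤ α + 1) {G : I → M → M}
    (hG : ContMDiff (IM.prod (𝓡∂ 1)) IM r (fun z : M × I => G z.2 z.1))
    (hGS : ∀ t m, π m ∈ circleCover '' Set.Ioo α β → π (G t m) ∈ circleCover '' Set.Ioo α β) :
    ∃ F : I → intervalOpens α β × N → intervalOpens α β × N,
      ContMDiff ((𝓘(ℝ, ℝ).prod IN).prod (𝓡∂ 1)) (𝓘(ℝ, ℝ).prod IN) r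
        (fun z : (intervalOpens α β × N) × I => F z.2 z.1) ∧
      ∀ t z, Ψ.arcEmbedding hβ (F t z) = G t (Ψ.arcEmbedding hβ z) := by
  have hr : (r : ℕ∞ω) ≤ ∞ := by exact_mod_cast le_top
  have hS : ∀ t z, π (G t (Ψ.arcEmbedding hβ z)) ∈ circleCover '' Set.Ioo α β := fun t z =>
    hGS t _ ((Ψ.mem_range_arcEmbedding hβ).1 ⟨z, rfl⟩)
  refine ⟨fun t z => (⟨circleLift ((α + β) / 2) (π (G t (Ψ.arcEmbedding hβ z))),
    (circleLift_mem_Ioo hβ (hS t z)).1⟩, Ψ.fib (circleLift ((α + β) / 2)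
      (π (G t (Ψ.arcEmbedding hβ z))), G t (Ψ.arcEmbedding hβ z))), fun z => ?_, fun t z =>
    Ψ.toMap_fib' (circleCover_circleLift _ _).symm⟩
  have c3 : ContMDiff (𝓘(ℝ, ℝ).prod IN) IM r (Ψ.arcEmbedding hβ) :=
    (Ψ.contMDiff_toMap.of_le hr).comp
      ((contMDiff_subtype_val.comp contMDiff_fst).prodMk contMDiff_snd)
  have c4 : ContMDiff ((𝓘(ℝ, ℝ).prod IN).prod (𝓡∂ 1)) IM r
      (fun z : (intervalOpens α β × N) × I => G z.2 (Ψ.arcEmbedding hβ z.1)) :=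
    hG.comp ((c3.comp contMDiff_fst).prodMk contMDiff_snd)
  have c5 := ((Ψ.contMDiffAt_coord (circleCover_circleLift _ _).symm
    (circleLift_mem_Ioo hβ (hS z.2 z.1)).2).of_le hr).comp z c4.contMDiffAt
  refine ContMDiffAt.prodMk ?_ (contMDiffAt_snd.comp z c5)
  exact (ChartedSpace.liftPropWithinAt_subtypeVal_comp_iff _ _ _).1 (contMDiffAt_fst.comp z c5)

theorem isCompact_arc_inter {α β : ℝ} (hβ : β ≤ α + 1) {U : Set Circle} (hU : IsOpen U)
    (hUs : (circleCover '' Set.Ioo α β)ᶜ ⊆ U) :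
    IsCompact {x : intervalOpens α β | circleCover x ∉ U} := by
  rw [Topology.IsEmbedding.subtypeVal.isCompact_iff]
  have e : Subtype.val '' {x : intervalOpens α β | circleCover x ∉ U} =
      Set.Icc α β ∩ (circleCover ⁻¹' U)ᶜ := by
    ext x
    constructor
    · rintro ⟨x, hx, rfl⟩
      exact ⟨Set.Ioo_subset_Icc_self x.2, hx⟩
    · rintro ⟨hx, hxU⟩
      obtain ⟨x', hx', h⟩ := Set.notMem_compl_iff.1 fun h => hxU (hUs h)
      obtain rfl : x' = x := eq_of_circleCover_eq_of_abs_lt h (by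
        rw [abs_lt]
        constructor <;> linarith [hx.1, hx.2, hx'.1, hx'.2])
      exact ⟨⟨x', hx'⟩, hxU, rfl⟩
  rw [e]
  exact isCompact_Icc.inter_right (hU.preimage continuous_circleCover).isClosed_compl

/-- The isotopies supported over an open arc are extensions by the identity of isotopies of the
trivial bundle over that arc. -/
theorem exists_viaEmbeddingHom_eq [Nonempty N] {r : ℕ∞} {α β : ℝ} (hβ : β ≤ α + 1)
    {G : I → Equiv.Perm M} (hG : G ∈ ξ.isotRel r (circleCover '' Set.Ioo α β)ᶜ) :
    ∃ F ∈ (productBundle 𝓘(ℝ, ℝ) IN Γ : GammaBundle 𝓘(ℝ, ℝ) IN (𝓘(ℝ, ℝ).prod IN) Γ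
      (Prod.fst : intervalOpens α β × N → intervalOpens α β)).isotC r,
      ∀ t, Equiv.Perm.viaEmbeddingHom (Ψ.arcEmbedding hβ) (F t) = G t := by
  obtain ⟨⟨hG1, hG2, hG3⟩, U, hU, hUs, hGU⟩ := hG
  have hGU' : ∀ t m, π m ∈ U → (G t).symm m = m := fun t m hm => by
    rw [Equiv.symm_apply_eq, hGU t m hm]
  have hS : ∀ t m, π m ∈ circleCover '' Set.Ioo α β → π (G t m) ∈ circleCover '' Set.Ioo α β := by
    intro t m hm
    by_contra h
    have := (G t).injective (hGU t _ (hUs h))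
    rw [this] at h
    exact h hm
  have hS' : ∀ t m, π m ∈ circleCover '' Set.Ioo α β →
      π ((G t).symm m) ∈ circleCover '' Set.Ioo α β := by
    intro t m hm
    by_contra h
    have := (G t).symm.injective (hGU' t _ (hUs h))
    rw [this] at h
    exact h hm
  obtain ⟨F, hF, e⟩ := Ψ.exists_restriction (G := fun t => G t) hβ hG1.1 hS
  obtain ⟨F', hF', e'⟩ := Ψ.exists_restriction (G := fun t => (G t).symm) hβ hG1.2 hS'
  let P : I → Equiv.Perm (intervalOpens α β × N) := fun t =>
    { toFun := F t
      invFun := F' t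
      left_inv := fun z => (Ψ.arcEmbedding hβ).injective (by
        rw [e', e, Equiv.symm_apply_apply])
      right_inv := fun z => (Ψ.arcEmbedding hβ).injective (by
        rw [e, e', Equiv.apply_symm_apply]) }
  have hP : P ∈ isotGroup (𝓘(ℝ, ℝ).prod IN) (intervalOpens α β × N) r := ⟨hF, hF'⟩
  have hPc : ∀ t, ∃ g, (productBundle 𝓘(ℝ, ℝ) IN Γ : GammaBundle 𝓘(ℝ, ℝ) IN (𝓘(ℝ, ℝ).prod IN) Γ
      (Prod.fst : intervalOpens α β × N → intervalOpens α β)).Covers (P t) g := by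
    refine fun t => covers_productBundle fun x => ?_
    obtain ⟨g, hg⟩ := (hG2 t).2
    obtain ⟨x', hx', h⟩ := hS t (Ψ.toMap (x, Classical.arbitrary N))
      ⟨x, x.2, (Ψ.proj' _ _).symm⟩
    rw [hg.1, Ψ.proj'] at h
    obtain ⟨γ, hγ, h1⟩ := Ψ.exists_gamma hg h
    exact ⟨⟨x', hx'⟩, γ, hγ, fun y => (Ψ.arcEmbedding hβ).injective ((e t (x, y)).trans (h1 y))⟩
  have hP0 : P 0 = 1 := Equiv.ext fun z => (Ψ.arcEmbedding hβ).injective (by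
    refine (e 0 z).trans ?_
    rw [hG3]
    rfl)
  have hP1 : P ∈ (productBundle 𝓘(ℝ, ℝ) IN Γ : GammaBundle 𝓘(ℝ, ℝ) IN (𝓘(ℝ, ℝ).prod IN) Γ
      (Prod.fst : intervalOpens α β × N → intervalOpens α β)).isot₀ r :=
    ⟨hP, fun t => ⟨apply_mem_diffGroup hP t, hPc t⟩, hP0⟩
  refine ⟨P, ⟨hP1, _, isCompact_arc_inter hβ hU hUs, ?_⟩, fun t => ?_⟩
  · refine closure_minimal (Set.iUnion_subset fun t z hz => ?_)
      ((isCompact_arc_inter hβ hU hUs).isClosed.preimage continuous_fst)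
    intro hzU
    refine hz ((Ψ.arcEmbedding hβ).injective ((e t z).trans (hGU t _ ?_)))
    rw [arcEmbedding_apply, Ψ.proj']
    exact hzU
  · ext m
    by_cases h : π m ∈ circleCover '' Set.Ioo α β
    · obtain ⟨z, rfl⟩ := (Ψ.mem_range_arcEmbedding hβ).2 h
      rw [viaEmbeddingHom_arcEmbedding]
      exact e t z
    · rw [Ψ.viaEmbeddingHom_of_notMem hβ _ h, hGU t m (hUs h)]

end DevelopingMap

/-- Under assumption `(∗)`, the group of diffeomorphisms supported over an open arc is perfect. -/
theorem GammaBundle.commutator_arcDiff (ξ : GammaBundle (𝓡 1) IN IM Γ π) [Nonempty N]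
    (hΓ : Γ ≤ diffGroup IN N ⊤) {r : ℕ∞} (hstar : AssumptionStar IN Γ r) {α β : ℝ} (hαβ : α < β)
    (hβ : β ≤ α + 1) :
    ⁅ξ.arcDiff r α β, ξ.arcDiff r α β⁆ = ξ.arcDiff r α β := by
  obtain ⟨Ψ⟩ := exists_developingMap hΓ ξ
  have e : ξ.arcDiff r α β = ((productBundle 𝓘(ℝ, ℝ) IN Γ :
      GammaBundle 𝓘(ℝ, ℝ) IN (𝓘(ℝ, ℝ).prod IN) Γ
      (Prod.fst : intervalOpens α β × N → intervalOpens α β)).diffC r).map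
        (Equiv.Perm.viaEmbeddingHom (Ψ.arcEmbedding hβ)) := by
    ext h
    constructor
    · rintro ⟨G, hG, rfl⟩
      obtain ⟨F, hF, e⟩ := Ψ.exists_viaEmbeddingHom_eq hβ hG
      exact ⟨F 1, ⟨F, hF, rfl⟩, e 1⟩
    · rintro ⟨_, ⟨F, hF, rfl⟩, rfl⟩
      exact ⟨_, Ψ.viaEmbedding_mem_isotRel hβ hΓ hF, rfl⟩
  have h := hstar (intervalOpens α β) (Set.nonempty_Ioo.2 hαβ) Set.ordConnected_Ioo
  rw [e, ← Subgroup.map_commutator, Subgroup.isPerfect_iff.1 h]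

end Arc

/-! ### Isotopies of the circle supported in arcs -/

/-- The isotopy `g` of the line, thought of as an isotopy of the circle, is supported in the arc
`(α, β)`. -/
def SupportedInArc (g : ℝ → Equiv.Perm ℝ) (α β : ℝ) : Prop :=
  ∀ t x, circleCover x ∉ circleCover '' Set.Ioo α β → g t x = x

theorem supportedInArc_of_Ico {r : ℕ∞} {g : ℝ → Equiv.Perm ℝ} (hg : g ∈ equivIsot r)
    {x₀ α β : ℝ} (h : ∀ t, ∀ x ∈ Set.Ico x₀ (x₀ + 1), x ∉ Set.Ioo α β → g t x = x) :
    SupportedInArc g α β := by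
  intro t x hx
  have h1 := Int.floor_le (x - x₀)
  have h2 := Int.lt_floor_add_one (x - x₀)
  have h3 := h t (x - ⌊x - x₀⌋) ⟨by linarith, by linarith⟩ fun h4 =>
    hx ⟨_, h4, circleCover_eq_iff.2 ⟨-⌊x - x₀⌋, by push_cast; ring⟩⟩
  have h4 := equivPerm_add_int ((mem_equivIsot.1 hg).2 t) (x - ⌊x - x₀⌋) ⌊x - x₀⌋
  rwa [h3, sub_add_cancel] at h4

theorem circleCover_notMem_image_Ioo {x α β : ℝ} (h1 : x ≤ α) (h2 : β ≤ x + 1) :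
    circleCover x ∉ circleCover '' Set.Ioo α β := by
  rintro ⟨y, ⟨h3, h4⟩, h⟩
  have := eq_of_circleCover_eq_of_abs_lt h (by rw [abs_lt]; constructor <;> linarith)
  linarith

theorem translation_mem_equivIsot {r : ℕ∞} {θ : ℝ → ℝ} (hθ : ContDiff ℝ r θ) (h0 : θ 0 = 0) :
    (fun t => Equiv.addRight (θ t)) ∈ equivIsot r := by
  refine mem_equivIsot.2 ⟨⟨contDiff_snd.add (hθ.comp contDiff_fst), ?_, ?_⟩, fun t x => ?_⟩
  · simp only [Equiv.addRight_symm, Equiv.coe_addRight]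
    exact contDiff_snd.add (hθ.comp contDiff_fst).neg
  · ext x
    simp [h0]
  · show x + 1 + θ t = x + θ t + 1
    ring

theorem exists_translation_supportedInArc (r : ℕ∞) {a b c d : ℝ} (hab : a < b) (hac : a < c)
    (hbd : b < d) (hcd : c < d) (hda : d ≤ a + 1) : ∃ g ∈ equivIsot r, ∃ η > 0,
      (∀ t x, |x - b| < η → g t x = x + Real.smoothTransition t * (c - b)) ∧
      SupportedInArc g a d := by
  obtain ⟨g, hg, η, hη, h1, h2⟩ := exists_arc_translation r hab hac hbd hcd hda
  refine ⟨g, hg, η, hη, h1, supportedInArc_of_Ico hg (x₀ := a) fun t x hx hxd => h2 t x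
    ⟨hx.1, hx.2.le⟩ fun h => hxd ⟨by linarith [h.1], by linarith [h.2]⟩⟩

theorem exists_cutoff_supportedInArc {r : ℕ∞} {u : ℝ → Equiv.Perm ℝ} (hu : u ∈ equivIsot r) {p : ℝ}
    (hup : ∀ t, u t p = p) {ε : ℝ} (hε : 0 < ε) (hε' : ε < 1 / 2) :
    ∃ v ∈ equivIsot r, ∃ δ > 0,
      (∀ t x, |x - p| < δ → v t x = u (Real.smoothTransition t) x) ∧
      SupportedInArc v (p - ε) (p + ε) := by
  obtain ⟨v, hv, δ, hδ, h1, h2⟩ := exists_arc_cutoff hu hup hε hε'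
  refine ⟨v, hv, δ, hδ, h1, supportedInArc_of_Ico hv (x₀ := p - 1 / 2) fun t x hx hxd =>
    h2 t x ?_ ?_⟩
  · by_contra! h
    rw [abs_lt] at h
    exact hxd ⟨by linarith, by linarith⟩
  · rw [abs_le]
    constructor <;> linarith [hx.1, hx.2]

/-- If `|s| < 1`, there are isotopies `c`, `b` of the circle supported in a common arc such that `c`
translates a neighborhood of `z` by `s` and `b` moves to `z` a point `w` at which `c` is the
identity. -/
theorem exists_arc_pair (r : ℕ∞) (z : ℝ) {s : ℝ} (hs : |s| < 1) :
    ∃ a α δ d w ε : ℝ, d < a + 1 ∧ a < α ∧ δ < d ∧ 0 < ε ∧ α ≤ z - ε ∧ z + ε ≤ δ ∧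
      w + ε ≤ α ∧ δ ≤ w - ε + 1 ∧
      ∃ c ∈ equivIsot r, ∃ b ∈ equivIsot r,
        (∀ t x, |x - z| < ε → c t x = x + Real.smoothTransition t * s) ∧
        (∀ x, |x - w| < ε → b 1 x = x + (z - w)) ∧
        SupportedInArc c α δ ∧ ∃ α' δ', a < α' ∧ δ' < d ∧ SupportedInArc b α' δ' := by
  obtain ⟨lo, hi, h1, h2, h3, h4, h5⟩ : ∃ lo hi, lo ≤ z ∧ z ≤ hi ∧ lo ≤ z + s ∧ z + s ≤ hi ∧
      hi - lo < 1 := by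
    rw [abs_lt] at hs
    rcases le_total 0 s with h | h
    · exact ⟨z, z + s, le_rfl, by linarith, by linarith, le_rfl, by linarith⟩
    · exact ⟨z + s, z, by linarith, le_rfl, le_rfl, by linarith, by linarith⟩
  set κ := 1 - (hi - lo) with hκ
  have hκ0 : 0 < κ := by linarith
  obtain ⟨c, hc, η, hη, c1, c2⟩ := exists_translation_supportedInArc r
    (a := lo - κ / 4) (b := z) (c := z + s) (d := hi + κ / 4) (by linarith) (by linarith)
    (by linarith) (by linarith) (by linarith)
  obtain ⟨b, hb, η', hη', b1, b2⟩ := exists_translation_supportedInArc r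
    (a := lo - κ / 2) (b := lo - 3 * κ / 8) (c := z) (d := hi + κ / 4) (by linarith) (by linarith)
    (by linarith) (by linarith) (by linarith)
  have e1 : min (κ / 8) (min η η') ≤ κ / 8 := min_le_left _ _
  have e2 : min (κ / 8) (min η η') ≤ η := (min_le_right _ _).trans (min_le_left _ _)
  have e3 : min (κ / 8) (min η η') ≤ η' := (min_le_right _ _).trans (min_le_right _ _)
  have e4 : 0 < min (κ / 8) (min η η') := lt_min (by linarith) (lt_min hη hη')
  refine ⟨lo - 9 * κ / 16, lo - κ / 4, hi + κ / 4, hi + 5 * κ / 16, lo - 3 * κ / 8,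
    min (κ / 8) (min η η'), by linarith, by linarith, by linarith, e4, by linarith, by linarith,
    by linarith, by linarith, c, hc, b, hb, fun t x hx => ?_, fun x hx => ?_, c2,
    lo - κ / 2, hi + κ / 4, by linarith, by linarith, b2⟩
  · rw [c1 t x (hx.trans_le e2), add_sub_cancel_left]
  · rw [b1 1 x (hx.trans_le e3), Real.smoothTransition.one, one_mul]

/-! ### Products of commutators supported over arcs -/

section Products

variable {EN : Type*} [NormedAddCommGroup EN] [NormedSpace ℝ EN] {HN : Type*} [TopologicalSpace HN]
  {EM : Type*} [NormedAddCommGroup EM] [NormedSpace ℝ EM] {HM : Type*} [TopologicalSpace HM]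
  {N : Type*} [TopologicalSpace N] [ChartedSpace HN N]
  {M : Type*} [TopologicalSpace M] [ChartedSpace HM M]
  {IN : ModelWithCorners ℝ EN HN} {IM : ModelWithCorners ℝ EM HM} {Γ : Subgroup (Equiv.Perm N)}
  {π : M → Circle}

namespace GammaBundle

variable {ξ : GammaBundle (𝓡 1) IN IM Γ π}

/-- `f` is a product of `n` commutators, each of two diffeomorphisms supported over a common arc. -/
def IsBallProduct (ξ : GammaBundle (𝓡 1) IN IM Γ π) (r : ℕ∞) (n : ℕ) (f : Equiv.Perm M) : Prop :=
  ∃ l : List (ξ.diff₀ r), l.length = n ∧ (∀ x ∈ l, x ∈ ξ.ballCommutators r) ∧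
    (l.prod : Equiv.Perm M) = f

theorem IsBallProduct.mul {r : ℕ∞} {n n' : ℕ} {f f' : Equiv.Perm M}
    (h : ξ.IsBallProduct r n f) (h' : ξ.IsBallProduct r n' f') :
    ξ.IsBallProduct r (n + n') (f * f') := by
  obtain ⟨l, h1, h2, h3⟩ := h
  obtain ⟨l', h1', h2', h3'⟩ := h'
  refine ⟨l ++ l', by rw [List.length_append, h1, h1'], fun x hx => ?_, ?_⟩
  · rcases List.mem_append.1 hx with h | h
    · exact h2 x h
    · exact h2' x h
  · rw [List.prod_append, Subgroup.coe_mul, h3, h3']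

theorem diffRel_le_diff₀ (ξ : GammaBundle (𝓡 1) IN IM Γ π) (r : ℕ∞) (C : Set Circle) :
    ξ.diffRel r C ≤ ξ.diff₀ r :=
  Subgroup.map_mono fun _ h => h.1

theorem isBallProduct_commutator {r : ℕ∞} {a d : ℝ} (had : a < d) (hda : d < a + 1)
    {A B : Equiv.Perm M} (hA : A ∈ ξ.arcDiff r a d) (hB : B ∈ ξ.arcDiff r a d) :
    ξ.IsBallProduct r 1 ⁅A, B⁆ := by
  have hsub : circleCover '' Set.Ioo a d ⊆ interior (circleCover '' Set.Icc a d) :=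
    interior_maximal (Set.image_mono Set.Ioo_subset_Icc_self) (isOpenMap_circleCover _ isOpen_Ioo)
  have h1 := ξ.diffRel_mono r (Set.compl_subset_compl.2 hsub)
  refine ⟨[⟨⁅A, B⁆, ?_⟩], rfl, fun x hx => ?_, by simp⟩
  · have hA' := ξ.diffRel_le_diff₀ r _ hA
    have hB' := ξ.diffRel_le_diff₀ r _ hB
    exact (ξ.diff₀ r).mul_mem ((ξ.diff₀ r).mul_mem ((ξ.diff₀ r).mul_mem hA' hB')
      ((ξ.diff₀ r).inv_mem hA')) ((ξ.diff₀ r).inv_mem hB')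
  · rw [List.mem_singleton.1 hx]
    exact ⟨_, ⟨a, d, had, hda, rfl⟩, A, h1 hA, B, h1 hB, rfl⟩

theorem conj_mem_isot₀ {r : ℕ∞} {F : I → Equiv.Perm M} (hF : F ∈ ξ.isot₀ r) {b : Equiv.Perm M}
    (hb : b ∈ ξ.bundleDiff r) : (fun t => b * F t * b⁻¹) ∈ ξ.isot₀ r := by
  have c : ContMDiff (IM.prod (𝓡∂ 1)) (IM.prod (𝓡∂ 1)) r
      (fun z : M × I => (b.symm z.1, z.2)) :=
    (hb.1.2.comp contMDiff_fst).prodMk contMDiff_snd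
  refine ⟨⟨hb.1.1.comp (hF.1.1.comp c), hb.1.1.comp (hF.1.2.comp c)⟩, fun t =>
    Subgroup.mul_mem _ (Subgroup.mul_mem _ hb (hF.2.1 t)) (Subgroup.inv_mem _ hb), ?_⟩
  simp only [hF.2.2, mul_one, mul_inv_cancel]

theorem diff₀_le_bundleDiff (ξ : GammaBundle (𝓡 1) IN IM Γ π) (r : ℕ∞) :
    ξ.diff₀ r ≤ ξ.bundleDiff r := by
  rintro _ ⟨F, hF, rfl⟩
  exact hF.2.1 1

/-- An isotopy which is the identity outside the preimage of the arc `(α, β)` is supported over the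
open arcs containing `[α, β]`. -/
theorem restrict_mem_isotRel {r : ℕ∞} {F : ℝ → Equiv.Perm M} (hF : F ∈ ξ.isotR r)
    {a α β d : ℝ} (ha : a < α) (hd : β < d)
    (h : ∀ t m, π m ∉ circleCover '' Set.Ioo α β → F t m = m) :
    (fun t : I => F t) ∈ ξ.isotRel r (circleCover '' Set.Ioo a d)ᶜ := by
  refine ⟨restrict_mem_isot₀ hF, (circleCover '' Set.Icc α β)ᶜ,
    ((isCompact_Icc.image continuous_circleCover).isClosed).isOpen_compl,
    Set.compl_subset_compl.2 (Set.image_mono (Set.Icc_subset_Ioo ha hd)), fun t m hm =>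
      h t m fun hm' => hm (Set.image_mono Set.Ioo_subset_Icc_self hm')⟩

end GammaBundle

namespace DevelopingMap

variable {ξ : GammaBundle (𝓡 1) IN IM Γ π} (Ψ : DevelopingMap ξ)

theorem lift_eq_self {r : ℕ∞} {g : ℝ → Equiv.Perm ℝ} (hg : g ∈ equivIsot r) {α β : ℝ}
    (h : SupportedInArc g α β) (t : ℝ) {m : M} (hm : π m ∉ circleCover '' Set.Ioo α β) :
    Ψ.lift (g t) m = m := by
  obtain ⟨x, y, rfl⟩ := Ψ.exists_eq m
  rw [Ψ.proj'] at hm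
  rw [Ψ.lift_toMap ((mem_equivIsot.1 hg).2 t), h t x hm]

theorem lift_mem_arcDiff {r : ℕ∞} {g : ℝ → Equiv.Perm ℝ} (hg : g ∈ equivIsot r) {a α β d : ℝ}
    (ha : a < α) (hd : β < d) (h : SupportedInArc g α β) : Ψ.lift (g 1) ∈ ξ.arcDiff r a d :=
  ⟨_, GammaBundle.restrict_mem_isotRel (Ψ.lift_mem_isotR hg) ha hd fun t _ hm =>
    Ψ.lift_eq_self hg h t hm, rfl⟩

end DevelopingMap

/-- Diffeomorphisms supported away from a fiber are products of two commutators. -/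
theorem GammaBundle.isBallProduct_two (ξ : GammaBundle (𝓡 1) IN IM Γ π) [Nonempty N]
    (hΓ : Γ ≤ diffGroup IN N ⊤) {r : ℕ∞} (hstar : AssumptionStar IN Γ r) {z : ℝ}
    {h : Equiv.Perm M} (hh : h ∈ ξ.diffRel r {circleCover z}) : ξ.IsBallProduct r 2 h := by
  obtain ⟨Ψ⟩ := exists_developingMap hΓ ξ
  obtain ⟨F, ⟨hF, U, hU, hzU, hFU⟩, rfl⟩ := hh
  obtain ⟨δ, hδ, hδU⟩ := Metric.isOpen_iff.1 (hU.preimage continuous_circleCover) z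
    (hzU rfl)
  obtain ⟨e, he, heδ, he4⟩ : ∃ e > 0, e < δ ∧ e < 1 / 4 := by
    obtain ⟨e, h1, h2⟩ := exists_between (show 0 < min δ (1 / 4) from lt_min hδ (by norm_num))
    exact ⟨e, h1, h2.trans_le (min_le_left _ _), h2.trans_le (min_le_right _ _)⟩
  -- As `h` is the identity near the fiber over `z`, it is supported over an arc with endpoints near
  -- `z`.
  set h := Pi.evalMonoidHom (fun _ : I => Equiv.Perm M) 1 F with hh
  have hH : h ∈ ξ.arcDiff r (z + e) (z + 1 - e) := by
    refine ⟨F, ⟨hF, U, hU, fun q hq => ?_, hFU⟩, rfl⟩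
    obtain ⟨x, hx1, hx2, rfl⟩ : ∃ x, z ≤ x ∧ x < z + 1 ∧ circleCover x = q := by
      have h1 := Int.floor_le (circleLift 0 q - z)
      have h2 := Int.lt_floor_add_one (circleLift 0 q - z)
      refine ⟨circleLift 0 q - ⌊circleLift 0 q - z⌋, by linarith, by linarith, ?_⟩
      refine Eq.trans ?_ (circleCover_circleLift 0 q)
      exact circleCover_eq_iff.2 ⟨-⌊circleLift 0 q - z⌋, by push_cast; ring⟩
    by_cases h1 : x ≤ z + e
    · exact hδU (by rw [Metric.mem_ball, Real.dist_eq, abs_lt]; constructor <;> linarith)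
    · have h2 : z + 1 - e ≤ x := by
        by_contra! h3
        exact hq ⟨x, ⟨by linarith, h3⟩, rfl⟩
      have h3 : x - 1 ∈ circleCover ⁻¹' U :=
        hδU (by rw [Metric.mem_ball, Real.dist_eq, abs_lt]; constructor <;> linarith)
      rwa [Set.mem_preimage, ← circleCover_add_one, sub_add_cancel] at h3
  -- `g 1` maps `[z + e, z + 1 - 3e/4)` into `[z + 1 - 7e/8, z + 1 - 3e/4)`, to the right of the
  -- support of `h`, and so do its powers.
  obtain ⟨g, hg, η, hη, g1, g2⟩ := exists_translation_supportedInArc r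
    (a := z + 3 * e / 4) (b := z + e) (c := z + 1 - 7 * e / 8) (d := z + 1 - 3 * e / 4)
    (by linarith) (by linarith) (by linarith) (by linarith) (by linarith)
  have gper := (mem_equivIsot.1 hg).2 1
  have gmono := strictMono_of_mem_equivIsot hg 1
  have g3 : g 1 (z + e) = z + 1 - 7 * e / 8 := by
    rw [g1 1 _ (by simpa using hη), Real.smoothTransition.one]
    ring
  have g4 : g 1 (z + 1 - 3 * e / 4) = z + 1 - 3 * e / 4 :=
    g2 1 _ fun ⟨y, ⟨h1, h2⟩, h⟩ => by
      have := eq_of_circleCover_eq_of_abs_lt h (by rw [abs_lt]; constructor <;> linarith)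
      linarith
  set φ := Ψ.lift (g 1) with hφ
  have φpow : ∀ i : ℕ, ∀ x y, z + e ≤ x → x < z + 1 - 3 * e / 4 → ∃ x', z + 1 - 7 * e / 8 ≤ x' ∧
      x' < z + 1 - 3 * e / 4 ∧ (φ ^ (i + 1)) (Ψ.toMap (x, y)) = Ψ.toMap (x', y) := by
    intro i
    induction i with
    | zero =>
      intro x y h1 h2
      refine ⟨g 1 x, ?_, ?_, ?_⟩
      · rw [← g3]
        exact gmono.monotone h1
      · rw [← g4]
        exact gmono h2
      · rw [zero_add, pow_one, Ψ.lift_toMap gper]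
    | succ i ih =>
      intro x y h1 h2
      obtain ⟨x', h3, h4, h5⟩ := ih x y h1 h2
      refine ⟨g 1 x', ?_, ?_, ?_⟩
      · rw [← g3]
        exact gmono.monotone (by linarith)
      · rw [← g4]
        exact gmono h4
      · rw [pow_succ', Equiv.Perm.mul_apply, h5, Ψ.lift_toMap gper]
  have supp : ∀ k ∈ ξ.arcDiff r (z + e) (z + 1 - e), ∀ m,
      π m ∉ circleCover '' Set.Ioo (z + e) (z + 1 - e) → k m = m := by
    rintro _ ⟨G, ⟨-, V, -, hV, hGV⟩, rfl⟩ m hm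
    exact hGV 1 m (hV hm)
  have hcomm : ∀ i : ℕ, ∀ k ∈ ξ.arcDiff r (z + e) (z + 1 - e),
      ∀ k' ∈ ξ.arcDiff r (z + e) (z + 1 - e),
      Commute k (φ ^ (i + 1) * k' * (φ ^ (i + 1))⁻¹) := by
    intro i k hk k' hk'
    have cancel : ∀ (f : Equiv.Perm M) m, f (f⁻¹ m) = m := fun f m => f.apply_symm_apply m
    refine Equiv.Perm.Disjoint.commute fun m => ?_
    by_cases hm : π ((φ ^ (i + 1))⁻¹ m) ∈ circleCover '' Set.Ioo (z + e) (z + 1 - e)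
    · left
      refine supp k hk m ?_
      obtain ⟨x, ⟨h1, h2⟩, h3⟩ := hm
      have h4 := Ψ.toMap_fib' h3.symm
      obtain ⟨x', h5, h6, h7⟩ := φpow i x (Ψ.fib (x, (φ ^ (i + 1))⁻¹ m)) h1.le (by linarith)
      rw [h4, cancel] at h7
      rw [h7, Ψ.proj']
      rintro ⟨y, ⟨h8, h9⟩, h10⟩
      have := eq_of_circleCover_eq_of_abs_lt h10 (by rw [abs_lt]; constructor <;> linarith)
      linarith
    · right
      rw [Equiv.Perm.mul_apply, Equiv.Perm.mul_apply, supp k' hk' _ hm, cancel]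
  have hφK : φ ∈ ξ.arcDiff r (z + e / 2) (z + 1 - e / 2) :=
    Ψ.lift_mem_arcDiff hg (by linarith) (by linarith) g2
  have hHK := ξ.arcDiff_mono r (α := z + e) (β := z + 1 - e) (α' := z + e / 2)
    (β' := z + 1 - e / 2) (by linarith) (by linarith)
  rw [← ξ.commutator_arcDiff hΓ hstar (by linarith) (by linarith)] at hH
  obtain ⟨A, hA, B, hB, W, hW, e⟩ := exists_eq_mul_commutators hHK hφK hcomm hH
  rw [e]
  exact (isBallProduct_commutator (by linarith) (by linarith) hA hB).mul
    (isBallProduct_commutator (by linarith) (by linarith) (Subgroup.inv_mem _ hφK) hW)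

end Products

/-! ### Fragmentation -/

section Fragmentation

variable {EN : Type*} [NormedAddCommGroup EN] [NormedSpace ℝ EN] {HN : Type*} [TopologicalSpace HN]
  {EM : Type*} [NormedAddCommGroup EM] [NormedSpace ℝ EM] {HM : Type*} [TopologicalSpace HM]
  {N : Type*} [TopologicalSpace N] [ChartedSpace HN N]
  {M : Type*} [TopologicalSpace M] [ChartedSpace HM M]
  {IN : ModelWithCorners ℝ EN HN} {IM : ModelWithCorners ℝ EM HM} {Γ : Subgroup (Equiv.Perm N)}
  {π : M → Circle}

namespace DevelopingMap

variable {ξ : GammaBundle (𝓡 1) IN IM Γ π} (Ψ : DevelopingMap ξ)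

/-- An isotopy preserving each fiber agrees near a given fiber with one supported near that
fiber. -/
theorem exists_vertical_cutoff_supported {r : ℕ∞} {V : ℝ → Equiv.Perm M} (hV : V ∈ ξ.isotR r)
    (hVπ : ∀ t m, π (V t m) = π m) (z : ℝ) {ε : ℝ} (hε : 0 < ε) :
    ∃ W ∈ ξ.isotR r, (∀ t m, π m ∉ circleCover '' Set.Ioo (z - ε) (z + ε) → W t m = m) ∧
      ∀ᶠ x in nhds z, ∀ t y, W t (Ψ.toMap (x, y)) = V t (Ψ.toMap (x, y)) := by
  have ho : IsOpen (circleCover '' Set.Ioo (z - ε) (z + ε)) := isOpenMap_circleCover _ isOpen_Ioo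
  obtain ⟨μ, h1, h2, -⟩ := exists_contMDiffMap_one_nhds_of_subset_interior (n := ⊤) (𝓡 1)
    (s := {circleCover z}) (t := circleCover '' Set.Ioo (z - ε) (z + ε)) isClosed_singleton (by
      rw [ho.interior_eq]
      exact Set.singleton_subset_iff.2 ⟨z, ⟨by linarith, by linarith⟩, rfl⟩)
  obtain ⟨W, hW, hWV⟩ := Ψ.exists_vertical_cutoff hV hVπ μ.contMDiff
  refine ⟨W, hW, fun t m hm => ?_, ?_⟩
  · rw [hWV, h2 _ hm, mul_zero, hV.2.2.2]
    rfl
  · rw [nhdsSet_singleton] at h1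
    filter_upwards [continuous_circleCover.continuousAt.eventually h1] with x hx t y
    rw [hWV, Ψ.proj', hx, mul_one]

/-- An isotopy moving a fiber less than once around the circle is, up to an isotopy fixing a
neighborhood of that fiber, one commutator of diffeomorphisms supported over an arc. -/
theorem exists_commutator_eq_near {r : ℕ∞} {g : ℝ → Equiv.Perm ℝ} (hg : g ∈ equivIsot r)
    {V : ℝ → Equiv.Perm M} (hV : V ∈ ξ.isotR r) (hVπ : ∀ t m, π (V t m) = π m) {z : ℝ}
    (hz : |g 1 z - z| < 1) :
    ∃ k, ξ.IsBallProduct r 1 k ∧ k⁻¹ * (Ψ.lift (g 1) * V 1) ∈ ξ.diffRel r {circleCover z} := by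
  set s := g 1 z - z with hs
  obtain ⟨a, α, δ, d, w, ε, hda, haα, hδd, hε, hαz, hzδ, hwα, hδw, c, hc, b, hb, hcz, hbw, hcs,
    α', δ', haα', hδd', hbs⟩ := exists_arc_pair r z hz
  -- The factor of the base isotopy `g` which fixes `z`.
  obtain ⟨hg1, hg2⟩ := mem_equivIsot.1 hg
  let θ : ℝ → ℝ := fun t => z - g t z
  have hθ : ContDiff ℝ r θ := contDiff_const.sub (hg1.1.comp (contDiff_id.prodMk contDiff_const))
  have hθ0 : θ 0 = 0 := by
    simp only [θ, hg1.2.2]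
    simp
  let u : ℝ → Equiv.Perm ℝ := fun t => Equiv.addRight (θ t) * g t
  have hu : u ∈ equivIsot r := Subgroup.mul_mem _ (translation_mem_equivIsot hθ hθ0) hg
  have huz : ∀ t, u t z = z := fun t => by
    show g t z + (z - g t z) = z
    ring
  obtain ⟨v, hv, η, hη, hvu, hvs⟩ := exists_cutoff_supportedInArc hu huz
    (lt_min hε (by norm_num) : 0 < min ε (1 / 4)) ((min_le_right _ _).trans_lt (by norm_num))
  obtain ⟨W, hW, hWs, hWV⟩ := Ψ.exists_vertical_cutoff_supported hV hVπ z hε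
  let A : ℝ → Equiv.Perm M := fun t => Ψ.lift (c t) * Ψ.lift (v t) * W t
  have hA : A ∈ ξ.isotR r := Subgroup.mul_mem _ (Subgroup.mul_mem _ (Ψ.lift_mem_isotR hc)
    (Ψ.lift_mem_isotR hv)) hW
  have hAs : ∀ t m, π m ∉ circleCover '' Set.Ioo α δ → A t m = m := by
    intro t m hm
    have h1 : π m ∉ circleCover '' Set.Ioo (z - ε) (z + ε) := fun h =>
      hm (Set.image_mono (Set.Ioo_subset_Ioo hαz hzδ) h)
    have h2 : π m ∉ circleCover '' Set.Ioo (z - min ε (1 / 4)) (z + min ε (1 / 4)) := fun h =>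
      h1 (Set.image_mono (Set.Ioo_subset_Ioo (by linarith [min_le_left ε (1 / 4)])
        (by linarith [min_le_left ε (1 / 4)])) h)
    show Ψ.lift (c t) (Ψ.lift (v t) (W t m)) = m
    rw [hWs t m h1, Ψ.lift_eq_self hv hvs t h2, Ψ.lift_eq_self hc hcs t hm]
  -- The isotopy `f` ends at the given diffeomorphism, and agrees with `A` near the fiber over `z`.
  let q : ℝ → Equiv.Perm ℝ := fun t =>
    Equiv.addRight (Real.smoothTransition t * s) * u (Real.smoothTransition t)
  have hq : q ∈ equivIsot r := Subgroup.mul_mem _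
    (translation_mem_equivIsot (Real.smoothTransition.contDiff.mul contDiff_const) (by simp))
    (smoothTransition_comp_mem_equivIsot hu)
  have hq1 : q 1 = g 1 := by
    ext x
    show u (Real.smoothTransition 1) x + Real.smoothTransition 1 * s = g 1 x
    rw [Real.smoothTransition.one]
    show g 1 x + (z - g 1 z) + 1 * s = g 1 x
    rw [hs]
    ring
  let f : ℝ → Equiv.Perm M := fun t => Ψ.lift (q t) * V t
  have hf : f ∈ ξ.isotR r := Subgroup.mul_mem _ (Ψ.lift_mem_isotR hq) hV
  have hAf : ∀ᶠ x in nhds z, ∀ t y, A t (Ψ.toMap (x, y)) = f t (Ψ.toMap (x, y)) := by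
    have h1 : ∀ᶠ x in nhds z, ∀ t ∈ Set.Icc (0 : ℝ) 1, |u t x - z| < ε := by
      refine isCompact_Icc.eventually_forall_of_forall_eventually fun t _ => ?_
      have h2 : Continuous fun p : ℝ × ℝ => |u p.2 p.1 - z| :=
        (((mem_equivIsot.1 hu).1.1.continuous.comp continuous_swap).sub continuous_const).abs
      refine h2.continuousAt.eventually_lt continuousAt_const ?_
      simpa [huz] using hε
    filter_upwards [h1, hWV, Metric.ball_mem_nhds z hη] with x hx1 hx2 hx3 t y
    have h3 : π (V t (Ψ.toMap (x, y))) = circleCover x := by rw [hVπ, Ψ.proj']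
    show Ψ.lift (c t) (Ψ.lift (v t) (W t (Ψ.toMap (x, y)))) =
      Ψ.lift (q t) (V t (Ψ.toMap (x, y)))
    rw [hx2, ← Ψ.toMap_fib' h3, Ψ.lift_toMap ((mem_equivIsot.1 hv).2 t),
      Ψ.lift_toMap ((mem_equivIsot.1 hc).2 t), Ψ.lift_toMap ((mem_equivIsot.1 hq).2 t),
      hvu t x hx3, hcz t _ (hx1 _ ⟨Real.smoothTransition.nonneg t, Real.smoothTransition.le_one t⟩)]
    rfl
  -- The conjugate of `A` by `B` is the identity near the fiber over `z`.
  set B := Ψ.lift (b 1) with hB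
  have hBarc : B ∈ ξ.arcDiff r a d := Ψ.lift_mem_arcDiff hb haα' hδd' hbs
  have hBA : ∀ᶠ x in nhds z, ∀ t y, (B * A t * B⁻¹) (Ψ.toMap (x, y)) = Ψ.toMap (x, y) := by
    filter_upwards [Metric.ball_mem_nhds z hε] with x hx t y
    have hx' : |x - (z - w) - w| < ε := by
      rw [show x - (z - w) - w = x - z by ring]
      exact hx
    have h1 : B (Ψ.toMap (x - (z - w), y)) = Ψ.toMap (x, y) := by
      rw [hB, Ψ.lift_toMap ((mem_equivIsot.1 hb).2 1), hbw _ hx', sub_add_cancel]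
    rw [← h1, Equiv.Perm.mul_apply, Equiv.Perm.mul_apply,
      show B⁻¹ (B (Ψ.toMap (x - (z - w), y))) = _ from B.symm_apply_apply _, hAs]
    rw [Ψ.proj']
    rw [abs_lt] at hx'
    exact circleCover_notMem_image_Ioo (by linarith) (by linarith)
  have hA1 : A 1 ∈ ξ.arcDiff r a d :=
    ⟨_, GammaBundle.restrict_mem_isotRel hA haα hδd hAs, rfl⟩
  refine ⟨⁅A 1, B⁆, GammaBundle.isBallProduct_commutator (by linarith) hda hA1 hBarc, ?_⟩
  have hA0 := GammaBundle.restrict_mem_isot₀ hA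
  have hc0 := GammaBundle.conj_mem_isot₀ ((ξ.isot₀ r).inv_mem hA0)
    (ξ.diff₀_le_bundleDiff r (ξ.diffRel_le_diff₀ r _ hBarc))
  have hR := (ξ.isot₀ r).mul_mem ((ξ.isot₀ r).inv_mem ((ξ.isot₀ r).mul_mem hA0 hc0))
    (GammaBundle.restrict_mem_isot₀ hf)
  obtain ⟨ρ, hρ, hρz⟩ := Metric.eventually_nhds_iff_ball.1 (hAf.and hBA)
  refine ⟨_, ⟨hR, circleCover '' Metric.ball z ρ, isOpenMap_circleCover _ Metric.isOpen_ball,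
    Set.singleton_subset_iff.2 ⟨z, Metric.mem_ball_self hρ, rfl⟩, fun t m hm => ?_⟩, ?_⟩
  · obtain ⟨x, hx, hxm⟩ := hm
    obtain ⟨h1, h2⟩ := hρz x hx
    rw [← Ψ.toMap_fib' hxm.symm]
    show (A t * (B * (A t)⁻¹ * B⁻¹))⁻¹ (f t (Ψ.toMap (x, _))) = _
    rw [← h1, Equiv.Perm.inv_eq_iff_eq,
      show A t * (B * (A t)⁻¹ * B⁻¹) = A t * (B * A t * B⁻¹)⁻¹ by group]
    have h3 := (Equiv.Perm.inv_eq_iff_eq (f := B * A t * B⁻¹)).2 (h2 t (Ψ.fib (x, m))).symm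
    exact (congrArg (A t) h3).symm
  · show (A 1 * (B * (A 1)⁻¹ * B⁻¹))⁻¹ * (Ψ.lift (q 1) * V 1) = _
    rw [hq1, commutatorElement_def]
    group

/-- An isotopy moving a fiber less than `n + 1` times around the circle ends at a product of `n + 3`
commutators. -/
theorem isBallProduct_of_abs_lt [Nonempty N] (hΓ : Γ ≤ diffGroup IN N ⊤) {r : ℕ∞}
    (hstar : AssumptionStar IN Γ r) {V : ℝ → Equiv.Perm M} (hV : V ∈ ξ.isotR r)
    (hVπ : ∀ t m, π (V t m) = π m) {z : ℝ} (n : ℕ) {g : ℝ → Equiv.Perm ℝ} (hg : g ∈ equivIsot r)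
    (hz : |g 1 z - z| < n + 1) : ξ.IsBallProduct r (n + 3) (Ψ.lift (g 1) * V 1) := by
  induction n generalizing g with
  | zero =>
    obtain ⟨k, hk, hk'⟩ := Ψ.exists_commutator_eq_near hg hV hVπ (z := z) (by simpa using hz)
    have := hk.mul (ξ.isBallProduct_two hΓ hstar hk')
    rwa [mul_inv_cancel_left] at this
  | succ n ih =>
    set s := g 1 z - z with hs
    push_cast at hz
    have hn : (0 : ℝ) < n + 1 + 1 := by positivity
    have hσ : |s / (n + 1 + 1)| < 1 := by
      rw [abs_div, abs_of_pos hn, div_lt_one hn]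
      exact hz
    -- A commutator of isotopies of the circle moves `g 1 z` back by the fraction `s / (n + 2)`.
    obtain ⟨a, α, δ, d, w, ε, hda, haα, hδd, hε, hαz, hzδ, hwα, hδw, c, hc, b, hb, hcz, hbw, hcs,
      α', δ', haα', hδd', hbs⟩ := exists_arc_pair r (g 1 z - s / (n + 1 + 1)) hσ
    set p := g 1 z - s / (n + 1 + 1) with hp
    have hcb : ⁅c, b⁆ ∈ equivIsot r := by
      rw [commutatorElement_def]
      exact Subgroup.mul_mem _ (Subgroup.mul_mem _ (Subgroup.mul_mem _ hc hb)
        (Subgroup.inv_mem _ hc)) (Subgroup.inv_mem _ hb)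
    have per : ∀ {g : ℝ → Equiv.Perm ℝ}, g ∈ equivIsot r → g 1 ∈ equivPerm := fun hg =>
      (mem_equivIsot.1 hg).2 1
    have h1 : ⁅c, b⁆ 1 p = g 1 z := by
      have e1 : (b 1)⁻¹ p = w := by
        rw [Equiv.Perm.inv_eq_iff_eq, hbw w (by simpa using hε)]
        ring
      have e2 : (c 1)⁻¹ w = w := by
        rw [Equiv.Perm.inv_eq_iff_eq, hcs 1 w]
        exact circleCover_notMem_image_Ioo (by linarith) (by linarith)
      have e3 : b 1 w = p := by
        rw [hbw w (by simpa using hε)]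
        ring
      show c 1 (b 1 ((c 1)⁻¹ ((b 1)⁻¹ p))) = _
      rw [e1, e2, e3, hcz 1 p (by simpa using hε), Real.smoothTransition.one, hp]
      ring
    have h2 : (⁅c, b⁆⁻¹ * g) 1 z = p := by
      show (⁅c, b⁆ 1)⁻¹ (g 1 z) = p
      rw [Equiv.Perm.inv_eq_iff_eq, h1]
    have h3 : p - z = s * ((n + 1) / (n + 1 + 1)) := by
      rw [hp, hs]
      field_simp
      ring
    have h4 := ih (Subgroup.mul_mem _ (Subgroup.inv_mem _ hcb) hg) (by
      rw [h2, h3, abs_mul, abs_of_pos (show (0 : ℝ) < (n + 1) / (n + 1 + 1) by positivity)]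
      rw [← mul_div_assoc, div_lt_iff₀ hn, mul_comm]
      exact mul_lt_mul_of_pos_left hz (by positivity))
    have h5 := (GammaBundle.isBallProduct_commutator (by linarith) hda
      (Ψ.lift_mem_arcDiff hc haα hδd hcs) (Ψ.lift_mem_arcDiff hb haα' hδd' hbs)).mul h4
    have h6 : ⁅Ψ.lift (c 1), Ψ.lift (b 1)⁆ = Ψ.lift (⁅c, b⁆ 1) := by
      show _ = Ψ.lift (c 1 * b 1 * (c 1)⁻¹ * (b 1)⁻¹)
      have pc := per hc
      have pb := per hb
      rw [Ψ.lift_mul (mul_mem (mul_mem pc pb) (inv_mem pc)) (inv_mem pb),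
        Ψ.lift_mul (mul_mem pc pb) (inv_mem pc), Ψ.lift_mul pc pb, Ψ.lift_inv pc, Ψ.lift_inv pb,
        commutatorElement_def]
    rw [h6, ← mul_assoc, ← Ψ.lift_mul (per hcb) (per (Subgroup.mul_mem _ (Subgroup.inv_mem _ hcb)
      hg)), Pi.mul_apply, Pi.inv_apply, mul_inv_cancel_left,
      show 1 + (n + 3) = n + 1 + 3 by ring] at h5
    exact h5

end DevelopingMap

end Fragmentation

/-! ### The bound on the commutator length -/

theorem theorem1
    {EN : Type*} [NormedAddCommGroup EN] [NormedSpace ℝ EN] [FiniteDimensional ℝ EN]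
    {HN : Type*} [TopologicalSpace HN] (IN : ModelWithCorners ℝ EN HN)
    {N : Type*} [TopologicalSpace N] [ChartedSpace HN N] [IsManifold IN ∞ N]
    [T2Space N] [SecondCountableTopology N] [Nonempty N]
    {EM : Type*} [NormedAddCommGroup EM] [NormedSpace ℝ EM] [FiniteDimensional ℝ EM]
    {HM : Type*} [TopologicalSpace HM] (IM : ModelWithCorners ℝ EM HM)
    {M : Type*} [TopologicalSpace M] [ChartedSpace HM M] [IsManifold IM ∞ M]
    [T2Space M] [SecondCountableTopology M]
    (Γ : Subgroup (Equiv.Perm N)) (hΓ : Γ ≤ diffGroup IN N ⊤)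
    (π : M → Circle) (ξ : GammaBundle (𝓡 1) IN IM Γ π)
    (r : ℕ∞) (p : Circle)
    (hk : 1 ≤ ξ.index r p)
    (hstar : AssumptionStar IN Γ r)
    (f : ξ.diff₀ r) (s : ℝ)
    (hs : s ∈ Set.Ioc (-(ξ.index r p : ℝ) / 2) ((ξ.index r p : ℝ) / 2))
    (hν : ξ.nuHat r p f = (s : AddCircle (ξ.index r p : ℝ))) :
    ξ.clb r f ≤ ((2 * ⌊|s|⌋₊ + 3 : ℕ) : ℕ∞) ∧ 2 * ⌊|s|⌋₊ + 3 ≤ ξ.index r p + 3 := by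
  obtain ⟨F, hF, hf⟩ := Subgroup.mem_map.1 f.2
  have hf : F 1 = f := hf
  -- Multiplication by a loop of isotopies makes `ν(F)` equal to `s`, and not only modulo `k`.
  obtain ⟨G, hG, hGf, hGs⟩ : ∃ G ∈ ξ.isot₀ r, G 1 = f ∧ nu π p G = s := by
    rw [ξ.nuHat_apply r p f hF hf, ← sub_eq_zero, ← AddCircle.coe_sub,
      AddCircle.coe_eq_zero_iff] at hν
    obtain ⟨m, hm⟩ := hν
    obtain ⟨L, hL, hLm⟩ : (ξ.index r p : ℝ) * ((-m : ℤ) : ℝ) ∈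
        nu π p '' (ξ.isotLoop r : Set (I → Equiv.Perm M)) := by
      rw [ξ.image_nu r p]
      exact ⟨-m, rfl⟩
    have hL1 : L 1 = 1 := hL.2
    refine ⟨F * L, Subgroup.mul_mem _ hF hL.1, by rw [Pi.mul_apply, hL1, mul_one, hf], ?_⟩
    rw [ξ.nu_mul p hF hL, hLm]
    rw [zsmul_eq_mul] at hm
    push_cast
    linarith
  obtain ⟨Ψ⟩ := exists_developingMap hΓ ξ
  obtain ⟨g, hg, V, hV, hVπ, hGV, hnu⟩ := Ψ.exists_decomposition hG
  have hz : g 1 (circleLift 0 p) - circleLift 0 p = s := by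
    rw [← hnu, circleCover_circleLift, hGs]
  obtain ⟨l, hl, hlb, hlf⟩ := Ψ.isBallProduct_of_abs_lt hΓ hstar hV hVπ (z := circleLift 0 p)
    ⌊|s|⌋₊ hg (by rw [hz]; exact Nat.lt_floor_add_one _)
  have hlf' : l.prod = f := Subtype.ext (by rw [hlf, ← hGV, hGf])
  constructor
  · refine (iInf_le _ ⟨l, hlb, hlf'⟩).trans ?_
    dsimp only
    rw [hl]
    exact_mod_cast (by omega : ⌊|s|⌋₊ + 3 ≤ 2 * ⌊|s|⌋₊ + 3)
  · have h1 : |s| ≤ (ξ.index r p : ℝ) / 2 := abs_le.2 ⟨by linarith [hs.1], hs.2⟩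
    have h2 : (⌊|s|⌋₊ : ℝ) ≤ |s| := Nat.floor_le (abs_nonneg s)
    have h3 : (2 * ⌊|s|⌋₊ : ℝ) ≤ ξ.index r p := by linarith
    have h4 : 2 * ⌊|s|⌋₊ ≤ ξ.index r p := by exact_mod_cast h3
    omega
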